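/- Let $D\subset\mathbb R^2$ be an open disc with a smooth Riemannian metric $g$, and let $M\subset D$ be a compact set with smooth boundary, so that $(M,g)$ is a compact oriented Riemannian surface with boundary $\partial M$. Let $\nu$ be the outer unit normal, let $v\mapsto v^\perp$ be the counterclockwise $g$-rotation by $90^\circ$, let $T=\nu^\perp$, let $\kappa=-\langle D_tT,\nu\rangle$ be the signed curvature of $\partial M$ (with $D_tT$ the covariant derivative of $T$ along $\partial M$ in direction $T$), and let $K$ be the Gaussian curvature of $M$. Let $\partial M=E\cup R$, where $E$ and $R$ are disjoint unions of connected components of $\partial M$ (either may be empty). Let $SM=\{(x,v): x\in M,\ v\in T_xM,\ |v|_g=1\}$, with its Sasaki volume measure (Riemannian area times angle), and let $\partial SM$ be the part of $SM$ over $\partial M$, with the induced measure (boundary length times angle). Put $SR=\{(x,v)\in SM: x\in R\}$, $R_0=\{(x,v)\in SR:\langle v,\nu\rangle=0\}$, and $\rho(x,v)=(x,v-2\langle v,\nu\rangle\nu)$ for $(x,v)\in\partial SM$. Let $X$ be the geodesic vector field on $SM$ (the generator of the geodesic flow) and $V$ the vertical vector field (the derivative in the angle variable). Suppose that $u:SM\to\mathbb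 R$ is Lipschitz continuous, $u\in C^1(SM\setminus R_0)\cap C^2(SM\setminus SR)$ (with derivatives continuous up to the remaining part of the boundary), that $u=u\circ\rho$ on $\partial SM$, and that $VXu\in L^2(SM)$. Then $XVu,\,Xu,\,Vu\in L^2(SM)$, $Vu\in L^2(\partial SM)$, and $$\|VXu\|^2_{L^2(SM)}=\|XVu\|^2_{L^2(SM)}+\|Xu\|^2_{L^2(SM)}-(KVu,Vu)_{L^2(SM)}-(\kappa Vu,Vu)_{L^2(\partial SM)}.$$ -/

import Mathlib

open MeasureTheory
open scoped ContDiff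

noncomputable section

namespace Pestov

/-- The plane `ℝ²` with its Euclidean norm, Lebesgue measure and standard orientation. -/
abbrev Plane := EuclideanSpace ℝ (Fin 2)

/-- A field of `2 × 2` matrices `x ↦ (g_{ij}(x))` on the plane. -/
abbrev MetricField := Plane → Matrix (Fin 2) (Fin 2) ℝ

/-- `g` is a smooth Riemannian metric on the open set `D`. -/
structure IsRiemannianMetricOn (g : MetricField) (D : Set Plane) : Prop where
  smooth : ∀ i j : Fin 2, ContDiffOn ℝ ∞ (fun x => g x i j) D
  posDef : ∀ x ∈ D, (g x).PosDef

/-- The inner product `⟨v, w⟩ = g_{ij}(x) v^i w^j` on the tangent space at `x`. -/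
def ip (g : MetricField) (x v w : Plane) : ℝ := ∑ i, ∑ j, g x i j * v i * w j

/-- The norm `|v|` of a tangent vector at `x`. -/
def gnorm (g : MetricField) (x v : Plane) : ℝ := Real.sqrt (ip g x v v)

/-- `v^⊥`, the rotation of `v` by 90 degrees counterclockwise with respect to `g`. -/
def perp (g : MetricField) (x v : Plane) : Plane :=
  (Real.sqrt (g x).det)⁻¹ •
    !₂[-(g x 1 0 * v 0 + g x 1 1 * v 1), g x 0 0 * v 0 + g x 0 1 * v 1]

/-- The partial derivative `∂f/∂x_i`. -/
def pd (i : Fin 2) (f : Plane → ℝ) (x : Plane) : ℝ :=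
  fderiv ℝ f x (EuclideanSpace.single i 1)

/-- The Christoffel symbols `Γ^l_{ij}` of `g`. -/
def christoffel (g : MetricField) (l i j : Fin 2) (x : Plane) : ℝ :=
  (1 / 2) * ∑ m, (g x)⁻¹ l m *
    (pd i (fun y => g y j m) x + pd j (fun y => g y i m) x - pd m (fun y => g y i j) x)

/-- The vector `Γ_x(v, w)` with components `Γ^l_{ij}(x) v^i w^j`. -/
def christoffelVec (g : MetricField) (x v w : Plane) : Plane :=
  WithLp.toLp 2 fun l => ∑ i, ∑ j, christoffel g l i j x * v i * w j

/-- The components `R(∂_i, ∂_j)∂_k = R_{ijk}^l ∂_l` of the curvature tensor, where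
`R(Y, Z)W = ∇_Y ∇_Z W - ∇_Z ∇_Y W - ∇_{[Y, Z]} W`. -/
def curvatureTensor (g : MetricField) (i j k l : Fin 2) (x : Plane) : ℝ :=
  pd i (christoffel g l j k) x - pd j (christoffel g l i k) x
    + ∑ m, (christoffel g l i m x * christoffel g m j k x
      - christoffel g l j m x * christoffel g m i k x)

/-- The Gaussian curvature `K = ⟨R(∂_1, ∂_2)∂_2, ∂_1⟩ / det g`. -/
def gaussCurvature (g : MetricField) (x : Plane) : ℝ :=
  (∑ l, g x 0 l * curvatureTensor g 0 1 1 l x) / (g x).det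

/-- `b` is a smooth defining function of `M` near the boundary point `x`: near `x` the set `M`
is `{b ≤ 0}`, and `db ≠ 0` at `x`. -/
def IsLocalDefiningFunction (M : Set Plane) (x : Plane) (b : Plane → ℝ) : Prop :=
  ∃ U : Set Plane, IsOpen U ∧ x ∈ U ∧ ContDiffOn ℝ ∞ b U ∧ fderiv ℝ b x ≠ 0 ∧
    M ∩ U = {y ∈ U | b y ≤ 0}

/-- `M` is a compact region of the plane with smooth boundary `∂M = frontier M`. -/
structure IsCompactSmoothDomain (M : Set Plane) : Prop where
  isCompact : IsCompact M
  boundary : ∀ x ∈ frontier M, ∃ b, IsLocalDefiningFunction M x b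

/-- `n` is the outer unit normal of `M` at `x`: it has `g`-length one, and it is a positive
multiple of the `g`-gradient of a defining function. -/
def IsOuterUnitNormal (g : MetricField) (M : Set Plane) (x n : Plane) : Prop :=
  ip g x n n = 1 ∧ ∃ b, IsLocalDefiningFunction M x b ∧
    ∃ c : ℝ, 0 < c ∧ ∀ w, ip g x n w = c * fderiv ℝ b x w

open Classical in
/-- The outer unit normal `ν` of `M` (zero at points where there is none). -/
def outerNormal (g : MetricField) (M : Set Plane) (x : Plane) : Plane :=
  if h : ∃ n, IsOuterUnitNormal g M x n then h.choose else 0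

/-- The oriented unit tangent vector `T = ν^⊥` of `∂M`. -/
def bdryTangent (g : MetricField) (M : Set Plane) (x : Plane) : Plane :=
  perp g x (outerNormal g M x)

/-- The signed curvature `κ = -⟨D_t T, ν⟩` of `∂M`, where `D_t T` is the covariant derivative of
`T` along `∂M` in the direction `T`. The derivative of `T` within the curve `∂M` is only
evaluated in the tangential direction, where it is uniquely determined. -/
def signedCurvature (g : MetricField) (M : Set Plane) (x : Plane) : ℝ :=
  -ip g x
    (fderivWithin ℝ (bdryTangent g M) (frontier M) x (bdryTangent g M x)
      + christoffelVec g x (bdryTangent g M x) (bdryTangent g M x))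
    (outerNormal g M x)

/-- The unit circle bundle `SM`, as a set of pairs `(x, v)`. -/
def unitBundle (g : MetricField) (M : Set Plane) : Set (Plane × Plane) :=
  {p | p.1 ∈ M ∧ ip g p.1 p.2 p.2 = 1}

/-- The part of `SM` over `A`, for `A` a part of the boundary, where `v` is tangent to `∂M`.
For `A = R` this is `R₀`. -/
def tangentialPart (g : MetricField) (M A : Set Plane) : Set (Plane × Plane) :=
  {p ∈ unitBundle g A | ip g p.1 p.2 (outerNormal g M p.1) = 0}

/-- The reflection `ρ(x, v) = (x, v - 2⟨v, ν⟩ν)`. -/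
def reflection (g : MetricField) (M : Set Plane) (p : Plane × Plane) : Plane × Plane :=
  (p.1, p.2 - (2 * ip g p.1 p.2 (outerNormal g M p.1)) • outerNormal g M p.1)

/-- The map `(x, y) ↦ (x, y/|y|)` of `TM ∖ 0` onto `SM`. -/
def toUnit (g : MetricField) (p : Plane × Plane) : Plane × Plane :=
  (p.1, (gnorm g p.1 p.2)⁻¹ • p.2)

/-- The extension of a function on `SM` that is homogeneous of degree zero in `y`. -/
def homExt (g : MetricField) (u : Plane × Plane → ℝ) (p : Plane × Plane) : ℝ := u (toUnit g p)

/-- The tangent bundle of `M` without its zero section. -/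
def slitTangent (M : Set Plane) : Set (Plane × Plane) := {p | p.1 ∈ M ∧ p.2 ≠ 0}

/-- `u ∈ C^k(SM ∖ A)`, up to those boundary points of `SM` that are not in `A`: the extension of
`u` is `C^k` on the cone over `SM ∖ A`. -/
def ContDiffSM (g : MetricField) (M : Set Plane) (k : ℕ) (A : Set (Plane × Plane))
    (u : Plane × Plane → ℝ) : Prop :=
  ContDiffOn ℝ k (homExt g u) {p ∈ slitTangent M | toUnit g p ∉ A}

/-- The derivative of the extension of `u` (one-sided at boundary points of `M`). -/
def dSM (g : MetricField) (M : Set Plane) (u : Plane × Plane → ℝ) (p : Plane × Plane) :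
    Plane × Plane →L[ℝ] ℝ :=
  fderivWithin ℝ (homExt g u) (slitTangent M) p

/-- The geodesic vector field `X = v^i ∂_{x_i} - Γ^l_{ij} v^i v^j ∂_{v_l}` on `SM`, the generator
of the geodesic flow. -/
def X (g : MetricField) (M : Set Plane) (u : Plane × Plane → ℝ) (p : Plane × Plane) : ℝ :=
  dSM g M u p (p.2, -christoffelVec g p.1 p.2 p.2)

/-- The vertical vector field `V` on `SM`, `Vu = ⟨v^⊥, ∂u⟩`. -/
def V (g : MetricField) (M : Set Plane) (u : Plane × Plane → ℝ) (p : Plane × Plane) : ℝ :=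
  dSM g M u p (0, perp g p.1 p.2)

/-- The unit vector at `x` that makes the oriented `g`-angle `θ` with `∂/∂x_1`. -/
def unitVec (g : MetricField) (x : Plane) (θ : ℝ) : Plane :=
  let e : Plane := (Real.sqrt (g x 0 0))⁻¹ • EuclideanSpace.single 0 1
  Real.cos θ • e + Real.sin θ • perp g x e

/-- The parametrization of the unit circle bundle by base point and angle. -/
def angleParam (g : MetricField) (q : Plane × ℝ) : Plane × Plane := (q.1, unitVec g q.1 q.2)

/-- The Riemannian area measure of `M`. -/
def areaMeasure (g : MetricField) (M : Set Plane) : Measure Plane :=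
  (volume.restrict M).withDensity fun x => ENNReal.ofReal (Real.sqrt (g x).det)

/-- The Riemannian length measure of `∂M`: since `T` has `g`-length one, the `g`-length element is
the Euclidean one (one-dimensional Hausdorff measure) divided by the Euclidean length of `T`. -/
def lengthMeasure (g : MetricField) (M : Set Plane) : Measure Plane :=
  ((Measure.hausdorffMeasure 1).restrict (frontier M)).withDensity
    fun x => ENNReal.ofReal ‖bdryTangent g M x‖⁻¹

/-- The volume measure of the Sasaki metric on `SM`, which is area times angle. -/
def volSM (g : MetricField) (M : Set Plane) : Measure (Plane × Plane) :=
  ((areaMeasure g M).prod (volume.restrict (Set.Ioc 0 (2 * Real.pi)))).map (angleParam g)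

/-- The measure induced by the Sasaki metric on `∂(SM)`, which is boundary length times angle. -/
def volBdrySM (g : MetricField) (M : Set Plane) : Measure (Plane × Plane) :=
  ((lengthMeasure g M).prod (volume.restrict (Set.Ioc 0 (2 * Real.pi)))).map (angleParam g)

end Pestov

end

open Pestov

noncomputable section

namespace Pestov

variable {g : MetricField} {D : Set Plane}

/-- The coordinate vector `∂_i`. -/
abbrev basisVec (i : Fin 2) : Plane := EuclideanSpace.single i 1

lemma plane_eq (v : Plane) : v = v 0 • basisVec 0 + v 1 • basisVec 1 := by
  ext i; fin_cases i <;> simp [basisVec]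

lemma plane_ext {v w : Plane} (h0 : v 0 = w 0) (h1 : v 1 = w 1) : v = w := by
  ext i; fin_cases i <;> assumption

lemma IsRiemannianMetricOn.symm (hg : IsRiemannianMetricOn g D) {x : Plane} (hx : x ∈ D)
    (i j : Fin 2) : g x i j = g x j i := by
  have := (hg.posDef x hx).isHermitian.apply i j
  simpa using this.symm

lemma IsRiemannianMetricOn.det_pos (hg : IsRiemannianMetricOn g D) {x : Plane} (hx : x ∈ D) :
    0 < (g x).det := (hg.posDef x hx).det_pos

lemma IsRiemannianMetricOn.diag_pos (hg : IsRiemannianMetricOn g D) {x : Plane} (hx : x ∈ D) :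
    0 < g x 0 0 := (hg.posDef x hx).diag_pos

lemma ip_eq (g : MetricField) (x v w : Plane) :
    ip g x v w = g x 0 0 * v 0 * w 0 + g x 0 1 * v 0 * w 1 + g x 1 0 * v 1 * w 0
      + g x 1 1 * v 1 * w 1 := by
  simp only [ip, Fin.sum_univ_two]; ring

lemma ip_comm' (hg : IsRiemannianMetricOn g D) {x : Plane} (hx : x ∈ D) (v w : Plane) :
    ip g x v w = ip g x w v := by
  rw [ip_eq, ip_eq, hg.symm hx 1 0]; ring

lemma ip_add_left (g : MetricField) (x v v' w : Plane) :
    ip g x (v + v') w = ip g x v w + ip g x v' w := by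
  simp only [ip_eq, PiLp.add_apply]; ring

lemma ip_add_right (g : MetricField) (x v w w' : Plane) :
    ip g x v (w + w') = ip g x v w + ip g x v w' := by
  simp only [ip_eq, PiLp.add_apply]; ring

lemma ip_smul_left (g : MetricField) (x : Plane) (c : ℝ) (v w : Plane) :
    ip g x (c • v) w = c * ip g x v w := by
  simp only [ip_eq, PiLp.smul_apply, smul_eq_mul]; ring

lemma ip_smul_right (g : MetricField) (x : Plane) (c : ℝ) (v w : Plane) :
    ip g x v (c • w) = c * ip g x v w := by
  simp only [ip_eq, PiLp.smul_apply, smul_eq_mul]; ring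

lemma ip_neg_left (g : MetricField) (x : Plane) (v w : Plane) :
    ip g x (-v) w = - ip g x v w := by
  simp only [ip_eq, PiLp.neg_apply]; ring

lemma ip_neg_right (g : MetricField) (x : Plane) (v w : Plane) :
    ip g x v (-w) = - ip g x v w := by
  simp only [ip_eq, PiLp.neg_apply]; ring

lemma ip_sub_left (g : MetricField) (x v v' w : Plane) :
    ip g x (v - v') w = ip g x v w - ip g x v' w := by
  simp only [ip_eq, PiLp.sub_apply]; ring

lemma ip_self_pos (hg : IsRiemannianMetricOn g D) {x : Plane} (hx : x ∈ D) {v : Plane}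
    (hv : v ≠ 0) : 0 < ip g x v v := by
  have hd := hg.det_pos hx
  have h0 := hg.diag_pos hx
  rw [Matrix.det_fin_two, hg.symm hx 1 0] at hd
  have key : g x 0 0 * ip g x v v = (g x 0 0 * v 0 + g x 0 1 * v 1) ^ 2
      + (g x 0 0 * g x 1 1 - g x 0 1 * g x 0 1) * (v 1) ^ 2 := by
    rw [ip_eq, hg.symm hx 1 0]; ring
  have : 0 < g x 0 0 * ip g x v v := by
    rw [key]
    by_cases h1 : v 1 = 0
    · have h2 : g x 0 0 * v 0 ≠ 0 := mul_ne_zero h0.ne' fun h => hv (plane_ext h h1)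
      have h3 : 0 < (g x 0 0 * v 0) ^ 2 := by positivity
      simpa only [h1, mul_zero, add_zero, ne_eq, OfNat.ofNat_ne_zero, not_false_eq_true, zero_pow] using h3
    · have := pow_pos (abs_pos.mpr h1) 2
      rw [sq_abs] at this
      exact add_pos_of_nonneg_of_pos (sq_nonneg _) (mul_pos hd this)
  exact pos_of_mul_pos_right this h0.le

lemma perp_zero_apply (g : MetricField) (x v : Plane) :
    perp g x v 0 = (Real.sqrt (g x).det)⁻¹ * -(g x 1 0 * v 0 + g x 1 1 * v 1) := by
  simp [perp]

lemma perp_one_apply (g : MetricField) (x v : Plane) :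
    perp g x v 1 = (Real.sqrt (g x).det)⁻¹ * (g x 0 0 * v 0 + g x 0 1 * v 1) := by
  simp [perp]

lemma perp_add (g : MetricField) (x v w : Plane) :
    perp g x (v + w) = perp g x v + perp g x w := by
  apply plane_ext <;>
    simp only [perp_zero_apply, perp_one_apply, PiLp.add_apply] <;> ring

lemma perp_smul (g : MetricField) (x : Plane) (c : ℝ) (v : Plane) :
    perp g x (c • v) = c • perp g x v := by
  apply plane_ext <;>
    simp only [perp_zero_apply, perp_one_apply, PiLp.smul_apply, smul_eq_mul] <;> ring

lemma perp_neg (g : MetricField) (x : Plane) (v : Plane) :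
    perp g x (-v) = - perp g x v := by
  apply plane_ext <;>
    simp only [perp_zero_apply, perp_one_apply, PiLp.neg_apply] <;> ring

lemma inv_sqrt_det_sq (hg : IsRiemannianMetricOn g D) {x : Plane} (hx : x ∈ D) :
    (Real.sqrt (g x).det)⁻¹ ^ 2 * (g x 0 0 * g x 1 1 - g x 0 1 * g x 1 0) = 1 := by
  have hd := hg.det_pos hx
  have h2 := Real.sq_sqrt hd.le
  have h3 : Real.sqrt (g x).det ≠ 0 := (Real.sqrt_pos.mpr hd).ne'
  rw [← Matrix.det_fin_two]
  nth_rewrite 2 [← h2]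
  field_simp

lemma perp_perp (hg : IsRiemannianMetricOn g D) {x : Plane} (hx : x ∈ D) (v : Plane) :
    perp g x (perp g x v) = -v := by
  have h := inv_sqrt_det_sq hg hx
  have hs := hg.symm hx 1 0
  rw [hs] at h
  apply plane_ext <;>
    simp only [perp_zero_apply, perp_one_apply, PiLp.neg_apply, hs]
  · linear_combination (- v 0) * h
  · linear_combination (- v 1) * h

lemma ip_perp_perp (hg : IsRiemannianMetricOn g D) {x : Plane} (hx : x ∈ D) (v w : Plane) :
    ip g x (perp g x v) (perp g x w) = ip g x v w := by
  have h := inv_sqrt_det_sq hg hx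
  have hs := hg.symm hx 1 0
  rw [hs] at h
  rw [ip_eq, ip_eq]
  simp only [perp_zero_apply, perp_one_apply, hs]
  linear_combination (g x 0 0 * v 0 * w 0 + g x 0 1 * v 0 * w 1 + g x 0 1 * v 1 * w 0
      + g x 1 1 * v 1 * w 1) * h

lemma ip_self_perp (hg : IsRiemannianMetricOn g D) {x : Plane} (hx : x ∈ D) (v : Plane) :
    ip g x v (perp g x v) = 0 := by
  have hs := hg.symm hx 1 0
  rw [ip_eq]
  simp only [perp_zero_apply, perp_one_apply, hs]
  ring

/-- A vector is determined by its components in the frame `(e, e^⊥)`. -/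
lemma eq_ip_smul_add (hg : IsRiemannianMetricOn g D) {x : Plane} (hx : x ∈ D) {e : Plane}
    (he : ip g x e e = 1) (z : Plane) :
    z = ip g x z e • e + ip g x z (perp g x e) • perp g x e := by
  have h := inv_sqrt_det_sq hg hx
  have hs := hg.symm hx 1 0
  rw [hs] at h
  set β := (Real.sqrt (g x).det)⁻¹ with hβ
  rw [ip_eq, hs] at he
  apply plane_ext <;>
    simp only [PiLp.add_apply, PiLp.smul_apply, smul_eq_mul, ip_eq, perp_zero_apply,
      perp_one_apply, hs, ← hβ]
  · linear_combination (-z 0) * he - (g x 0 1 * e 0 + g x 1 1 * e 1) * (z 0 * e 1 - z 1 * e 0) * h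
  · linear_combination (-z 1) * he + (g x 0 0 * e 0 + g x 0 1 * e 1) * (z 0 * e 1 - z 1 * e 0) * h

lemma cross_perp (hg : IsRiemannianMetricOn g D) {x : Plane} (hx : x ∈ D) (v : Plane) :
    v 0 * perp g x v 1 - v 1 * perp g x v 0 = (Real.sqrt (g x).det)⁻¹ * ip g x v v := by
  have hs := hg.symm hx 1 0
  rw [ip_eq]
  simp only [perp_zero_apply, perp_one_apply, hs]
  ring

lemma christoffelVec_apply (g : MetricField) (x v w : Plane) (l : Fin 2) :
    christoffelVec g x v w l = ∑ i, ∑ j, christoffel g l i j x * v i * w j := rfl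

lemma christoffelVec_add_left (g : MetricField) (x v v' w : Plane) :
    christoffelVec g x (v + v') w = christoffelVec g x v w + christoffelVec g x v' w := by
  apply plane_ext <;>
    simp only [christoffelVec_apply, Fin.sum_univ_two, PiLp.add_apply] <;> ring

lemma christoffelVec_add_right (g : MetricField) (x v w w' : Plane) :
    christoffelVec g x v (w + w') = christoffelVec g x v w + christoffelVec g x v w' := by
  apply plane_ext <;>
    simp only [christoffelVec_apply, Fin.sum_univ_two, PiLp.add_apply] <;> ring

lemma christoffelVec_smul_left (g : MetricField) (x : Plane) (c : ℝ) (v w : Plane) :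
    christoffelVec g x (c • v) w = c • christoffelVec g x v w := by
  apply plane_ext <;>
    simp only [christoffelVec_apply, Fin.sum_univ_two, PiLp.smul_apply, smul_eq_mul] <;> ring

lemma christoffelVec_smul_right (g : MetricField) (x : Plane) (c : ℝ) (v w : Plane) :
    christoffelVec g x v (c • w) = c • christoffelVec g x v w := by
  apply plane_ext <;>
    simp only [christoffelVec_apply, Fin.sum_univ_two, PiLp.smul_apply, smul_eq_mul] <;> ring

lemma IsRiemannianMetricOn.pd_symm (hg : IsRiemannianMetricOn g D) (hD : IsOpen D) {x : Plane}
    (hx : x ∈ D) (k i j : Fin 2) : pd k (fun y => g y i j) x = pd k (fun y => g y j i) x := by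
  have : (fun y => g y i j) =ᶠ[nhds x] fun y => g y j i :=
    Filter.eventually_of_mem (hD.mem_nhds hx) fun y hy => hg.symm hy i j
  simp only [pd, this.fderiv_eq]

lemma christoffel_symm (hg : IsRiemannianMetricOn g D) (hD : IsOpen D) {x : Plane}
    (hx : x ∈ D) (l i j : Fin 2) : christoffel g l i j x = christoffel g l j i x := by
  simp only [christoffel]
  congr 1
  refine Finset.sum_congr rfl fun m _ => ?_
  rw [hg.pd_symm hD hx m i j]; ring

lemma christoffelVec_symm (hg : IsRiemannianMetricOn g D) (hD : IsOpen D) {x : Plane}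
    (hx : x ∈ D) (v w : Plane) : christoffelVec g x v w = christoffelVec g x w v := by
  apply plane_ext <;>
    simp only [christoffelVec_apply, Fin.sum_univ_two, christoffel_symm hg hD hx _ 1 0] <;> ring

/-- Lowering the upper index of the Christoffel symbols. -/
lemma christoffel_lower (hg : IsRiemannianMetricOn g D) {x : Plane} (hx : x ∈ D)
    (k i j : Fin 2) : g x k 0 * christoffel g 0 i j x + g x k 1 * christoffel g 1 i j x =
      (1 / 2) * (pd i (fun y => g y j k) x + pd j (fun y => g y i k) x
        - pd k (fun y => g y i j) x) := by
  have hu : IsUnit (g x).det := (hg.det_pos hx).ne'.isUnit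
  have h := Matrix.mul_nonsing_inv (g x) hu
  have h0 := congrFun (congrFun h k) 0
  have h1 := congrFun (congrFun h k) 1
  simp only [Matrix.mul_apply, Fin.sum_univ_two] at h0 h1
  simp only [christoffel, Fin.sum_univ_two]
  fin_cases k
  · simp [Matrix.one_apply] at h0 h1 ⊢
    linear_combination (1 / 2) * (pd i (fun y => g y j 0) x + pd j (fun y => g y i 0) x
        - pd 0 (fun y => g y i j) x) * h0 + (1 / 2) * (pd i (fun y => g y j 1) x
        + pd j (fun y => g y i 1) x - pd 1 (fun y => g y i j) x) * h1
  · simp [Matrix.one_apply] at h0 h1 ⊢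
    linear_combination (1 / 2) * (pd i (fun y => g y j 0) x + pd j (fun y => g y i 0) x
        - pd 0 (fun y => g y i j) x) * h0 + (1 / 2) * (pd i (fun y => g y j 1) x
        + pd j (fun y => g y i 1) x - pd 1 (fun y => g y i j) x) * h1

/-- Metric compatibility of the Levi-Civita connection. -/
lemma metric_compat (hg : IsRiemannianMetricOn g D) (hD : IsOpen D) {x : Plane} (hx : x ∈ D)
    (i j k : Fin 2) : pd i (fun y => g y j k) x =
      (g x k 0 * christoffel g 0 i j x + g x k 1 * christoffel g 1 i j x)
      + (g x j 0 * christoffel g 0 i k x + g x j 1 * christoffel g 1 i k x) := by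
  rw [christoffel_lower hg hx, christoffel_lower hg hx, hg.pd_symm hD hx j i k,
    hg.pd_symm hD hx k i j, hg.pd_symm hD hx i k j, hg.pd_symm hD hx j k i,
    hg.pd_symm hD hx k j i]
  ring

lemma fderiv_eq_pd (f : Plane → ℝ) (x a : Plane) :
    fderiv ℝ f x a = a 0 * pd 0 f x + a 1 * pd 1 f x := by
  conv_lhs => rw [plane_eq a]
  simp [pd, basisVec]

lemma IsRiemannianMetricOn.differentiableAt (hg : IsRiemannianMetricOn g D) (hD : IsOpen D)
    {x : Plane} (hx : x ∈ D) (i j : Fin 2) : DifferentiableAt ℝ (fun y => g y i j) x :=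
  ((hg.smooth i j).contDiffAt (hD.mem_nhds hx)).differentiableAt (by simp)

lemma hasFDerivAt_coord {P : Plane → Plane} {x : Plane} {P' : Plane →L[ℝ] Plane}
    (hP : HasFDerivAt P P' x) (i : Fin 2) :
    HasFDerivAt (fun y => P y i) ((EuclideanSpace.proj i : Plane →L[ℝ] ℝ) ∘L P') x :=
  HasFDerivAt.comp x (EuclideanSpace.proj i : Plane →L[ℝ] ℝ).hasFDerivAt hP

/-- Product rule for the metric pairing of two vector fields. -/
lemma fderiv_ip (hg : IsRiemannianMetricOn g D) (hD : IsOpen D) {x : Plane} (hx : x ∈ D)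
    {P Q : Plane → Plane} {P' Q' : Plane →L[ℝ] Plane} (hP : HasFDerivAt P P' x)
    (hQ : HasFDerivAt Q Q' x) (a : Plane) :
    fderiv ℝ (fun y => ip g y (P y) (Q y)) x a =
      ip g x (P' a + christoffelVec g x a (P x)) (Q x)
      + ip g x (P x) (Q' a + christoffelVec g x a (Q x)) := by
  have hG := fun i j => (hg.differentiableAt hD hx i j).hasFDerivAt
  have hfun : (fun y => ip g y (P y) (Q y)) = fun y => g y 0 0 * P y 0 * Q y 0
      + g y 0 1 * P y 0 * Q y 1 + g y 1 0 * P y 1 * Q y 0 + g y 1 1 * P y 1 * Q y 1 := by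
    funext y; exact ip_eq g y _ _
  have hp := fun i => hasFDerivAt_coord hP i
  have hq := fun i => hasFDerivAt_coord hQ i
  have h := (((((hG 0 0).mul (hp 0)).mul (hq 0)).add (((hG 0 1).mul (hp 0)).mul (hq 1))).add
    (((hG 1 0).mul (hp 1)).mul (hq 0))).add (((hG 1 1).mul (hp 1)).mul (hq 1))
  rw [hfun]
  refine (congrArg (fun L : Plane →L[ℝ] ℝ => L a) h.fderiv).trans ?_
  simp only [add_apply, smul_apply, Pi.mul_apply,
    ContinuousLinearMap.comp_apply, PiLp.proj_apply, smul_eq_mul, fderiv_eq_pd,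
    metric_compat hg hD hx, ip_eq, PiLp.add_apply, christoffelVec_apply, Fin.sum_univ_two,
    hg.symm hx 1 0]
  ring

end Pestov
end

noncomputable section

namespace Pestov

variable {g : MetricField} {D : Set Plane}

/-- The first vector of the orthonormal frame, the normalized `∂_1`. -/
def frameE (g : MetricField) (x : Plane) : Plane :=
  (Real.sqrt (g x 0 0))⁻¹ • EuclideanSpace.single 0 1

/-- The second vector of the orthonormal frame. -/
def frameF (g : MetricField) (x : Plane) : Plane := perp g x (frameE g x)

lemma unitVec_eq (g : MetricField) (x : Plane) (θ : ℝ) :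
    unitVec g x θ = Real.cos θ • frameE g x + Real.sin θ • frameF g x := rfl

lemma frameE_zero (g : MetricField) (x : Plane) : frameE g x 0 = (Real.sqrt (g x 0 0))⁻¹ := by
  simp [frameE]

lemma frameE_one (g : MetricField) (x : Plane) : frameE g x 1 = 0 := by
  simp [frameE]

lemma ip_frameE (hg : IsRiemannianMetricOn g D) {x : Plane} (hx : x ∈ D) :
    ip g x (frameE g x) (frameE g x) = 1 := by
  have h0 := hg.diag_pos hx
  have h2 := Real.sq_sqrt h0.le
  have h3 : Real.sqrt (g x 0 0) ≠ 0 := (Real.sqrt_pos.mpr h0).ne'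
  rw [ip_eq, frameE_zero, frameE_one]
  field_simp
  linarith

lemma ip_frameF (hg : IsRiemannianMetricOn g D) {x : Plane} (hx : x ∈ D) :
    ip g x (frameF g x) (frameF g x) = 1 := by
  rw [frameF, ip_perp_perp hg hx, ip_frameE hg hx]

lemma ip_frameE_frameF (hg : IsRiemannianMetricOn g D) {x : Plane} (hx : x ∈ D) :
    ip g x (frameE g x) (frameF g x) = 0 := ip_self_perp hg hx _

lemma contDiffOn_plane {P : Plane → Plane} {s : Set Plane} {n : ℕ∞ω}
    (h0 : ContDiffOn ℝ n (fun x => P x 0) s) (h1 : ContDiffOn ℝ n (fun x => P x 1) s) :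
    ContDiffOn ℝ n P s := by
  rw [contDiffOn_euclidean]
  intro i; fin_cases i <;> assumption

lemma contDiffOn_det (hg : IsRiemannianMetricOn g D) :
    ContDiffOn ℝ ∞ (fun x => (g x).det) D := by
  simp only [Matrix.det_fin_two]
  exact ((hg.smooth 0 0).mul (hg.smooth 1 1)).sub ((hg.smooth 0 1).mul (hg.smooth 1 0))

lemma contDiffOn_sqrt_det (hg : IsRiemannianMetricOn g D) :
    ContDiffOn ℝ ∞ (fun x => Real.sqrt (g x).det) D :=
  (contDiffOn_det hg).sqrt fun _ hx => (hg.det_pos hx).ne'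

lemma sqrt_det_pos (hg : IsRiemannianMetricOn g D) {x : Plane} (hx : x ∈ D) :
    0 < Real.sqrt (g x).det := Real.sqrt_pos.mpr (hg.det_pos hx)

lemma contDiffOn_perp (hg : IsRiemannianMetricOn g D) {s : Set Plane} (hs : s ⊆ D)
    {n : ℕ∞} {P : Plane → Plane}
    (hP : ContDiffOn ℝ n P s) : ContDiffOn ℝ n (fun x => perp g x (P x)) s := by
  have hp : ∀ i, ContDiffOn ℝ n (fun x => P x i) s := contDiffOn_euclidean.mp hP
  have hG : ∀ i j, ContDiffOn ℝ n (fun x => g x i j) s := fun i j =>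
    ((hg.smooth i j).mono hs).of_le (by exact_mod_cast le_top)
  have hd : ContDiffOn ℝ n (fun x => (Real.sqrt (g x).det)⁻¹) s :=
    (((contDiffOn_sqrt_det hg).mono hs).of_le (by exact_mod_cast le_top)).inv
      fun x hx => (sqrt_det_pos hg (hs hx)).ne'
  apply contDiffOn_plane
  · simp only [perp_zero_apply]
    exact hd.mul (((hG 1 0).mul (hp 0)).add ((hG 1 1).mul (hp 1))).neg
  · simp only [perp_one_apply]
    exact hd.mul (((hG 0 0).mul (hp 0)).add ((hG 0 1).mul (hp 1)))

lemma contDiffOn_frameE (hg : IsRiemannianMetricOn g D) : ContDiffOn ℝ ∞ (frameE g) D := by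
  unfold frameE
  exact (((hg.smooth 0 0).sqrt fun x hx => (hg.diag_pos hx).ne').inv
    fun x hx => (Real.sqrt_pos.mpr (hg.diag_pos hx)).ne').smul contDiffOn_const

lemma contDiffOn_frameF (hg : IsRiemannianMetricOn g D) : ContDiffOn ℝ ∞ (frameF g) D :=
  contDiffOn_perp hg subset_rfl (contDiffOn_frameE hg)

lemma contDiffOn_pd (hD : IsOpen D) {f : Plane → ℝ} (hf : ContDiffOn ℝ ∞ f D) (i : Fin 2) :
    ContDiffOn ℝ ∞ (pd i f) D :=
  ((hf.fderiv_of_isOpen hD (m := ∞) (by simp)).clm_apply contDiffOn_const)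

lemma inv_apply_two (A : Matrix (Fin 2) (Fin 2) ℝ) :
    A⁻¹ = A.det⁻¹ • !![A 1 1, -A 0 1; -A 1 0, A 0 0] := by
  rw [Matrix.inv_def, Ring.inverse_eq_inv', Matrix.adjugate_fin_two]

lemma contDiffOn_inv (hg : IsRiemannianMetricOn g D) (l m : Fin 2) :
    ContDiffOn ℝ ∞ (fun x => (g x)⁻¹ l m) D := by
  have hd : ContDiffOn ℝ ∞ (fun x => (g x).det⁻¹) D :=
    (contDiffOn_det hg).inv fun x hx => (hg.det_pos hx).ne'
  simp only [inv_apply_two, Matrix.smul_apply, smul_eq_mul]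
  refine hd.mul ?_
  fin_cases l <;> fin_cases m <;>
    simp <;> first | exact hg.smooth _ _ | exact (hg.smooth _ _).neg

lemma contDiffOn_christoffel (hg : IsRiemannianMetricOn g D) (hD : IsOpen D) (l i j : Fin 2) :
    ContDiffOn ℝ ∞ (christoffel g l i j) D := by
  unfold christoffel
  refine contDiffOn_const.mul (ContDiffOn.sum fun m _ => (contDiffOn_inv hg l m).mul ?_)
  exact ((contDiffOn_pd hD (hg.smooth _ _) _).add (contDiffOn_pd hD (hg.smooth _ _) _)).sub
    (contDiffOn_pd hD (hg.smooth _ _) _)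

lemma contDiffOn_christoffelVec (hg : IsRiemannianMetricOn g D) (hD : IsOpen D) {s : Set Plane}
    (hs : s ⊆ D) {n : ℕ∞} {P Q : Plane → Plane} (hP : ContDiffOn ℝ n P s)
    (hQ : ContDiffOn ℝ n Q s) : ContDiffOn ℝ n (fun x => christoffelVec g x (P x) (Q x)) s := by
  have hp : ∀ i, ContDiffOn ℝ n (fun x => P x i) s := contDiffOn_euclidean.mp hP
  have hq : ∀ i, ContDiffOn ℝ n (fun x => Q x i) s := contDiffOn_euclidean.mp hQ
  refine contDiffOn_euclidean.mpr fun l => ?_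
  simp only [christoffelVec_apply]
  refine ContDiffOn.sum fun i _ => ContDiffOn.sum fun j _ => ((ContDiffOn.mul ?_ (hp i)).mul (hq j))
  exact ((contDiffOn_christoffel hg hD l i j).mono hs).of_le (by exact_mod_cast le_top)

lemma contDiffOn_ip (hg : IsRiemannianMetricOn g D) {s : Set Plane}
    (hs : s ⊆ D) {n : ℕ∞} {P Q : Plane → Plane} (hP : ContDiffOn ℝ n P s)
    (hQ : ContDiffOn ℝ n Q s) : ContDiffOn ℝ n (fun x => ip g x (P x) (Q x)) s := by
  have hp : ∀ i, ContDiffOn ℝ n (fun x => P x i) s := contDiffOn_euclidean.mp hP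
  have hq : ∀ i, ContDiffOn ℝ n (fun x => Q x i) s := contDiffOn_euclidean.mp hQ
  simp only [ip]
  refine ContDiffOn.sum fun i _ => ContDiffOn.sum fun j _ => ((ContDiffOn.mul ?_ (hp i)).mul (hq j))
  exact ((hg.smooth i j).mono hs).of_le (by exact_mod_cast le_top)

/-- The connection form of the frame: `∇_a e = λ(a) e^⊥`. -/
def connForm (g : MetricField) (x a : Plane) : ℝ :=
  ip g x (fderiv ℝ (frameE g) x a + christoffelVec g x a (frameE g x)) (frameF g x)

lemma connForm_add (g : MetricField) (x a b : Plane) :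
    connForm g x (a + b) = connForm g x a + connForm g x b := by
  simp only [connForm, map_add, christoffelVec_add_left, ip_add_left]; ring

lemma connForm_smul (g : MetricField) (x : Plane) (c : ℝ) (a : Plane) :
    connForm g x (c • a) = c * connForm g x a := by
  simp only [connForm, map_smul, christoffelVec_smul_left, ip_add_left, ip_smul_left]; ring

lemma connForm_eq (g : MetricField) (x a : Plane) :
    connForm g x a = a 0 * connForm g x (basisVec 0) + a 1 * connForm g x (basisVec 1) := by
  conv_lhs => rw [plane_eq a]
  rw [connForm_add, connForm_smul, connForm_smul]

lemma contDiffOn_connForm (hg : IsRiemannianMetricOn g D) (hD : IsOpen D) (a : Plane) :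
    ContDiffOn ℝ ∞ (fun x => connForm g x a) D := by
  have hE := contDiffOn_frameE hg
  refine contDiffOn_ip hg subset_rfl (ContDiffOn.add ?_ ?_) (contDiffOn_frameF hg)
  · exact (hE.fderiv_of_isOpen hD (m := ∞) (by simp)).clm_apply contDiffOn_const
  · exact contDiffOn_christoffelVec hg hD subset_rfl contDiffOn_const hE

lemma hasFDerivAt_frameE (hg : IsRiemannianMetricOn g D) (hD : IsOpen D) {x : Plane} (hx : x ∈ D) :
    HasFDerivAt (frameE g) (fderiv ℝ (frameE g) x) x :=
  (((contDiffOn_frameE hg).contDiffAt (hD.mem_nhds hx)).differentiableAt (by simp)).hasFDerivAt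

lemma hasFDerivAt_frameF (hg : IsRiemannianMetricOn g D) (hD : IsOpen D) {x : Plane} (hx : x ∈ D) :
    HasFDerivAt (frameF g) (fderiv ℝ (frameF g) x) x :=
  (((contDiffOn_frameF hg).contDiffAt (hD.mem_nhds hx)).differentiableAt (by simp)).hasFDerivAt

lemma fderiv_eq_zero_of_const_on (hD : IsOpen D) {x : Plane} (hx : x ∈ D) {f : Plane → ℝ} {c : ℝ}
    (hf : ∀ y ∈ D, f y = c) (a : Plane) : fderiv ℝ f x a = 0 := by
  have : f =ᶠ[nhds x] fun _ => c := Filter.eventually_of_mem (hD.mem_nhds hx) hf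
  rw [this.fderiv_eq]; simp

lemma fderiv_frameE (hg : IsRiemannianMetricOn g D) (hD : IsOpen D) {x : Plane} (hx : x ∈ D)
    (a : Plane) : fderiv ℝ (frameE g) x a =
      - christoffelVec g x a (frameE g x) + connForm g x a • frameF g x := by
  have hE := hasFDerivAt_frameE hg hD hx
  have h1 := fderiv_ip hg hD hx hE hE a
  rw [fderiv_eq_zero_of_const_on hD hx fun y hy => ip_frameE hg hy,
    ip_comm' hg hx (frameE g x)] at h1
  have h2 := eq_ip_smul_add hg hx (ip_frameE hg hx)
    (fderiv ℝ (frameE g) x a + christoffelVec g x a (frameE g x))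
  have h3 : ip g x (fderiv ℝ (frameE g) x a + christoffelVec g x a (frameE g x)) (frameE g x) = 0 := by
    linarith
  rw [h3, zero_smul, zero_add] at h2
  rw [neg_add_eq_sub, eq_sub_iff_add_eq]
  exact h2

lemma fderiv_frameF (hg : IsRiemannianMetricOn g D) (hD : IsOpen D) {x : Plane} (hx : x ∈ D)
    (a : Plane) : fderiv ℝ (frameF g) x a =
      - christoffelVec g x a (frameF g x) - connForm g x a • frameE g x := by
  have hE := hasFDerivAt_frameE hg hD hx
  have hF := hasFDerivAt_frameF hg hD hx
  have h1 := fderiv_ip hg hD hx hF hF a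
  rw [fderiv_eq_zero_of_const_on hD hx fun y hy => ip_frameF hg hy,
    ip_comm' hg hx (frameF g x)] at h1
  have h0 := fderiv_ip hg hD hx hE hF a
  rw [fderiv_eq_zero_of_const_on hD hx fun y hy => ip_frameE_frameF hg hy,
    ip_comm' hg hx (frameE g x)] at h0
  have h2 := eq_ip_smul_add hg hx (ip_frameE hg hx)
    (fderiv ℝ (frameF g) x a + christoffelVec g x a (frameF g x))
  have h3 : ip g x (fderiv ℝ (frameF g) x a + christoffelVec g x a (frameF g x)) (frameF g x) = 0 := by
    linarith
  have h4 : ip g x (fderiv ℝ (frameF g) x a + christoffelVec g x a (frameF g x)) (frameE g x)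
      = - connForm g x a := by
    have : connForm g x a = ip g x (fderiv ℝ (frameE g) x a + christoffelVec g x a (frameE g x))
      (frameF g x) := rfl
    linarith
  rw [← frameF, h3, zero_smul, add_zero, h4] at h2
  rw [sub_eq_add_neg, neg_add_eq_sub, eq_sub_iff_add_eq, h2, neg_smul]

section pd

variable {f h : Plane → ℝ} {x : Plane} (i : Fin 2)

lemma pd_add (hf : DifferentiableAt ℝ f x) (hh : DifferentiableAt ℝ h x) :
    pd i (fun y => f y + h y) x = pd i f x + pd i h x := by
  simp only [pd]; rw [fderiv_fun_add hf hh]; rfl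

lemma pd_sub (hf : DifferentiableAt ℝ f x) (hh : DifferentiableAt ℝ h x) :
    pd i (fun y => f y - h y) x = pd i f x - pd i h x := by
  simp only [pd]; rw [fderiv_fun_sub hf hh]; rfl

lemma pd_neg : pd i (fun y => - f y) x = - pd i f x := by
  simp only [pd]; rw [fderiv_fun_neg]; rfl

lemma pd_mul (hf : DifferentiableAt ℝ f x) (hh : DifferentiableAt ℝ h x) :
    pd i (fun y => f y * h y) x = f x * pd i h x + h x * pd i f x := by
  simp only [pd]; rw [fderiv_fun_mul hf hh]; rfl

lemma pd_comm (hD : IsOpen D) (hx : x ∈ D) (hf : ContDiffOn ℝ ∞ f D) (j : Fin 2) :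
    pd i (pd j f) x = pd j (pd i f) x := by
  have hfx := hf.contDiffAt (hD.mem_nhds hx)
  have hs : IsSymmSndFDerivAt ℝ f x := (hfx.of_le (m := 2) (WithTop.coe_le_coe.2 le_top)).isSymmSndFDerivAt (by simp)
  have hd : DifferentiableAt ℝ (fderiv ℝ f) x :=
    (hfx.fderiv_right (m := ∞) (by simp)).differentiableAt (by simp)
  have key : ∀ i j : Fin 2, pd i (pd j f) x = fderiv ℝ (fderiv ℝ f) x (basisVec i) (basisVec j) := by
    intro i j
    have : HasFDerivAt (pd j f) ((fderiv ℝ (fderiv ℝ f) x).flip (basisVec j)) x := by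
      have := hd.hasFDerivAt.clm_apply (hasFDerivAt_const (basisVec j) x)
      convert! this using 1
      ext; simp
    rw [pd, this.fderiv]; rfl
  rw [key, key, hs.eq]

end pd

lemma pd_coord {P : Plane → Plane} {x : Plane} (hP : DifferentiableAt ℝ P x) (i l : Fin 2) :
    pd i (fun y => P y l) x = fderiv ℝ P x (basisVec i) l := by
  rw [pd, (hasFDerivAt_coord hP.hasFDerivAt l).fderiv]; rfl

lemma pd_congr (hD : IsOpen D) {x : Plane} (hx : x ∈ D) {f h : Plane → ℝ}
    (hfh : ∀ y ∈ D, f y = h y) (i : Fin 2) : pd i f x = pd i h x := by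
  have : f =ᶠ[nhds x] h := Filter.eventually_of_mem (hD.mem_nhds hx) hfh
  rw [pd, pd, this.fderiv_eq]

lemma pd_frameE (hg : IsRiemannianMetricOn g D) (hD : IsOpen D) {x : Plane} (hx : x ∈ D)
    (i l : Fin 2) : pd i (fun y => frameE g y l) x =
      -(christoffel g l i 0 x * frameE g x 0 + christoffel g l i 1 x * frameE g x 1)
        + connForm g x (basisVec i) * frameF g x l := by
  rw [pd_coord (hasFDerivAt_frameE hg hD hx).differentiableAt, fderiv_frameE hg hD hx]
  fin_cases i <;> simp [christoffelVec_apply, basisVec]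

lemma pd_frameF (hg : IsRiemannianMetricOn g D) (hD : IsOpen D) {x : Plane} (hx : x ∈ D)
    (i l : Fin 2) : pd i (fun y => frameF g y l) x =
      -(christoffel g l i 0 x * frameF g x 0 + christoffel g l i 1 x * frameF g x 1)
        - connForm g x (basisVec i) * frameE g x l := by
  rw [pd_coord (hasFDerivAt_frameF hg hD hx).differentiableAt, fderiv_frameF hg hD hx]
  fin_cases i <;> simp [christoffelVec_apply, basisVec]

/-- The exterior derivative of the connection form. -/
def dConnForm (g : MetricField) (x : Plane) : ℝ :=
  pd 0 (fun y => connForm g y (basisVec 1)) x - pd 1 (fun y => connForm g y (basisVec 0)) x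

lemma curvature_frame_aux (hg : IsRiemannianMetricOn g D) (hD : IsOpen D) {x : Plane} (hx : x ∈ D)
    {P Q : Plane → Plane} {c : ℝ} (hP : ContDiffOn ℝ ∞ P D) (hQ : ContDiffOn ℝ ∞ Q D)
    (hp : ∀ y ∈ D, ∀ i l, pd i (fun y => P y l) y =
      -(christoffel g l i 0 y * P y 0 + christoffel g l i 1 y * P y 1)
        + c * connForm g y (basisVec i) * Q y l)
    (hq : ∀ y ∈ D, ∀ i l, pd i (fun y => Q y l) y =
      -(christoffel g l i 0 y * Q y 0 + christoffel g l i 1 y * Q y 1)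
        - c * connForm g y (basisVec i) * P y l) (l : Fin 2) :
    curvatureTensor g 0 1 0 l x * P x 0 + curvatureTensor g 0 1 1 l x * P x 1
      = c * dConnForm g x * Q x l := by
  have hda : ∀ {f : Plane → ℝ}, ContDiffOn ℝ ∞ f D → DifferentiableAt ℝ f x := fun hf =>
    (hf.contDiffAt (hD.mem_nhds hx)).differentiableAt (by simp)
  have hPl : ∀ l, ContDiffOn ℝ ∞ (fun y => P y l) D := contDiffOn_euclidean.mp hP
  have hdP : ∀ l, DifferentiableAt ℝ (fun y => P y l) x := fun l => hda (hPl l)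
  have hdQ : ∀ l, DifferentiableAt ℝ (fun y => Q y l) x := fun l =>
    hda (contDiffOn_euclidean.mp hQ l)
  have hdΓ : ∀ l i j, DifferentiableAt ℝ (fun y => christoffel g l i j y) x := fun l i j =>
    hda (contDiffOn_christoffel hg hD l i j)
  have hdc : ∀ i, DifferentiableAt ℝ (fun y => connForm g y (basisVec i)) x := fun i =>
    hda (contDiffOn_connForm hg hD _)
  have key : ∀ i j, pd i (pd j fun y => P y l) x =
      -(christoffel g l j 0 x * pd i (fun y => P y 0) x + P x 0 * pd i (christoffel g l j 0) x
        + (christoffel g l j 1 x * pd i (fun y => P y 1) x + P x 1 * pd i (christoffel g l j 1) x))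
      + (c * connForm g x (basisVec j) * pd i (fun y => Q y l) x
        + Q x l * (c * pd i (fun y => connForm g y (basisVec j)) x)) := by
    intro i j
    rw [pd_congr hD hx (fun y hy => hp y hy j l), pd_add, pd_neg, pd_add, pd_mul, pd_mul, pd_mul,
      pd_mul]
    · simp [pd]
    all_goals first
      | exact hdP _ | exact hdQ _ | exact hdΓ _ _ _ | exact hdc _
      | exact differentiableAt_const _
      | exact (differentiableAt_const _).mul (hdc _)
      | exact (hdΓ _ _ _).mul (hdP _)
      | exact (((hdΓ _ _ _).mul (hdP _)).add ((hdΓ _ _ _).mul (hdP _))).neg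
      | exact ((differentiableAt_const _).mul (hdc _)).mul (hdQ _)
  have hsym := pd_comm 0 hD hx (hPl l) 1
  rw [key, key] at hsym
  simp only [hp x hx, hq x hx] at hsym
  simp only [curvatureTensor, dConnForm, Fin.sum_univ_two]
  linear_combination -hsym

/-- The curvature acts on the frame through the exterior derivative of the connection form. -/
lemma gaussCurvature_eq (hg : IsRiemannianMetricOn g D) (hD : IsOpen D) {x : Plane} (hx : x ∈ D) :
    dConnForm g x = - gaussCurvature g x * Real.sqrt (g x).det := by
  have hE := curvature_frame_aux (c := 1) hg hD hx (contDiffOn_frameE hg) (contDiffOn_frameF hg)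
    (fun y hy i l => by rw [pd_frameE hg hD hy]; ring)
    (fun y hy i l => by rw [pd_frameF hg hD hy]; ring)
  have hF := curvature_frame_aux (c := -1) hg hD hx (contDiffOn_frameF hg) (contDiffOn_frameE hg)
    (fun y hy i l => by rw [pd_frameF hg hD hy]; ring)
    (fun y hy i l => by rw [pd_frameE hg hD hy]; ring)
  have hd := hg.det_pos hx
  have h0 := hg.diag_pos hx
  have hsd := sqrt_det_pos hg hx
  have hs0 : 0 < Real.sqrt (g x 0 0) := Real.sqrt_pos.mpr h0
  have hdet := Real.sq_sqrt hd.le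
  have h00 := Real.sq_sqrt h0.le
  have e0 := frameE_zero g x
  have e1 := frameE_one g x
  have f0 : frameF g x 0 = _ := perp_zero_apply g x _
  have f1 : frameF g x 1 = _ := perp_one_apply g x _
  have hs := hg.symm hx 1 0
  rw [gaussCurvature, Fin.sum_univ_two]
  have hE0 := hE 0
  have hE1 := hE 1
  have hF0 := hF 0
  have hF1 := hF 1
  simp only [f0, f1, e0, e1, hs] at hE0 hE1 hF0 hF1
  set A0 := curvatureTensor g 0 1 0 0 x
  set A1 := curvatureTensor g 0 1 0 1 x
  set B0 := curvatureTensor g 0 1 1 0 x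
  set B1 := curvatureTensor g 0 1 1 1 x
  set w := dConnForm g x
  set s := Real.sqrt (g x).det
  set t := Real.sqrt (g x 0 0)
  rw [← hdet]
  have hs' := hsd.ne'
  have ht' := hs0.ne'
  have h0' := h0.ne'
  field_simp at hE0 hE1 hF0 hF1 ⊢
  simp only [mul_zero, add_zero] at hE0 hE1 hF0 hF1
  have hB1 : s * B1 = w * g x 0 1 := by
    apply mul_left_cancel₀ h0'
    linear_combination s * hF1 + g x 0 1 * hE1
  apply mul_left_cancel₀ hs'
  linear_combination s * hF0 + g x 0 1 * hB1 + g x 0 1 * hE0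

end Pestov
end

noncomputable section

namespace Pestov

variable {g : MetricField} {D : Set Plane}

/-- The unit vector at angle `θ`, as a function on the trivialized circle bundle. -/
def angVec (g : MetricField) (q : Plane × ℝ) : Plane := unitVec g q.1 q.2

/-- The rotated unit vector at angle `θ`. -/
def angPerp (g : MetricField) (q : Plane × ℝ) : Plane := perp g q.1 (unitVec g q.1 q.2)

/-- The horizontal lift of a vector `a` in angle coordinates. -/
def horLift (g : MetricField) (x a : Plane) : Plane × ℝ := (a, - connForm g x a)

lemma ip_unitVec (hg : IsRiemannianMetricOn g D) {x : Plane} (hx : x ∈ D) (θ : ℝ) :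
    ip g x (unitVec g x θ) (unitVec g x θ) = 1 := by
  rw [unitVec_eq]
  simp only [ip_add_left, ip_add_right, ip_smul_left, ip_smul_right, ip_frameE hg hx,
    ip_frameF hg hx, ip_frameE_frameF hg hx, ip_comm' hg hx (frameF g x) (frameE g x)]
  linear_combination Real.sin_sq_add_cos_sq θ

lemma angPerp_eq (hg : IsRiemannianMetricOn g D) {q : Plane × ℝ} (hq : q.1 ∈ D) :
    angPerp g q = -Real.sin q.2 • frameE g q.1 + Real.cos q.2 • frameF g q.1 := by
  rw [angPerp, unitVec_eq, perp_add, perp_smul, perp_smul]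
  rw [← frameF, frameF, perp_perp hg hq]
  module

lemma contDiffOn_angVec (hg : IsRiemannianMetricOn g D) :
    ContDiffOn ℝ ∞ (angVec g) (D ×ˢ Set.univ) := by
  have hE : ContDiffOn ℝ ∞ (fun q : Plane × ℝ => frameE g q.1) (D ×ˢ Set.univ) :=
    (contDiffOn_frameE hg).comp contDiffOn_fst fun q hq => hq.1
  have hF : ContDiffOn ℝ ∞ (fun q : Plane × ℝ => frameF g q.1) (D ×ˢ Set.univ) :=
    (contDiffOn_frameF hg).comp contDiffOn_fst fun q hq => hq.1
  exact ((Real.contDiff_cos.comp contDiff_snd).contDiffOn.smul hE).add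
    ((Real.contDiff_sin.comp contDiff_snd).contDiffOn.smul hF)

lemma contDiffOn_angPerp (hg : IsRiemannianMetricOn g D) :
    ContDiffOn ℝ ∞ (angPerp g) (D ×ˢ Set.univ) := by
  have hE : ContDiffOn ℝ ∞ (fun q : Plane × ℝ => frameE g q.1) (D ×ˢ Set.univ) :=
    (contDiffOn_frameE hg).comp contDiffOn_fst fun q hq => hq.1
  have hF : ContDiffOn ℝ ∞ (fun q : Plane × ℝ => frameF g q.1) (D ×ˢ Set.univ) :=
    (contDiffOn_frameF hg).comp contDiffOn_fst fun q hq => hq.1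
  refine ContDiffOn.congr ?_ fun q hq => angPerp_eq hg hq.1
  exact ((Real.contDiff_sin.comp contDiff_snd).contDiffOn.neg.smul hE).add
    ((Real.contDiff_cos.comp contDiff_snd).contDiffOn.smul hF)

lemma nhds_prod_univ (hD : IsOpen D) {q : Plane × ℝ} (hq : q.1 ∈ D) :
    D ×ˢ (Set.univ : Set ℝ) ∈ nhds q :=
  (hD.prod isOpen_univ).mem_nhds ⟨hq, trivial⟩

lemma hasFDerivAt_angVec (hg : IsRiemannianMetricOn g D) (hD : IsOpen D) {q : Plane × ℝ}
    (hq : q.1 ∈ D) : HasFDerivAt (angVec g) (fderiv ℝ (angVec g) q) q :=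
  (((contDiffOn_angVec hg).contDiffAt (nhds_prod_univ hD hq)).differentiableAt (by simp)).hasFDerivAt

lemma hasFDerivAt_angPerp (hg : IsRiemannianMetricOn g D) (hD : IsOpen D) {q : Plane × ℝ}
    (hq : q.1 ∈ D) : HasFDerivAt (angPerp g) (fderiv ℝ (angPerp g) q) q :=
  (((contDiffOn_angPerp hg).contDiffAt (nhds_prod_univ hD hq)).differentiableAt
    (by simp)).hasFDerivAt

lemma fderiv_angVec (hg : IsRiemannianMetricOn g D) (hD : IsOpen D) {q : Plane × ℝ}
    (hq : q.1 ∈ D) (a : Plane) (τ : ℝ) : fderiv ℝ (angVec g) q (a, τ) =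
      - christoffelVec g q.1 a (angVec g q) + (connForm g q.1 a + τ) • angPerp g q := by
  have hE := (hasFDerivAt_frameE hg hD hq).comp q hasFDerivAt_fst
  have hF := (hasFDerivAt_frameF hg hD hq).comp q hasFDerivAt_fst
  have hc := (Real.hasDerivAt_cos q.2).comp_hasFDerivAt q (hasFDerivAt_snd (𝕜 := ℝ) (E := Plane))
  have hs := (Real.hasDerivAt_sin q.2).comp_hasFDerivAt q (hasFDerivAt_snd (𝕜 := ℝ) (E := Plane))
  have h := (hc.smul hE).add (hs.smul hF)
  have h' : HasFDerivAt (angVec g) _ q := h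
  rw [h'.fderiv, angPerp_eq hg hq]
  simp only [add_apply, smul_apply, ContinuousLinearMap.comp_apply,
    ContinuousLinearMap.smulRight_apply, ContinuousLinearMap.coe_fst',
    ContinuousLinearMap.coe_snd', Function.comp, fderiv_frameE hg hD hq, fderiv_frameF hg hD hq,
    angVec, unitVec_eq, christoffelVec_add_right, christoffelVec_smul_right, smul_eq_mul]
  module

lemma fderiv_angPerp (hg : IsRiemannianMetricOn g D) (hD : IsOpen D) {q : Plane × ℝ}
    (hq : q.1 ∈ D) (a : Plane) (τ : ℝ) : fderiv ℝ (angPerp g) q (a, τ) =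
      - christoffelVec g q.1 a (angPerp g q) - (connForm g q.1 a + τ) • angVec g q := by
  have hE := (hasFDerivAt_frameE hg hD hq).comp q hasFDerivAt_fst
  have hF := (hasFDerivAt_frameF hg hD hq).comp q hasFDerivAt_fst
  have hc := (Real.hasDerivAt_cos q.2).comp_hasFDerivAt q (hasFDerivAt_snd (𝕜 := ℝ) (E := Plane))
  have hs := (Real.hasDerivAt_sin q.2).comp_hasFDerivAt q (hasFDerivAt_snd (𝕜 := ℝ) (E := Plane))
  have h := (hs.neg.smul hE).add (hc.smul hF)
  have h' : HasFDerivAt (angPerp g) _ q := h.congr_of_eventuallyEq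
    (Filter.eventually_of_mem (nhds_prod_univ hD hq) fun p hp => angPerp_eq hg hp.1)
  rw [h'.fderiv, angPerp_eq hg hq]
  simp only [add_apply, smul_apply, neg_apply, ContinuousLinearMap.comp_apply,
    ContinuousLinearMap.smulRight_apply, ContinuousLinearMap.coe_fst', Pi.neg_apply,
    ContinuousLinearMap.coe_snd', Function.comp, fderiv_frameE hg hD hq, fderiv_frameF hg hD hq,
    angVec, unitVec_eq, christoffelVec_add_right, christoffelVec_smul_right, smul_eq_mul]
  module

lemma contDiffOn_horLift (hg : IsRiemannianMetricOn g D) (hD : IsOpen D) {n : ℕ∞} {s : Set (Plane × ℝ)}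
    (hs : s ⊆ D ×ˢ Set.univ) {P : Plane × ℝ → Plane} (hP : ContDiffOn ℝ n P s) :
    ContDiffOn ℝ n (fun q => horLift g q.1 (P q)) s := by
  have hp : ∀ i, ContDiffOn ℝ n (fun q => P q i) s := contDiffOn_euclidean.mp hP
  have hc : ∀ i, ContDiffOn ℝ n (fun q : Plane × ℝ => connForm g q.1 (basisVec i)) s := fun i =>
    (((contDiffOn_connForm hg hD (basisVec i)).of_le (by exact_mod_cast le_top)).comp
      contDiffOn_fst fun q hq => (hs hq).1)
  refine hP.prodMk ?_
  have : (fun q : Plane × ℝ => -connForm g q.1 (P q)) = fun q => -(P q 0 * connForm g q.1 (basisVec 0)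
      + P q 1 * connForm g q.1 (basisVec 1)) := by
    funext q; rw [connForm_eq]
  rw [this]
  exact (((hp 0).mul (hc 0)).add ((hp 1).mul (hc 1))).neg

lemma hasFDerivAt_coord' {E : Type*} [NormedAddCommGroup E] [NormedSpace ℝ E] {P : E → Plane}
    {x : E} {P' : E →L[ℝ] Plane} (hP : HasFDerivAt P P' x) (i : Fin 2) :
    HasFDerivAt (fun y => P y i) ((EuclideanSpace.proj i : Plane →L[ℝ] ℝ) ∘L P') x :=
  HasFDerivAt.comp x (EuclideanSpace.proj i : Plane →L[ℝ] ℝ).hasFDerivAt hP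

/-- The derivative of the contraction of the connection form with a vector field. -/
lemma hasFDerivAt_connForm (hg : IsRiemannianMetricOn g D) (hD : IsOpen D) {q : Plane × ℝ}
    (hq : q.1 ∈ D) {P : Plane × ℝ → Plane} {P' : Plane × ℝ →L[ℝ] Plane} (hP : HasFDerivAt P P' q) :
    ∃ L : Plane × ℝ →L[ℝ] ℝ, HasFDerivAt (fun q => connForm g q.1 (P q)) L q ∧
      ∀ ξ : Plane × ℝ, L ξ = connForm g q.1 (P' ξ)
        + P q 0 * (ξ.1 0 * pd 0 (fun y => connForm g y (basisVec 0)) q.1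
          + ξ.1 1 * pd 1 (fun y => connForm g y (basisVec 0)) q.1)
        + P q 1 * (ξ.1 0 * pd 0 (fun y => connForm g y (basisVec 1)) q.1
          + ξ.1 1 * pd 1 (fun y => connForm g y (basisVec 1)) q.1) := by
  have hc : ∀ i, HasFDerivAt (fun y => connForm g y (basisVec i))
      (fderiv ℝ (fun y => connForm g y (basisVec i)) q.1) q.1 := fun i =>
    (((contDiffOn_connForm hg hD (basisVec i)).contDiffAt (hD.mem_nhds hq)).differentiableAt
      (by simp)).hasFDerivAt
  have hc' := fun i => (hc i).comp q (hasFDerivAt_fst (𝕜 := ℝ) (E := Plane) (F := ℝ))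
  have hp := fun i => hasFDerivAt_coord' hP i
  have h := ((hp 0).mul (hc' 0)).add ((hp 1).mul (hc' 1))
  refine ⟨_, h.congr_of_eventuallyEq (Filter.Eventually.of_forall fun p => connForm_eq g p.1 (P p)),
    fun ξ => ?_⟩
  rw [connForm_eq g q.1 (P' ξ)]
  simp only [add_apply, smul_apply, ContinuousLinearMap.comp_apply, PiLp.proj_apply,
    ContinuousLinearMap.coe_fst', Function.comp, smul_eq_mul, fderiv_eq_pd]
  ring

section Commutator

variable {E : Type*} [NormedAddCommGroup E] [NormedSpace ℝ E]

lemma hasFDerivAt_lieDeriv {f : E → ℝ} {q : E} (hf : ContDiffAt ℝ 2 f q) {B : E → E} {B' : E →L[ℝ] E}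
    (hB : HasFDerivAt B B' q) :
    HasFDerivAt (fun p => fderiv ℝ f p (B p))
      ((fderiv ℝ f q) ∘L B' + (fderiv ℝ (fderiv ℝ f) q).flip (B q)) q := by
  have hd : DifferentiableAt ℝ (fderiv ℝ f) q :=
    (hf.fderiv_right (m := 1) (by norm_num)).differentiableAt (by simp)
  exact hd.hasFDerivAt.clm_apply hB

/-- The commutator of two first order operators. -/
lemma lieDeriv_comm {f : E → ℝ} {q : E} (hf : ContDiffAt ℝ 2 f q) {A B : E → E} {A' B' : E →L[ℝ] E}
    (hA : HasFDerivAt A A' q) (hB : HasFDerivAt B B' q) :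
    fderiv ℝ (fun p => fderiv ℝ f p (B p)) q (A q) - fderiv ℝ (fun p => fderiv ℝ f p (A p)) q (B q)
      = fderiv ℝ f q (B' (A q) - A' (B q)) := by
  have hs : IsSymmSndFDerivAt ℝ f q := hf.isSymmSndFDerivAt (by simp)
  rw [(hasFDerivAt_lieDeriv hf hA).fderiv, (hasFDerivAt_lieDeriv hf hB).fderiv]
  simp only [add_apply, ContinuousLinearMap.comp_apply, ContinuousLinearMap.flip_apply, map_sub]
  rw [hs.eq (A q) (B q)]; ring

end Commutator

/-- The geodesic vector field in angle coordinates. -/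
def geoField (g : MetricField) (q : Plane × ℝ) : Plane × ℝ := horLift g q.1 (angVec g q)

/-- The horizontal lift of the rotated unit vector in angle coordinates. -/
def perpField (g : MetricField) (q : Plane × ℝ) : Plane × ℝ := horLift g q.1 (angPerp g q)

lemma fderiv_angVec_horLift (hg : IsRiemannianMetricOn g D) (hD : IsOpen D) {q : Plane × ℝ}
    (hq : q.1 ∈ D) (a : Plane) : fderiv ℝ (angVec g) q (horLift g q.1 a) =
      - christoffelVec g q.1 a (angVec g q) := by
  rw [horLift, fderiv_angVec hg hD hq]; simp

lemma fderiv_angPerp_horLift (hg : IsRiemannianMetricOn g D) (hD : IsOpen D) {q : Plane × ℝ}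
    (hq : q.1 ∈ D) (a : Plane) : fderiv ℝ (angPerp g) q (horLift g q.1 a) =
      - christoffelVec g q.1 a (angPerp g q) := by
  rw [horLift, fderiv_angPerp hg hD hq]; simp

lemma connForm_zero (g : MetricField) (x : Plane) : connForm g x 0 = 0 := by
  simpa using connForm_smul g x 0 0

lemma connForm_neg (g : MetricField) (x a : Plane) : connForm g x (-a) = - connForm g x a := by
  simpa using connForm_smul g x (-1) a

/-- `[V, X] = X_⊥`, `[V, X_⊥] = -X` and `[X, X_⊥] = K V` in angle coordinates. -/
lemma field_brackets (hg : IsRiemannianMetricOn g D) (hD : IsOpen D) {q : Plane × ℝ}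
    (hq : q.1 ∈ D) : ∃ X' Y' : Plane × ℝ →L[ℝ] Plane × ℝ,
      HasFDerivAt (geoField g) X' q ∧ HasFDerivAt (perpField g) Y' q ∧
      X' (0, 1) = perpField g q ∧ Y' (0, 1) = - geoField g q ∧
      Y' (geoField g q) - X' (perpField g q) = (0, gaussCurvature g q.1) := by
  have hv := hasFDerivAt_angVec hg hD hq
  have hw := hasFDerivAt_angPerp hg hD hq
  obtain ⟨Lv, hLv, hLv'⟩ := hasFDerivAt_connForm hg hD hq hv
  obtain ⟨Lw, hLw, hLw'⟩ := hasFDerivAt_connForm hg hD hq hw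
  refine ⟨_, _, hv.prodMk hLv.neg, hw.prodMk hLw.neg, ?_, ?_, ?_⟩
  · have : fderiv ℝ (angVec g) q (0, 1) = angPerp g q := by
      rw [fderiv_angVec hg hD hq, connForm_zero]
      simp [christoffelVec]
      rfl
    ext1
    · simpa [perpField, horLift] using this
    · simp [perpField, horLift, hLv', this]
  · have : fderiv ℝ (angPerp g) q (0, 1) = - angVec g q := by
      rw [fderiv_angPerp hg hD hq, connForm_zero]
      simp [christoffelVec]
      rfl
    ext1
    · simpa [geoField, horLift] using this
    · simp [geoField, horLift, hLw', this, connForm_neg]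
  · have h1 := fderiv_angPerp_horLift hg hD hq (angVec g q)
    have h2 := fderiv_angVec_horLift hg hD hq (angPerp g q)
    rw [christoffelVec_symm hg hD hq] at h1
    have hcr : angVec g q 0 * angPerp g q 1 - angVec g q 1 * angPerp g q 0
        = (Real.sqrt (g q.1).det)⁻¹ := by
      have := cross_perp hg hq (angVec g q)
      rw [angVec, ip_unitVec hg hq, mul_one] at this
      exact this
    have hK := gaussCurvature_eq hg hD hq
    have hd := (sqrt_det_pos hg hq).ne'
    ext1
    · simp only [ContinuousLinearMap.prod_apply, Prod.fst_sub, geoField, perpField, h1, h2, sub_self]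
    · simp only [ContinuousLinearMap.prod_apply, Prod.snd_sub, geoField, perpField, neg_apply, hLw',
        hLv', h1, h2]
      have : gaussCurvature g q.1 = - dConnForm g q.1 * (Real.sqrt (g q.1).det)⁻¹ := by
        rw [hK]; field_simp
      rw [this, ← hcr, dConnForm]
      simp only [horLift]
      ring

/-- The pointwise Pestov identity. -/
lemma pestov_pointwise (hg : IsRiemannianMetricOn g D) (hD : IsOpen D) {q : Plane × ℝ}
    (hq : q.1 ∈ D) {f : Plane × ℝ → ℝ} (hf : ContDiffAt ℝ 2 f q) {a b c : Plane × ℝ → ℝ}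
    (ha : a = fun p => fderiv ℝ f p (geoField g p)) (hb : b = fun p => fderiv ℝ f p (perpField g p))
    (hc : c = fun p => fderiv ℝ f p (0, 1)) :
    DifferentiableAt ℝ a q ∧ DifferentiableAt ℝ b q ∧ DifferentiableAt ℝ c q ∧
    fderiv ℝ (fun p => a p * b p) q (0, 1) + fderiv ℝ (fun p => b p * c p) q (geoField g q)
      - fderiv ℝ (fun p => a p * c p) q (perpField g q)
      = (fderiv ℝ a q (0, 1)) ^ 2 - (fderiv ℝ c q (geoField g q)) ^ 2 - (a q) ^ 2
        + gaussCurvature g q.1 * (c q) ^ 2 := by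
  obtain ⟨X', Y', hX, hY, h1, h2, h3⟩ := field_brackets hg hD hq
  have hV : HasFDerivAt (fun _ : Plane × ℝ => ((0 : Plane), (1 : ℝ)))
      (0 : Plane × ℝ →L[ℝ] Plane × ℝ) q := hasFDerivAt_const _ _
  have da : DifferentiableAt ℝ a q := by rw [ha]; exact (hasFDerivAt_lieDeriv hf hX).differentiableAt
  have db : DifferentiableAt ℝ b q := by rw [hb]; exact (hasFDerivAt_lieDeriv hf hY).differentiableAt
  have dc : DifferentiableAt ℝ c q := by rw [hc]; exact (hasFDerivAt_lieDeriv hf hV).differentiableAt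
  refine ⟨da, db, dc, ?_⟩
  have c1 := lieDeriv_comm hf hV hX
  have c2 := lieDeriv_comm hf hV hY
  have c3 := lieDeriv_comm hf hX hY
  rw [← ha, ← hc, h1] at c1
  rw [← hb, ← hc, h2] at c2
  rw [← ha, ← hb, h3] at c3
  have e1 : fderiv ℝ f q (perpField g q) = b q := by rw [hb]
  have e2 : fderiv ℝ f q (geoField g q) = a q := by rw [ha]
  have e3 : fderiv ℝ f q (0, gaussCurvature g q.1) = gaussCurvature g q.1 * c q := by
    have : ((0 : Plane), gaussCurvature g q.1) = gaussCurvature g q.1 • ((0 : Plane), (1 : ℝ)) := by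
      simp
    rw [this, map_smul, hc, smul_eq_mul]
  simp only [zero_apply, sub_zero, map_neg, e1, e2, e3] at c1 c2 c3
  rw [fderiv_fun_mul da db, fderiv_fun_mul db dc, fderiv_fun_mul da dc]
  simp only [add_apply, smul_apply, smul_eq_mul]
  linear_combination (- fderiv ℝ a q (0, 1) - fderiv ℝ c q (geoField g q)) * c1 + a q * c2 + c q * c3

end Pestov
end

noncomputable section

namespace Pestov

variable {g : MetricField} {D : Set Plane}

lemma pd_sqrt_det (hg : IsRiemannianMetricOn g D) (hD : IsOpen D) {x : Plane} (hx : x ∈ D)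
    (i : Fin 2) : pd i (fun y => Real.sqrt (g y).det) x =
      Real.sqrt (g x).det * (christoffel g 0 i 0 x + christoffel g 1 i 1 x) := by
  have hd := hg.det_pos hx
  have hs := (sqrt_det_pos hg hx).ne'
  have hsq := Real.sq_sqrt hd.le
  have hda : DifferentiableAt ℝ (fun y => (g y).det) x :=
    ((contDiffOn_det hg).contDiffAt (hD.mem_nhds hx)).differentiableAt (by simp)
  have h1 : pd i (fun y => Real.sqrt (g y).det) x
      = 1 / (2 * Real.sqrt (g x).det) * pd i (fun y => (g y).det) x := by
    simp only [pd]
    rw [(hda.hasFDerivAt.sqrt hd.ne').fderiv]; rfl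
  have hG := fun i j => hg.differentiableAt hD hx i j
  have h2 : pd i (fun y => (g y).det) x = 2 * (g x).det * (christoffel g 0 i 0 x + christoffel g 1 i 1 x) := by
    simp only [Matrix.det_fin_two]
    rw [pd_sub, pd_mul, pd_mul]
    · simp only [metric_compat hg hD hx, hg.symm hx 1 0]
      ring
    all_goals first | exact hG _ _ | exact (hG _ _).mul (hG _ _)
  rw [h1, h2]
  nth_rewrite 2 [← hsq]
  field_simp

/-- The divergence of a horizontal field whose base component is `P h`, with `P` parallel along
horizontal directions. -/
lemma sum_fderiv_density (hg : IsRiemannianMetricOn g D) (hD : IsOpen D) {q : Plane × ℝ}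
    (hq : q.1 ∈ D) {P : Plane × ℝ → Plane} {P' : Plane × ℝ →L[ℝ] Plane} (hP : HasFDerivAt P P' q)
    (hpar : ∀ a, P' (horLift g q.1 a) = - christoffelVec g q.1 a (P q)) {h : Plane × ℝ → ℝ}
    (hh : DifferentiableAt ℝ h q) :
    ∑ i : Fin 2, fderiv ℝ (fun p : Plane × ℝ => Real.sqrt (g p.1).det * (P p i * h p)) q (basisVec i, 0)
      = Real.sqrt (g q.1).det * (fderiv ℝ h q (horLift g q.1 (P q))
        + fderiv ℝ (fun p => connForm g p.1 (P p) * h p) q (0, 1)) := by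
  obtain ⟨L, hL, hL'⟩ := hasFDerivAt_connForm hg hD hq hP
  have hs0 : HasFDerivAt (fun y => Real.sqrt (g y).det) (fderiv ℝ (fun y => Real.sqrt (g y).det) q.1) q.1 :=
    (((contDiffOn_sqrt_det hg).contDiffAt (hD.mem_nhds hq)).differentiableAt (by simp)).hasFDerivAt
  have hs := hs0.comp q (hasFDerivAt_fst (𝕜 := ℝ) (E := Plane) (F := ℝ))
  have hp := fun i => hasFDerivAt_coord' hP i
  have key : ∀ i a, fderiv ℝ (fun p : Plane × ℝ => Real.sqrt (g p.1).det * (P p i * h p)) q (a, 0)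
      = Real.sqrt (g q.1).det * (P q i * fderiv ℝ h q (a, 0) + h q * P' (a, 0) i)
        + P q i * h q * fderiv ℝ (fun y => Real.sqrt (g y).det) q.1 a := by
    intro i a
    have := hs.mul ((hp i).mul hh.hasFDerivAt)
    refine (congrArg (fun L : Plane × ℝ →L[ℝ] ℝ => L (a, 0)) this.fderiv).trans ?_
    simp
    ring
  have hsplit : ∀ i, P' (basisVec i, 0) = - christoffelVec g q.1 (basisVec i) (P q)
      + connForm g q.1 (basisVec i) • P' (0, 1) := by
    intro i
    rw [← hpar, ← map_smul, ← map_add]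
    congr 1
    simp [horLift]
  have hh1 : fderiv ℝ h q (horLift g q.1 (P q)) = P q 0 * fderiv ℝ h q (basisVec 0, 0)
      + P q 1 * fderiv ℝ h q (basisVec 1, 0) - connForm g q.1 (P q) * fderiv ℝ h q (0, 1) := by
    have : horLift g q.1 (P q) = P q 0 • (basisVec 0, (0 : ℝ)) + P q 1 • (basisVec 1, (0 : ℝ))
        - connForm g q.1 (P q) • ((0 : Plane), (1 : ℝ)) := by
      ext1
      · simpa [horLift, basisVec] using plane_eq (P q)
      · simp [horLift]
    rw [this]
    simp only [map_add, map_sub, map_smul, smul_eq_mul]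
  have hh2 : fderiv ℝ (fun p => connForm g p.1 (P p) * h p) q (0, 1)
      = connForm g q.1 (P q) * fderiv ℝ h q (0, 1) + h q * connForm g q.1 (P' (0, 1)) := by
    refine (congrArg (fun L : Plane × ℝ →L[ℝ] ℝ => L (0, 1)) (hL.mul hh.hasFDerivAt).fderiv).trans ?_
    simp [hL']
  have hpd : ∀ i, fderiv ℝ (fun y => Real.sqrt (g y).det) q.1 (basisVec i)
      = Real.sqrt (g q.1).det * (christoffel g 0 i 0 q.1 + christoffel g 1 i 1 q.1) :=
    fun i => pd_sqrt_det hg hD hq i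
  rw [hh1, hh2, connForm_eq g q.1 (P' (0, 1)), Fin.sum_univ_two, key, key, hsplit, hsplit, hpd, hpd]
  simp [christoffelVec_apply, basisVec, christoffel_symm hg hD hq _ 1 0]
  ring

/-- The pointwise Pestov identity in divergence form. -/
lemma pestov_divergence (hg : IsRiemannianMetricOn g D) (hD : IsOpen D) {q : Plane × ℝ}
    (hq : q.1 ∈ D) {f : Plane × ℝ → ℝ} (hf : ContDiffAt ℝ 2 f q) {a b c : Plane × ℝ → ℝ}
    (ha : a = fun p => fderiv ℝ f p (geoField g p)) (hb : b = fun p => fderiv ℝ f p (perpField g p))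
    (hc : c = fun p => fderiv ℝ f p (0, 1)) :
    ∑ i : Fin 2, fderiv ℝ (fun p : Plane × ℝ => Real.sqrt (g p.1).det *
        (angVec g p i * (b p * c p) - angPerp g p i * (a p * c p))) q (basisVec i, 0)
      = Real.sqrt (g q.1).det * ((fderiv ℝ a q (0, 1)) ^ 2 - (fderiv ℝ c q (geoField g q)) ^ 2
        - (a q) ^ 2 + gaussCurvature g q.1 * (c q) ^ 2)
        + fderiv ℝ (fun p : Plane × ℝ => Real.sqrt (g p.1).det * (connForm g p.1 (angVec g p) * (b p * c p)
          - connForm g p.1 (angPerp g p) * (a p * c p) - a p * b p)) q (0, 1) := by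
  obtain ⟨da, db, dc, hpt⟩ := pestov_pointwise hg hD hq hf ha hb hc
  have hv := hasFDerivAt_angVec hg hD hq
  have hw := hasFDerivAt_angPerp hg hD hq
  have e1 := sum_fderiv_density hg hD hq hv (fun a => fderiv_angVec_horLift hg hD hq a) (db.mul dc)
  have e2 := sum_fderiv_density hg hD hq hw (fun a => fderiv_angPerp_horLift hg hD hq a) (da.mul dc)
  obtain ⟨Lv, hLv, -⟩ := hasFDerivAt_connForm hg hD hq hv
  obtain ⟨Lw, hLw, -⟩ := hasFDerivAt_connForm hg hD hq hw
  have hs0 : HasFDerivAt (fun y => Real.sqrt (g y).det) (fderiv ℝ (fun y => Real.sqrt (g y).det) q.1) q.1 :=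
    (((contDiffOn_sqrt_det hg).contDiffAt (hD.mem_nhds hq)).differentiableAt (by simp)).hasFDerivAt
  have hs : HasFDerivAt (fun p : Plane × ℝ => Real.sqrt (g p.1).det) _ q :=
    hs0.comp q (hasFDerivAt_fst (𝕜 := ℝ) (E := Plane) (F := ℝ))
  have dv : ∀ i, DifferentiableAt ℝ (fun p => angVec g p i) q := fun i =>
    (hasFDerivAt_coord' hv i).differentiableAt
  have dw : ∀ i, DifferentiableAt ℝ (fun p => angPerp g p i) q := fun i =>
    (hasFDerivAt_coord' hw i).differentiableAt
  have ds := hs.differentiableAt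
  have dbc := db.mul dc
  have dac := da.mul dc
  have dab := da.mul db
  have hH : ∀ i, fderiv ℝ (fun p : Plane × ℝ => Real.sqrt (g p.1).det *
        (angVec g p i * (b p * c p) - angPerp g p i * (a p * c p))) q
      = fderiv ℝ (fun p : Plane × ℝ => Real.sqrt (g p.1).det * (angVec g p i * (b p * c p))) q
       - fderiv ℝ (fun p : Plane × ℝ => Real.sqrt (g p.1).det * (angPerp g p i * (a p * c p))) q := by
    intro i
    have : (fun p : Plane × ℝ => Real.sqrt (g p.1).det *
        (angVec g p i * (b p * c p) - angPerp g p i * (a p * c p))) = fun p =>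
        Real.sqrt (g p.1).det * (angVec g p i * (b p * c p))
          - Real.sqrt (g p.1).det * (angPerp g p i * (a p * c p)) := by
      funext p; ring
    rw [this, fderiv_fun_sub]
    · exact ds.mul ((dv i).mul dbc)
    · exact ds.mul ((dw i).mul dac)
  have hG : fderiv ℝ (fun p : Plane × ℝ => Real.sqrt (g p.1).det * (connForm g p.1 (angVec g p) * (b p * c p)
          - connForm g p.1 (angPerp g p) * (a p * c p) - a p * b p)) q (0, 1)
      = Real.sqrt (g q.1).det * (fderiv ℝ (fun p => connForm g p.1 (angVec g p) * (b p * c p)) q (0, 1)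
        - fderiv ℝ (fun p => connForm g p.1 (angPerp g p) * (a p * c p)) q (0, 1)
        - fderiv ℝ (fun p => a p * b p) q (0, 1)) := by
    have d1 : DifferentiableAt ℝ (fun p => connForm g p.1 (angVec g p) * (b p * c p)) q :=
      hLv.differentiableAt.mul dbc
    have d2 : DifferentiableAt ℝ (fun p => connForm g p.1 (angPerp g p) * (a p * c p)) q :=
      hLw.differentiableAt.mul dac
    have d3 : DifferentiableAt ℝ (fun p => a p * b p) q := dab
    rw [fderiv_fun_mul ds ((d1.fun_sub d2).fun_sub d3), fderiv_fun_sub (d1.fun_sub d2) d3,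
      fderiv_fun_sub d1 d2, hs.fderiv]
    simp
  have e1' : ∑ i : Fin 2, fderiv ℝ (fun p : Plane × ℝ => Real.sqrt (g p.1).det *
      (angVec g p i * (b p * c p))) q (basisVec i, 0) = Real.sqrt (g q.1).det *
      (fderiv ℝ (fun p => b p * c p) q (geoField g q)
        + fderiv ℝ (fun p => connForm g p.1 (angVec g p) * (b p * c p)) q (0, 1)) := e1
  have e2' : ∑ i : Fin 2, fderiv ℝ (fun p : Plane × ℝ => Real.sqrt (g p.1).det *
      (angPerp g p i * (a p * c p))) q (basisVec i, 0) = Real.sqrt (g q.1).det *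
      (fderiv ℝ (fun p => a p * c p) q (perpField g q)
        + fderiv ℝ (fun p => connForm g p.1 (angPerp g p) * (a p * c p)) q (0, 1)) := e2
  simp only [hH, sub_apply, Finset.sum_sub_distrib]
  rw [e1', e2', hG]
  linear_combination Real.sqrt (g q.1).det * hpt

lemma continuousOn_integral_angle {Ω : Set Plane} {F : Plane × ℝ → ℝ}
    (hF : ContinuousOn F (Ω ×ˢ Set.univ)) (a b : ℝ) :
    ContinuousOn (fun x => ∫ θ in a..b, F (x, θ)) Ω := by
  rw [continuousOn_iff_continuous_domRestrict]
  refine intervalIntegral.continuous_parametric_intervalIntegral_of_continuous'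
    (f := fun (x : Ω) θ => F (x, θ)) ?_ a b
  exact hF.comp_continuous (by fun_prop) fun p => ⟨p.1.2, trivial⟩

/-- Differentiation under the integral over the angle. -/
lemma hasFDerivAt_integral_angle {Ω : Set Plane} (hΩ : IsOpen Ω) {F : Plane × ℝ → ℝ}
    (hF : ContDiffOn ℝ 1 F (Ω ×ˢ Set.univ)) {x : Plane} (hx : x ∈ Ω) (a b : ℝ) :
    ∃ L : Plane →L[ℝ] ℝ, HasFDerivAt (fun x => ∫ θ in a..b, F (x, θ)) L x ∧
      ∀ v, L v = ∫ θ in a..b, fderiv ℝ F (x, θ) (v, 0) := by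
  have hO : IsOpen (Ω ×ˢ (Set.univ : Set ℝ)) := hΩ.prod isOpen_univ
  have hdF : ContinuousOn (fderiv ℝ F) (Ω ×ˢ Set.univ) :=
    hF.continuousOn_fderiv_of_isOpen hO (by simp)
  obtain ⟨r, hr, hrΩ⟩ := Metric.nhds_basis_closedBall.mem_iff.mp (hΩ.mem_nhds hx)
  have hK : IsCompact (Metric.closedBall x r ×ˢ Set.uIcc a b) :=
    (isCompact_closedBall x r).prod isCompact_uIcc
  obtain ⟨C, hC⟩ := hK.exists_bound_of_continuousOn
    (hdF.mono (Set.prod_mono hrΩ (Set.subset_univ _)))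
  have hcont : ∀ y ∈ Ω, Continuous fun θ => F (y, θ) := fun y hy =>
    hF.continuousOn.comp_continuous (by fun_prop) fun θ => ⟨hy, trivial⟩
  have hcont' : Continuous fun θ => (fderiv ℝ F (x, θ)) ∘L (ContinuousLinearMap.inl ℝ Plane ℝ) := by
    have : Continuous fun θ => fderiv ℝ F (x, θ) :=
      hdF.comp_continuous (by fun_prop) fun θ => ⟨hx, trivial⟩
    exact this.clm_comp continuous_const
  have h := intervalIntegral.hasFDerivAt_integral_of_dominated_of_fderiv_le (μ := volume)
    (F := fun y θ => F (y, θ)) (x₀ := x) (a := a) (b := b) (bound := fun _ => C)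
    (F' := fun y θ => (fderiv ℝ F (y, θ)) ∘L (ContinuousLinearMap.inl ℝ Plane ℝ))
    (Metric.ball_mem_nhds x hr)
    (Filter.eventually_of_mem (hΩ.mem_nhds hx) fun y hy => (hcont y hy).aestronglyMeasurable)
    ((hcont x hx).intervalIntegrable _ _)
    hcont'.aestronglyMeasurable
    (Filter.Eventually.of_forall fun θ hθ y hy => by
      refine (ContinuousLinearMap.opNorm_comp_le _ _).trans ?_
      have h1 := hC (y, θ) ⟨Metric.ball_subset_closedBall hy, Set.uIoc_subset_uIcc hθ⟩
      have h2 := ContinuousLinearMap.norm_inl_le_one ℝ Plane ℝ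
      nlinarith [norm_nonneg (fderiv ℝ F (y, θ)),
        norm_nonneg (ContinuousLinearMap.inl ℝ Plane ℝ)])
    (by simp)
    (Filter.Eventually.of_forall fun θ hθ y hy => by
      have hyΩ : y ∈ Ω := hrΩ (Metric.ball_subset_closedBall hy)
      have hm : (y, θ) ∈ Ω ×ˢ (Set.univ : Set ℝ) := ⟨hyΩ, Set.mem_univ θ⟩
      have hd : HasFDerivAt F (fderiv ℝ F (y, θ)) (y, θ) :=
        ((hF.contDiffAt (hO.mem_nhds hm)).differentiableAt one_ne_zero).hasFDerivAt
      exact HasFDerivAt.comp (g := F) (f := fun z => (z, θ)) y hd (hasFDerivAt_prodMk_left y θ))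
  refine ⟨_, h, fun v => ?_⟩
  have hi : IntervalIntegrable (fun θ => (fderiv ℝ F (x, θ)) ∘L (ContinuousLinearMap.inl ℝ Plane ℝ))
    volume a b := hcont'.intervalIntegrable a b
  refine (ContinuousLinearMap.intervalIntegral_apply hi v).trans ?_
  rfl

end Pestov
end

noncomputable section

namespace Pestov

/-- Euclidean rotation by 90 degrees. -/
def rot (n : Plane) : Plane := !₂[-n 1, n 0]

@[simp] lemma rot_zero_apply (n : Plane) : rot n 0 = -n 1 := by simp [rot]
@[simp] lemma rot_one_apply (n : Plane) : rot n 1 = n 0 := by simp [rot]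

/-- The chart map `(s, τ) ↦ x + s n^⊥ + (τ + f(s)) n`. -/
def chartMap (x n : Plane) (f : ℝ → ℝ) (p : ℝ × ℝ) : Plane :=
  x + p.1 • rot n + (p.2 + f p.1) • n

/-- The inverse of `chartMap`. -/
def chartInv (x n : Plane) (f : ℝ → ℝ) (y : Plane) : ℝ × ℝ :=
  ((y 1 - x 1) * n 0 - (y 0 - x 0) * n 1,
    (y 0 - x 0) * n 0 + (y 1 - x 1) * n 1 - f ((y 1 - x 1) * n 0 - (y 0 - x 0) * n 1))

section chart

variable {x n : Plane} {f : ℝ → ℝ}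

lemma chartMap_zero (p : ℝ × ℝ) : chartMap x n f p 0 = x 0 - p.1 * n 1 + (p.2 + f p.1) * n 0 := by
  simp [chartMap]; ring

lemma chartMap_one (p : ℝ × ℝ) : chartMap x n f p 1 = x 1 + p.1 * n 0 + (p.2 + f p.1) * n 1 := by
  simp [chartMap]

lemma chartInv_chartMap (hn : n 0 ^ 2 + n 1 ^ 2 = 1) (p : ℝ × ℝ) :
    chartInv x n f (chartMap x n f p) = p := by
  have h1 : (chartMap x n f p 1 - x 1) * n 0 - (chartMap x n f p 0 - x 0) * n 1 = p.1 := by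
    rw [chartMap_zero, chartMap_one]; linear_combination p.1 * hn
  have h2 : (chartMap x n f p 0 - x 0) * n 0 + (chartMap x n f p 1 - x 1) * n 1 = p.2 + f p.1 := by
    rw [chartMap_zero, chartMap_one]; linear_combination (p.2 + f p.1) * hn
  ext1
  · exact h1
  · simp only [chartInv, h1, h2]; ring

lemma chartMap_chartInv (hn : n 0 ^ 2 + n 1 ^ 2 = 1) (y : Plane) :
    chartMap x n f (chartInv x n f y) = y := by
  apply plane_ext
  · rw [chartMap_zero]; simp only [chartInv]; linear_combination (y 0 - x 0) * hn
  · rw [chartMap_one]; simp only [chartInv]; linear_combination (y 1 - x 1) * hn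

lemma continuous_chartMap (hf : Continuous f) : Continuous (chartMap x n f) := by
  unfold chartMap; fun_prop

lemma continuous_chartInv (hf : Continuous f) : Continuous (chartInv x n f) := by
  unfold chartInv; fun_prop

/-- `chartMap` as a homeomorphism. -/
def chartHomeo (hn : n 0 ^ 2 + n 1 ^ 2 = 1) (hf : Continuous f) : ℝ × ℝ ≃ₜ Plane where
  toFun := chartMap x n f
  invFun := chartInv x n f
  left_inv := chartInv_chartMap hn
  right_inv := chartMap_chartInv hn
  continuous_toFun := continuous_chartMap hf
  continuous_invFun := continuous_chartInv hf

lemma norm_frame_sq (hn : n 0 ^ 2 + n 1 ^ 2 = 1) (s t : ℝ) :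
    ‖s • rot n + t • n‖ ^ 2 = s ^ 2 + t ^ 2 := by
  rw [EuclideanSpace.norm_sq_eq]
  simp [Fin.sum_univ_two]
  linear_combination (s ^ 2 + t ^ 2) * hn

/-- The rotation taking the standard basis to `(n^⊥, n)`. -/
def rotIso (hn : n 0 ^ 2 + n 1 ^ 2 = 1) : Plane ≃ₗᵢ[ℝ] Plane :=
  LinearIsometry.toLinearIsometryEquiv
    { toFun := fun z => z 0 • rot n + z 1 • n
      map_add' := fun z w => by simp only [PiLp.add_apply]; module
      map_smul' := fun c z => by
        simp only [PiLp.smul_apply, smul_eq_mul, RingHom.id_apply]; module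
      norm_map' := fun z => by
        have h := norm_frame_sq hn (z 0) (z 1)
        have h2 : ‖z‖ ^ 2 = z 0 ^ 2 + z 1 ^ 2 := by
          rw [EuclideanSpace.norm_sq_eq]; simp [Fin.sum_univ_two]
        exact (sq_eq_sq₀ (norm_nonneg _) (norm_nonneg _)).mp (h.trans h2.symm) } rfl

lemma measurePreserving_chartMap (hn : n 0 ^ 2 + n 1 ^ 2 = 1) (hf : Continuous f) :
    MeasurePreserving (chartMap x n f) (volume : Measure (ℝ × ℝ)) volume := by
  have h1 : MeasurePreserving (fun p : ℝ × ℝ => (p.1, p.2 + f p.1)) volume volume := by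
    refine MeasurePreserving.skew_product (g := fun s τ => τ + f s) (MeasurePreserving.id volume)
      (by fun_prop) ?_
    exact Filter.Eventually.of_forall fun s => (measurePreserving_add_right volume (f s)).map_eq
  have h2 : MeasurePreserving (fun p : ℝ × ℝ => (WithLp.toLp 2 ![p.1, p.2] : Plane)) volume volume := by
    have e1 := (volume_preserving_finTwoArrow ℝ).symm
    have e2 := (PiLp.volume_preserving_toLp (Fin 2))
    exact e2.comp e1
  have h3 := (rotIso hn).measurePreserving
  have h4 := measurePreserving_add_left (volume : Measure Plane) x
  have := h4.comp (h3.comp (h2.comp h1))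
  convert! this using 1
  funext p
  simp only [Function.comp, chartMap]
  change _ = x + (p.1 • rot n + (p.2 + f p.1) • n)
  rw [add_assoc]

lemma hasFDerivAt_chartMap {p : ℝ × ℝ} {f' : ℝ} (hf : HasDerivAt f f' p.1) :
    ∃ L : ℝ × ℝ →L[ℝ] Plane, HasFDerivAt (chartMap x n f) L p ∧
      ∀ σ τ, L (σ, τ) = σ • rot n + (τ + f' * σ) • n := by
  have h1 : HasFDerivAt (fun p : ℝ × ℝ => p.1) (ContinuousLinearMap.fst ℝ ℝ ℝ) p := hasFDerivAt_fst
  have h2 : HasFDerivAt (fun p : ℝ × ℝ => p.2) (ContinuousLinearMap.snd ℝ ℝ ℝ) p := hasFDerivAt_snd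
  have h3 := hf.comp_hasFDerivAt p h1
  have h := ((h1.smul_const (rot n)).const_add x).add ((h2.add h3).smul_const n)
  refine ⟨_, h, fun σ τ => ?_⟩
  simp

end chart

/-- Near `x`, the set `M` is, in suitable rotated coordinates, the region below the graph of a
`C²` function. -/
structure GraphChart (M : Set Plane) (x : Plane) where
  n : Plane
  f : ℝ → ℝ
  a : ℝ
  h : ℝ
  unit : n 0 ^ 2 + n 1 ^ 2 = 1
  smooth : ContDiff ℝ 2 f
  f_zero : f 0 = 0
  a_pos : 0 < a
  h_pos : 0 < h
  mem_iff : ∀ s ∈ Set.Ioo (-a) a, ∀ τ ∈ Set.Ioo (-h) h, chartMap x n f (s, τ) ∈ M ↔ τ ≤ 0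

lemma exists_contDiff_eq {k : ℕ} {f : ℝ → ℝ} (hf : ContDiffAt ℝ k f 0) :
    ∃ F : ℝ → ℝ, ContDiff ℝ k F ∧ F =ᶠ[nhds 0] f := by
  obtain ⟨u, hu, hfu⟩ := hf.contDiffOn (m := k) le_rfl (by simp)
  obtain ⟨ε, hε, hεu⟩ := Metric.mem_nhds_iff.mp hu
  let φ : ContDiffBump (0 : ℝ) := ⟨ε / 3, ε / 2, by positivity, by linarith⟩
  refine ⟨fun t => φ t * f t, ?_, ?_⟩
  · rw [contDiff_iff_contDiffAt]
    intro t
    by_cases ht : t ∈ Metric.ball (0 : ℝ) ε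
    · exact φ.contDiff.contDiffAt.mul (hfu.contDiffAt (Filter.mem_of_superset
        (Metric.isOpen_ball.mem_nhds ht) hεu))
    · have : (fun t => φ t * f t) =ᶠ[nhds t] fun _ => 0 := by
        have h1 : t ∉ Metric.closedBall (0 : ℝ) (ε / 2) := fun h =>
          ht (Metric.closedBall_subset_ball (by linarith) h)
        filter_upwards [Metric.isClosed_closedBall.isOpen_compl.mem_nhds h1] with y hy
        rw [φ.zero_of_le_dist (le_of_lt (by simpa using hy)), zero_mul]
      exact contDiffAt_const.congr_of_eventuallyEq this
  · filter_upwards [φ.eventuallyEq_one] with t ht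
    simp [ht]

lemma IsLocalDefiningFunction.eq_zero {M : Set Plane} {x : Plane} {b : Plane → ℝ}
    (hb : IsLocalDefiningFunction M x b) (hx : x ∈ frontier M) : b x = 0 := by
  obtain ⟨U, hU, hxU, hbU, -, hM⟩ := hb
  have hc : ContinuousAt b x := (hbU.continuousOn).continuousAt (hU.mem_nhds hxU)
  rcases lt_trichotomy (b x) 0 with h | h | h
  · exfalso
    refine hx.2 (mem_interior_iff_mem_nhds.mpr ?_)
    filter_upwards [hU.mem_nhds hxU, hc.eventually (gt_mem_nhds h)] with y hy hy'
    have : y ∈ M ∩ U := by rw [hM]; exact ⟨hy, le_of_lt hy'⟩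
    exact this.1
  · exact h
  · exfalso
    have hx1 := mem_closure_iff_nhds.mp hx.1 _
      (Filter.inter_mem (hU.mem_nhds hxU) (hc.eventually (lt_mem_nhds h)))
    obtain ⟨y, ⟨hyU, hy'⟩, hyM⟩ := hx1
    have : y ∈ M ∩ U := ⟨hyM, hyU⟩
    rw [hM] at this
    have h1 := this.2
    have h2 : 0 < b y := hy'
    linarith

theorem IsLocalDefiningFunction.nonempty_graphChart {M : Set Plane} {x : Plane} {b : Plane → ℝ}
    (hb : IsLocalDefiningFunction M x b) (hx : x ∈ frontier M) : Nonempty (GraphChart M x) := by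
  have hbx := hb.eq_zero hx
  obtain ⟨U, hU, hxU, hbU, hdb, hM⟩ := hb
  set G : Plane := !₂[pd 0 b x, pd 1 b x] with hG
  have hG0 : G 0 = pd 0 b x := by simp [hG]
  have hG1 : G 1 = pd 1 b x := by simp [hG]
  set ℓ := Real.sqrt (pd 0 b x ^ 2 + pd 1 b x ^ 2) with hℓ
  have hℓpos : 0 < ℓ := by
    apply Real.sqrt_pos.mpr
    by_contra hcon
    have h0 : pd 0 b x = 0 := by nlinarith [sq_nonneg (pd 0 b x), sq_nonneg (pd 1 b x)]
    have h1 : pd 1 b x = 0 := by nlinarith [sq_nonneg (pd 0 b x), sq_nonneg (pd 1 b x)]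
    apply hdb
    ext v
    · rw [fderiv_eq_pd, h0, h1]; simp
  have hℓsq : ℓ ^ 2 = pd 0 b x ^ 2 + pd 1 b x ^ 2 := Real.sq_sqrt (by positivity)
  set n : Plane := ℓ⁻¹ • G with hn
  have hn0 : n 0 = ℓ⁻¹ * pd 0 b x := by simp [hn, hG0]
  have hn1 : n 1 = ℓ⁻¹ * pd 1 b x := by simp [hn, hG1]
  have hunit : n 0 ^ 2 + n 1 ^ 2 = 1 := by
    rw [hn0, hn1]; field_simp; linarith
  have hdn : fderiv ℝ b x n = ℓ := by
    rw [fderiv_eq_pd, hn0, hn1]; field_simp; linarith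
  set c : ℝ × ℝ → Plane := chartMap x n (fun _ => 0) with hc
  have hc0 : c 0 = x := by simp [hc, chartMap]
  have hcs : ContDiff ℝ ∞ c := by
    rw [hc]; unfold chartMap; fun_prop
  set B : ℝ × ℝ → ℝ := fun p => b (c p) with hB
  have hUo : IsOpen (c ⁻¹' U) := hU.preimage hcs.continuous
  have hBU : ContDiffOn ℝ ∞ B (c ⁻¹' U) := hbU.comp hcs.contDiffOn fun p hp => hp
  have h0U : (0 : ℝ × ℝ) ∈ c ⁻¹' U := by rw [Set.mem_preimage, hc0]; exact hxU
  have hB0 : ContDiffAt ℝ 2 B 0 := (hBU.contDiffAt (hUo.mem_nhds h0U)).of_le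
    (WithTop.coe_le_coe.2 le_top)
  have hBv : ∀ p ∈ c ⁻¹' U, fderiv ℝ B p (0, 1) = fderiv ℝ b (c p) n := by
    intro p hp
    obtain ⟨L, hL, hL'⟩ := hasFDerivAt_chartMap (x := x) (n := n) (f := fun _ => 0) (p := p)
      (hasDerivAt_const p.1 (0 : ℝ))
    have hbp : HasFDerivAt b (fderiv ℝ b (c p)) (c p) :=
      ((hbU.contDiffAt (hU.mem_nhds hp)).differentiableAt (by simp)).hasFDerivAt
    have hBp : HasFDerivAt B ((fderiv ℝ b (c p)) ∘L L) p := hbp.comp p hL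
    rw [hBp.fderiv, ContinuousLinearMap.comp_apply, hL']
    simp
  have hBd : fderiv ℝ B 0 (0, 1) = ℓ := by rw [hBv 0 h0U, hc0, hdn]
  have hinv : (fderiv ℝ B 0 ∘L .inr ℝ ℝ ℝ).IsInvertible := by
    refine ⟨ContinuousLinearEquiv.unitsEquivAut ℝ (Units.mk0 ℓ hℓpos.ne'), ?_⟩
    ext
    simp [hBd]
  have hψ := hB0.contDiffAt_implicitFunction (by norm_num) hinv
  have hψ0 := hB0.implicitFunction_apply_self (by norm_num) hinv
  have hψe := hB0.eventually_apply_implicitFunction (by norm_num) hinv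
  obtain ⟨f, hf, hfe⟩ := exists_contDiff_eq (k := 2) hψ
  have hf0 : f 0 = 0 := by rw [hfe.self_of_nhds]; exact hψ0
  have hB00 : B 0 = 0 := by simp [hB, hc0, hbx]
  have hBf : ∀ᶠ s in nhds (0 : ℝ), B (s, f s) = 0 := by
    filter_upwards [hψe, hfe] with s h1 h2
    rw [h2, h1, hB00]
  have hpos : ∀ᶠ p in nhds (0 : ℝ × ℝ), p ∈ c ⁻¹' U ∧ 0 < fderiv ℝ B p (0, 1) := by
    refine Filter.Eventually.and (hUo.mem_nhds h0U) ?_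
    have hcont : ContinuousAt (fun p => fderiv ℝ B p (0, 1)) 0 :=
      ((hB0.fderiv_right (m := 1) (by norm_num)).continuousAt).clm_apply continuousAt_const
    exact hcont.eventually (lt_mem_nhds (hℓpos.trans_eq hBd.symm))
  rw [show (0 : ℝ × ℝ) = (0, 0) from rfl, nhds_prod_eq] at hpos
  obtain ⟨pa, hpa, pb, hpb, hab⟩ := Filter.eventually_prod_iff.mp hpos
  obtain ⟨h, hh, hball⟩ := Metric.eventually_nhds_iff.mp hpb
  have hfsmall : ∀ᶠ s in nhds (0 : ℝ), |f s| < h / 2 := by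
    have : Filter.Tendsto (fun s => |f s|) (nhds 0) (nhds |f 0|) := (hf.continuous.abs).tendsto 0
    rw [hf0, abs_zero] at this
    exact this.eventually (gt_mem_nhds (by positivity))
  obtain ⟨a, ha, hball'⟩ := Metric.eventually_nhds_iff.mp ((hpa.and hBf).and hfsmall)
  refine ⟨⟨n, f, a, h / 2, hunit, hf, hf0, ha, by positivity, fun s hs τ hτ => ?_⟩⟩
  obtain ⟨⟨hs1, hs2⟩, hs3⟩ := hball' (y := s) (by rw [Real.dist_eq, sub_zero]; exact abs_lt.mpr hs)
  rw [abs_lt] at hs3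
  have hin : ∀ t ∈ Set.Ioo (-h) h, (s, t) ∈ c ⁻¹' U ∧ 0 < fderiv ℝ B (s, t) (0, 1) := fun t ht =>
    hab hs1 (hball (by rw [Real.dist_eq, sub_zero]; exact abs_lt.mpr ht))
  have hderiv : ∀ t ∈ Set.Ioo (-h) h, HasDerivAt (fun t => B (s, t)) (fderiv ℝ B (s, t) (0, 1)) t := by
    intro t ht
    have hd : HasFDerivAt B (fderiv ℝ B (s, t)) (s, t) :=
      ((hBU.contDiffAt (hUo.mem_nhds (hin t ht).1)).differentiableAt (by simp)).hasFDerivAt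
    exact hd.comp_hasDerivAt t ((hasDerivAt_const t s).prodMk (hasDerivAt_id t))
  have hmono : StrictMonoOn (fun t => B (s, t)) (Set.Ioo (-h) h) := by
    apply strictMonoOn_of_deriv_pos (convex_Ioo _ _)
    · exact fun t ht => (hderiv t ht).continuousAt.continuousWithinAt
    · intro t ht
      rw [interior_Ioo] at ht
      rw [(hderiv t ht).deriv]
      exact (hin t ht).2
  have ht1 : τ + f s ∈ Set.Ioo (-h) h := ⟨by linarith [hτ.1], by linarith [hτ.2]⟩
  have ht2 : f s ∈ Set.Ioo (-h) h := ⟨by linarith, by linarith⟩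
  have hpt : chartMap x n f (s, τ) = c (s, τ + f s) := by simp [hc, chartMap]
  have hmem : c (s, τ + f s) ∈ M ↔ B (s, τ + f s) ≤ 0 := by
    have : c (s, τ + f s) ∈ M ∩ U ↔ c (s, τ + f s) ∈ {y ∈ U | b y ≤ 0} := by rw [hM]
    have hU' : c (s, τ + f s) ∈ U := (hin _ ht1).1
    constructor
    · exact fun h => (this.mp ⟨h, hU'⟩).2
    · exact fun h => (this.mpr ⟨hU', h⟩).1
  rw [hpt, hmem, ← hs2]
  have : B (s, τ + f s) ≤ B (s, f s) ↔ τ + f s ≤ f s := hmono.le_iff_le ht1 ht2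
  rw [this]
  constructor <;> intro <;> linarith

end Pestov
end

noncomputable section

namespace Pestov

variable {g : MetricField} {D M : Set Plane} {x y : Plane}

/-- The Euclidean gradient of `b` rotated by 90 degrees. -/
def rotGrad (b : Plane → ℝ) (x : Plane) : Plane := !₂[-pd 1 b x, pd 0 b x]

@[simp] lemma rotGrad_zero_apply (b : Plane → ℝ) (x : Plane) : rotGrad b x 0 = -pd 1 b x := by
  simp [rotGrad]
@[simp] lemma rotGrad_one_apply (b : Plane → ℝ) (x : Plane) : rotGrad b x 1 = pd 0 b x := by
  simp [rotGrad]

lemma rotGrad_ne_zero {b : Plane → ℝ} (hb : fderiv ℝ b x ≠ 0) : rotGrad b x ≠ 0 := by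
  intro h
  apply hb
  have h0 : pd 0 b x = 0 := by rw [← rotGrad_one_apply, h]; rfl
  have h1 : pd 1 b x = 0 := by
    have : -pd 1 b x = 0 := by rw [← rotGrad_zero_apply, h]; rfl
    linarith
  ext v
  rw [fderiv_eq_pd, h0, h1]; simp

lemma ip_perp_rotGrad (hg : IsRiemannianMetricOn g D) (hx : x ∈ D) (b : Plane → ℝ) (w : Plane) :
    ip g x (perp g x (rotGrad b x)) w = - Real.sqrt (g x).det * fderiv ℝ b x w := by
  have h := inv_sqrt_det_sq hg hx
  have hs := hg.symm hx 1 0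
  have hd := (sqrt_det_pos hg hx).ne'
  rw [hs, ] at h
  have hD2 : g x 0 0 * g x 1 1 - g x 0 1 * g x 0 1 = Real.sqrt (g x).det ^ 2 := by
    field_simp at h; rw [← h]; ring
  rw [fderiv_eq_pd, ip_eq]
  simp only [perp_zero_apply, perp_one_apply, hs, rotGrad_zero_apply, rotGrad_one_apply]
  have : (Real.sqrt (g x).det)⁻¹ * (g x 0 0 * g x 1 1 - g x 0 1 * g x 0 1) = Real.sqrt (g x).det := by
    rw [hD2]; field_simp
  linear_combination (- w 0 * pd 0 b x - w 1 * pd 1 b x) * this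

lemma eq_zero_of_ip (hg : IsRiemannianMetricOn g D) (hx : x ∈ D) {v : Plane}
    (h : ∀ w, ip g x v w = 0) : v = 0 := by
  by_contra hv
  exact (ip_self_pos hg hx hv).ne' (h v)

lemma IsLocalDefiningFunction.fderiv_nonpos {b : Plane → ℝ} (hb : IsLocalDefiningFunction M x b)
    (hx : x ∈ frontier M) {γ : ℝ → Plane} {v : Plane} (h0 : γ 0 = x) (hγ : HasDerivAt γ v 0)
    (hM : ∀ᶠ t in nhdsWithin 0 (Set.Ioi (0 : ℝ)), γ t ∈ M) : fderiv ℝ b x v ≤ 0 := by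
  have hbx := hb.eq_zero hx
  obtain ⟨U, hU, hxU, hbU, -, hMU⟩ := hb
  have hd : HasFDerivAt b (fderiv ℝ b (γ 0)) (γ 0) := by
    rw [h0]
    exact ((hbU.contDiffAt (hU.mem_nhds hxU)).differentiableAt (by simp)).hasFDerivAt
  have hbγ : HasDerivAt (fun t => b (γ t)) (fderiv ℝ b (γ 0) v) 0 := hd.comp_hasDerivAt 0 hγ
  rw [h0] at hbγ
  have ht := hbγ.hasDerivWithinAt (s := Set.Ioi 0)
  rw [hasDerivWithinAt_iff_tendsto_slope' (by simp)] at ht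
  refine le_of_tendsto ht ?_
  have hγU : ∀ᶠ t in nhdsWithin 0 (Set.Ioi (0 : ℝ)), γ t ∈ U :=
    (hγ.continuousAt.eventually (by rw [h0]; exact hU.mem_nhds hxU)).filter_mono nhdsWithin_le_nhds
  filter_upwards [hM, hγU, self_mem_nhdsWithin] with t h1 h2 h3
  have h4 : γ t ∈ M ∩ U := ⟨h1, h2⟩
  rw [hMU] at h4
  simp only [slope, vsub_eq_sub, sub_zero, smul_eq_mul, h0, hbx]
  exact mul_nonpos_of_nonneg_of_nonpos (inv_nonneg.mpr (le_of_lt h3)) h4.2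

lemma exists_curve_of_neg {b : Plane → ℝ} (hb : IsLocalDefiningFunction M x b)
    (hx : x ∈ frontier M) {v : Plane} (hv : fderiv ℝ b x v < 0) :
    ∀ᶠ t in nhdsWithin 0 (Set.Ioi (0 : ℝ)), x + t • v ∈ M := by
  have hbx := hb.eq_zero hx
  obtain ⟨U, hU, hxU, hbU, -, hMU⟩ := hb
  have hγ : HasDerivAt (fun t : ℝ => x + t • v) v 0 := by
    simpa using ((hasDerivAt_id (0 : ℝ)).smul_const v).const_add x
  have h0 : x + (0 : ℝ) • v = x := by simp
  have hd : HasFDerivAt b (fderiv ℝ b x) (x + (0 : ℝ) • v) := by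
    rw [h0]
    exact ((hbU.contDiffAt (hU.mem_nhds hxU)).differentiableAt (by simp)).hasFDerivAt
  have hbγ : HasDerivAt (fun t : ℝ => b (x + t • v)) (fderiv ℝ b x v) 0 := hd.comp_hasDerivAt 0 hγ
  have ht := hbγ.hasDerivWithinAt (s := Set.Ioi 0)
  rw [hasDerivWithinAt_iff_tendsto_slope' (by simp)] at ht
  have hγU : ∀ᶠ t in nhdsWithin 0 (Set.Ioi (0 : ℝ)), x + t • v ∈ U :=
    (hγ.continuousAt.eventually (by
      change U ∈ nhds (x + (0 : ℝ) • v)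
      rw [h0]; exact hU.mem_nhds hxU)).filter_mono nhdsWithin_le_nhds
  filter_upwards [ht.eventually (gt_mem_nhds hv), hγU, self_mem_nhdsWithin] with t h1 h2 h3
  simp only [slope, vsub_eq_sub, sub_zero, smul_eq_mul, h0, hbx] at h1
  have h5 : b (x + t • v) ≤ 0 := by
    by_contra hcon
    push Not at hcon
    have := mul_pos (inv_pos.mpr h3) hcon
    linarith
  have : x + t • v ∈ M ∩ U := by rw [hMU]; exact ⟨h2, h5⟩
  exact this.1

/-- The differentials of two defining functions are positively proportional. -/
lemma IsLocalDefiningFunction.rotGrad_eq {b b' : Plane → ℝ} (hb : IsLocalDefiningFunction M x b)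
    (hb' : IsLocalDefiningFunction M x b') (hx : x ∈ frontier M) :
    ∃ c : ℝ, 0 < c ∧ rotGrad b' x = c • rotGrad b x := by
  have key : ∀ v, fderiv ℝ b x v < 0 → fderiv ℝ b' x v ≤ 0 := fun v hv =>
    hb'.fderiv_nonpos hx (γ := fun t => x + t • v) (by simp)
      (by simpa using ((hasDerivAt_id (0 : ℝ)).smul_const v).const_add x)
      (exists_curve_of_neg hb hx hv)
  obtain ⟨-, -, -, -, hd, -⟩ := hb
  obtain ⟨-, -, -, -, hd', -⟩ := hb'
  have h1 := rotGrad_ne_zero hd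
  have h2 := rotGrad_ne_zero hd'
  simp only [fderiv_eq_pd] at key
  set p := pd 0 b x
  set q := pd 1 b x
  set p' := pd 0 b' x
  set q' := pd 1 b' x
  have hpq : 0 < p ^ 2 + q ^ 2 := by
    by_contra hcon
    apply h1
    apply plane_ext
    · simp; change q = 0; nlinarith [sq_nonneg p, sq_nonneg q]
    · simp; change p = 0; nlinarith [sq_nonneg p, sq_nonneg q]
  have hv : ∀ s : ℝ, -(p * p' + q * q') + s * (q' * p - p' * q) ≤ 0 := by
    intro s
    have := key !₂[-p - s * q, -q + s * p] (by simp; nlinarith)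
    simp at this
    nlinarith
  have hcr : q' * p - p' * q = 0 := by
    by_contra hne
    have := hv ((1 + (p * p' + q * q')) / (q' * p - p' * q))
    rw [div_mul_cancel₀ _ hne] at this
    linarith
  have hpos : 0 ≤ p * p' + q * q' := by have := hv 0; linarith
  have hc0 : p' = (p * p' + q * q') / (p ^ 2 + q ^ 2) * p := by
    rw [div_mul_eq_mul_div, eq_div_iff hpq.ne']; linear_combination -q * hcr
  have hc1 : q' = (p * p' + q * q') / (p ^ 2 + q ^ 2) * q := by
    rw [div_mul_eq_mul_div, eq_div_iff hpq.ne']; linear_combination p * hcr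
  refine ⟨(p * p' + q * q') / (p ^ 2 + q ^ 2), ?_, ?_⟩
  · refine lt_of_le_of_ne (div_nonneg hpos hpq.le) fun h => ?_
    rw [← h, zero_mul] at hc0 hc1
    apply h2
    apply plane_ext
    · simp; exact hc1
    · simp; exact hc0
  · apply plane_ext
    · simp; exact hc1
    · simp; exact hc0

/-- The unit tangent determined by a defining function. -/
def unitTangent (g : MetricField) (b : Plane → ℝ) (x : Plane) : Plane :=
  (gnorm g x (rotGrad b x))⁻¹ • rotGrad b x

lemma gnorm_pos (hg : IsRiemannianMetricOn g D) (hx : x ∈ D) {v : Plane} (hv : v ≠ 0) :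
    0 < gnorm g x v := Real.sqrt_pos.mpr (ip_self_pos hg hx hv)

lemma gnorm_sq (hg : IsRiemannianMetricOn g D) (hx : x ∈ D) (v : Plane) :
    gnorm g x v ^ 2 = ip g x v v := by
  by_cases hv : v = 0
  · simp [hv, gnorm, ip]
  · exact Real.sq_sqrt (ip_self_pos hg hx hv).le

lemma gnorm_smul (g : MetricField) (x : Plane) {c : ℝ} (hc : 0 ≤ c) (v : Plane) :
    gnorm g x (c • v) = c * gnorm g x v := by
  rw [gnorm, gnorm, ip_smul_left, ip_smul_right, ← mul_assoc, ← sq, Real.sqrt_mul (sq_nonneg c),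
    Real.sqrt_sq hc]

lemma ip_normalize (hg : IsRiemannianMetricOn g D) (hx : x ∈ D) {v : Plane} (hv : v ≠ 0) :
    ip g x ((gnorm g x v)⁻¹ • v) ((gnorm g x v)⁻¹ • v) = 1 := by
  have := gnorm_pos hg hx hv
  rw [ip_smul_left, ip_smul_right, ← gnorm_sq hg hx]
  field_simp

lemma unitTangent_congr (hg : IsRiemannianMetricOn g D) (hxD : x ∈ D) {b b' : Plane → ℝ}
    (hb : IsLocalDefiningFunction M x b) (hb' : IsLocalDefiningFunction M x b')
    (hx : x ∈ frontier M) : unitTangent g b' x = unitTangent g b x := by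
  obtain ⟨c, hc, h⟩ := hb.rotGrad_eq hb' hx
  obtain ⟨-, -, -, -, hd, -⟩ := hb
  have := gnorm_pos hg hxD (rotGrad_ne_zero hd)
  rw [unitTangent, unitTangent, h, gnorm_smul g x hc.le, smul_smul]
  congr 1
  field_simp

lemma isOuterUnitNormal_unitTangent (hg : IsRiemannianMetricOn g D) (hxD : x ∈ D) {b : Plane → ℝ}
    (hb : IsLocalDefiningFunction M x b) :
    IsOuterUnitNormal g M x (- perp g x (unitTangent g b x)) := by
  have hd : fderiv ℝ b x ≠ 0 := by obtain ⟨-, -, -, -, hd, -⟩ := hb; exact hd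
  have hn := gnorm_pos hg hxD (rotGrad_ne_zero hd)
  refine ⟨?_, b, hb, (gnorm g x (rotGrad b x))⁻¹ * Real.sqrt (g x).det,
    mul_pos (inv_pos.mpr hn) (sqrt_det_pos hg hxD), fun w => ?_⟩
  · rw [ip_neg_left, ip_neg_right, neg_neg, ip_perp_perp hg hxD, unitTangent,
      ip_normalize hg hxD (rotGrad_ne_zero hd)]
  · rw [unitTangent, perp_smul, ip_neg_left, ip_smul_left, ip_perp_rotGrad hg hxD]
    ring

lemma IsOuterUnitNormal.eq (hg : IsRiemannianMetricOn g D) (hxD : x ∈ D) (hx : x ∈ frontier M)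
    {b : Plane → ℝ} (hb : IsLocalDefiningFunction M x b) {ν : Plane}
    (hν : IsOuterUnitNormal g M x ν) : ν = - perp g x (unitTangent g b x) := by
  obtain ⟨h1, b', hb', c, hc, h2⟩ := hν
  obtain ⟨h3, -⟩ := isOuterUnitNormal_unitTangent hg hxD hb'
  rw [← unitTangent_congr hg hxD hb hb' hx]
  have hd : fderiv ℝ b' x ≠ 0 := by obtain ⟨-, -, -, -, hd, -⟩ := hb'; exact hd
  have hn := gnorm_pos hg hxD (rotGrad_ne_zero hd)
  have hsd := sqrt_det_pos hg hxD
  set ν' := - perp g x (unitTangent g b' x) with hν'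
  have h4 : ∀ w, ip g x ν' w = (gnorm g x (rotGrad b' x))⁻¹ * Real.sqrt (g x).det * fderiv ℝ b' x w := by
    intro w
    rw [hν', unitTangent, perp_smul, ip_neg_left, ip_smul_left, ip_perp_rotGrad hg hxD]
    ring
  set k := (gnorm g x (rotGrad b' x))⁻¹ * Real.sqrt (g x).det with hk
  have hkpos : 0 < k := mul_pos (inv_pos.mpr hn) hsd
  have h5 : ν = (c / k) • ν' := by
    rw [← sub_eq_zero]
    apply eq_zero_of_ip hg hxD
    intro w
    rw [ip_sub_left, ip_smul_left, h2, h4]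
    field_simp
    ring
  have h6 : (c / k) ^ 2 = 1 := by
    rw [h5, ip_smul_left, ip_smul_right, h3] at h1
    linear_combination h1
  have h7 : c / k = 1 := by
    have : 0 < c / k := div_pos hc hkpos
    nlinarith
  rw [h5, h7, one_smul]

lemma outerNormal_eq (hg : IsRiemannianMetricOn g D) (hxD : x ∈ D) (hx : x ∈ frontier M)
    {b : Plane → ℝ} (hb : IsLocalDefiningFunction M x b) :
    outerNormal g M x = - perp g x (unitTangent g b x) := by
  have h : ∃ n, IsOuterUnitNormal g M x n := ⟨_, isOuterUnitNormal_unitTangent hg hxD hb⟩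
  rw [outerNormal, dif_pos h]
  exact IsOuterUnitNormal.eq hg hxD hx hb h.choose_spec

lemma bdryTangent_eq (hg : IsRiemannianMetricOn g D) (hxD : x ∈ D) (hx : x ∈ frontier M)
    {b : Plane → ℝ} (hb : IsLocalDefiningFunction M x b) :
    bdryTangent g M x = unitTangent g b x := by
  rw [bdryTangent, outerNormal_eq hg hxD hx hb, perp_neg, perp_perp hg hxD, neg_neg]

namespace GraphChart

variable (ch : GraphChart M x)

/-- The parametrization of a neighbourhood. -/
def map : ℝ × ℝ → Plane := chartMap x ch.n ch.f

/-- The coordinate box of the chart. -/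
def box : Set (ℝ × ℝ) := Set.Ioo (-ch.a) ch.a ×ˢ Set.Ioo (-ch.h) ch.h

/-- The coordinate neighbourhood. -/
def nbhd : Set Plane := ch.map '' ch.box

/-- The velocity of the boundary curve `s ↦ map (s, 0)`. -/
def velocity (s : ℝ) : Plane := rot ch.n + deriv ch.f s • ch.n

lemma isOpen_box : IsOpen ch.box := isOpen_Ioo.prod isOpen_Ioo

lemma continuous_map : Continuous ch.map := continuous_chartMap ch.smooth.continuous

lemma injective_map : Function.Injective ch.map :=
  (chartHomeo (x := x) ch.unit ch.smooth.continuous).injective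

lemma isOpen_image {s : Set (ℝ × ℝ)} (hs : IsOpen s) : IsOpen (ch.map '' s) :=
  (chartHomeo (x := x) ch.unit ch.smooth.continuous).isOpenMap s hs

lemma isOpen_nbhd : IsOpen ch.nbhd := ch.isOpen_image ch.isOpen_box

lemma map_zero : ch.map (0, 0) = x := by simp [map, chartMap, ch.f_zero]

lemma zero_mem_box : ((0, 0) : ℝ × ℝ) ∈ ch.box :=
  ⟨⟨by simpa using ch.a_pos, ch.a_pos⟩, ⟨by simpa using ch.h_pos, ch.h_pos⟩⟩

lemma mem_nbhd : x ∈ ch.nbhd := ⟨(0, 0), ch.zero_mem_box, ch.map_zero⟩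

lemma map_mem_iff {p : ℝ × ℝ} (hp : p ∈ ch.box) : ch.map p ∈ M ↔ p.2 ≤ 0 :=
  ch.mem_iff p.1 hp.1 p.2 hp.2

lemma map_mem_interior_iff {p : ℝ × ℝ} (hp : p ∈ ch.box) : ch.map p ∈ interior M ↔ p.2 < 0 := by
  constructor
  · intro h
    have h0 : p.2 ≤ 0 := (ch.map_mem_iff hp).mp (interior_subset h)
    refine lt_of_le_of_ne h0 fun h1 => ?_
    have hc : Continuous fun t : ℝ => ch.map (p.1, t) := ch.continuous_map.comp (by fun_prop)
    have hopen : ∀ᶠ t in nhds p.2, ch.map (p.1, t) ∈ interior M :=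
      hc.continuousAt.eventually (isOpen_interior.mem_nhds h)
    rw [h1] at hopen
    have h2 : ∀ᶠ t in nhds (0 : ℝ), t ∈ Set.Ioo (-ch.h) ch.h :=
      isOpen_Ioo.mem_nhds ⟨by simpa using ch.h_pos, ch.h_pos⟩
    obtain ⟨t, ⟨⟨ht1, ht2⟩, ht3⟩⟩ := (((hopen.and h2).filter_mono nhdsWithin_le_nhds).and
      (self_mem_nhdsWithin (a := (0 : ℝ)) (s := Set.Ioi 0))).exists
    have := (ch.map_mem_iff (p := (p.1, t)) ⟨hp.1, ht2⟩).mp (interior_subset ht1)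
    exact absurd ht3 (not_lt.mpr this)
  · intro h
    refine mem_interior.mpr ⟨ch.map '' (Set.Ioo (-ch.a) ch.a ×ˢ Set.Ioo (-ch.h) 0), ?_,
      ch.isOpen_image (isOpen_Ioo.prod isOpen_Ioo), ⟨p, ⟨hp.1, hp.2.1, h⟩, rfl⟩⟩
    rintro _ ⟨q, hq, rfl⟩
    exact (ch.map_mem_iff ⟨hq.1, hq.2.1, hq.2.2.trans ch.h_pos⟩).mpr hq.2.2.le

lemma map_mem_frontier_iff (hM : IsClosed M) {p : ℝ × ℝ} (hp : p ∈ ch.box) :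
    ch.map p ∈ frontier M ↔ p.2 = 0 := by
  rw [hM.frontier_eq, Set.mem_sdiff, ch.map_mem_iff hp, ch.map_mem_interior_iff hp, not_lt]
  exact ⟨fun h => le_antisymm h.1 h.2, fun h => ⟨h.le, h.ge⟩⟩

lemma hasFDerivAt_map (p : ℝ × ℝ) : ∃ L : ℝ × ℝ →L[ℝ] Plane, HasFDerivAt ch.map L p ∧
    ∀ σ τ, L (σ, τ) = σ • ch.velocity p.1 + τ • ch.n := by
  obtain ⟨L, hL, h⟩ := hasFDerivAt_chartMap (x := x) (n := ch.n) (p := p)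
    ((ch.smooth.differentiable (by norm_num)) p.1).hasDerivAt
  refine ⟨L, hL, fun σ τ => ?_⟩
  rw [h, velocity]; module

lemma hasDerivAt_curve (s τ : ℝ) :
    HasDerivAt (fun s => ch.map (s, τ)) (ch.velocity s) s := by
  obtain ⟨L, hL, h⟩ := ch.hasFDerivAt_map (s, τ)
  have := hL.comp_hasDerivAt s ((hasDerivAt_id s).prodMk (hasDerivAt_const s τ))
  rw [h, one_smul, zero_smul, add_zero] at this
  exact this

lemma hasDerivAt_normal (s τ : ℝ) : HasDerivAt (fun τ => ch.map (s, τ)) ch.n τ := by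
  obtain ⟨L, hL, h⟩ := ch.hasFDerivAt_map (s, τ)
  have := hL.comp_hasDerivAt τ ((hasDerivAt_const τ s).prodMk (hasDerivAt_id τ))
  rw [h, one_smul, zero_smul, zero_add] at this
  exact this

lemma velocity_ne_zero (s : ℝ) : ch.velocity s ≠ 0 := by
  intro h
  have h0 : ch.velocity s 0 = 0 := by rw [h]; rfl
  have h1 : ch.velocity s 1 = 0 := by rw [h]; rfl
  simp [velocity] at h0 h1
  have := ch.unit
  have h2 : ch.n 0 * ch.n 0 + ch.n 1 * ch.n 1 = 0 := by
    linear_combination ch.n 0 * h1 - ch.n 1 * h0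
  nlinarith

/-- The rotated gradient of a defining function is a positive multiple of the velocity. -/
lemma rotGrad_eq (hM : IsClosed M) {s : ℝ} (hs : s ∈ Set.Ioo (-ch.a) ch.a) {b : Plane → ℝ}
    (hb : IsLocalDefiningFunction M (ch.map (s, 0)) b) :
    ∃ c : ℝ, 0 < c ∧ rotGrad b (ch.map (s, 0)) = c • ch.velocity s := by
  have hbox : ∀ τ ∈ Set.Ioo (-ch.h) ch.h, (s, τ) ∈ ch.box := fun τ hτ => ⟨hs, hτ⟩
  have h0 : (0 : ℝ) ∈ Set.Ioo (-ch.h) ch.h := ⟨by simpa using ch.h_pos, ch.h_pos⟩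
  have hfr : ch.map (s, 0) ∈ frontier M := (ch.map_mem_frontier_iff hM (hbox 0 h0)).mpr rfl
  set y := ch.map (s, 0)
  have hev : ∀ c : ℝ, ∀ᶠ t in nhds (0 : ℝ), s + c * t ∈ Set.Ioo (-ch.a) ch.a := fun c => by
    have : ContinuousAt (fun t : ℝ => s + c * t) 0 := by fun_prop
    exact this.eventually (isOpen_Ioo.mem_nhds (by simpa using hs))
  have htan : ∀ c : ℝ, fderiv ℝ b y (c • ch.velocity s) ≤ 0 := by
    intro c
    have hc : HasDerivAt (fun t : ℝ => s + c * t) c 0 := by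
      simpa using ((hasDerivAt_id (0 : ℝ)).const_mul c).const_add s
    have hcur : HasDerivAt (fun s => ch.map (s, 0)) (ch.velocity s) (s + c * 0) := by
      simpa using ch.hasDerivAt_curve s 0
    refine hb.fderiv_nonpos hfr (γ := fun t => ch.map (s + c * t, 0)) (by simp [y])
      (HasDerivAt.scomp (h := fun t => s + c * t) (g₁ := fun s => ch.map (s, 0)) (0 : ℝ) hcur hc) ?_
    filter_upwards [(hev c).filter_mono nhdsWithin_le_nhds] with t ht
    exact (ch.map_mem_iff ⟨ht, h0⟩).mpr le_rfl
  have htan0 : fderiv ℝ b y (ch.velocity s) = 0 := by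
    have h1 := htan 1
    have h2 := htan (-1)
    simp only [map_smul, smul_eq_mul] at h1 h2
    linarith
  have hnor : 0 ≤ fderiv ℝ b y ch.n := by
    have hcur : HasDerivAt (fun τ => ch.map (s, τ)) ch.n (-0) := by
      simpa using ch.hasDerivAt_normal s 0
    have := hb.fderiv_nonpos hfr (γ := fun t => ch.map (s, -t)) (by simp [y])
      (HasDerivAt.scomp (h := fun t => -t) (g₁ := fun τ => ch.map (s, τ)) (0 : ℝ) hcur
      (hasDerivAt_neg (0 : ℝ))) ?_
    · simpa using this
    · have hev0 : ∀ᶠ t in nhdsWithin 0 (Set.Ioi (0 : ℝ)), t ∈ Set.Ioo (-ch.h) ch.h :=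
        nhdsWithin_le_nhds (isOpen_Ioo.mem_nhds h0)
      filter_upwards [hev0, self_mem_nhdsWithin] with t ht ht'
      have ht'' : (0 : ℝ) < t := ht'
      exact (ch.map_mem_iff (p := (s, -t)) ⟨hs, by linarith [ht.2], by linarith [ht.1, ch.h_pos]⟩).mpr
        (by simpa using ht''.le)
  have hd : fderiv ℝ b y ≠ 0 := by obtain ⟨-, -, -, -, hd, -⟩ := hb; exact hd
  have hu := ch.unit
  have hformula : rotGrad b y = fderiv ℝ b y ch.n • ch.velocity s := by
    rw [fderiv_eq_pd] at htan0
    simp [velocity] at htan0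
    rw [fderiv_eq_pd]
    apply plane_ext
    · simp [velocity]
      linear_combination pd 1 b y * hu - ch.n 0 * htan0
    · simp [velocity]
      linear_combination - pd 0 b y * hu - ch.n 1 * htan0
  refine ⟨_, lt_of_le_of_ne hnor fun h => ?_, hformula⟩
  rw [← h, zero_smul] at hformula
  exact rotGrad_ne_zero hd hformula

lemma bdryTangent_map (hM : IsCompactSmoothDomain M) (hg : IsRiemannianMetricOn g D) (hMD : M ⊆ D)
    {s : ℝ} (hs : s ∈ Set.Ioo (-ch.a) ch.a) :
    bdryTangent g M (ch.map (s, 0)) =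
      (gnorm g (ch.map (s, 0)) (ch.velocity s))⁻¹ • ch.velocity s := by
  have hcl := hM.isCompact.isClosed
  have hfr : ch.map (s, 0) ∈ frontier M := (ch.map_mem_frontier_iff hcl
    ⟨hs, by simpa using ch.h_pos, ch.h_pos⟩).mpr rfl
  have hD : ch.map (s, 0) ∈ D := hMD (hcl.frontier_subset hfr)
  obtain ⟨b, hb⟩ := hM.boundary _ hfr
  obtain ⟨c, hc, h⟩ := ch.rotGrad_eq hcl hs hb
  have hn := gnorm_pos hg hD (ch.velocity_ne_zero s)
  rw [bdryTangent_eq hg hD hfr hb, unitTangent, h, gnorm_smul g _ hc.le, smul_smul]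
  congr 1
  field_simp

end GraphChart

end Pestov
end

noncomputable section

namespace Pestov

lemma measure_le_of_locally_le {μ ν : Measure ℝ}
    (h : ∀ x : ℝ, ∃ U, IsOpen U ∧ x ∈ U ∧ ∀ A ⊆ U, MeasurableSet A → μ A ≤ ν A) : μ ≤ ν := by
  choose U hU hxU hle using h
  obtain ⟨s, hs, hcov⟩ := TopologicalSpace.countable_cover_nhds fun x => (hU x).mem_nhds (hxU x)
  have hne : s.Nonempty := by
    rcases s.eq_empty_or_nonempty with h | h
    · simp [h] at hcov
      exact absurd hcov (Set.empty_ne_univ)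
    · exact h
  obtain ⟨u, rfl⟩ := hs.exists_eq_range hne
  rw [Set.biUnion_range] at hcov
  refine Measure.le_iff.mpr fun A hA => ?_
  have hmeas : ∀ n, MeasurableSet (A ∩ disjointed (fun n => U (u n)) n) := fun n =>
    hA.inter (MeasurableSet.disjointed (fun n => (hU (u n)).measurableSet) n)
  have hdis : Pairwise (Function.onFun Disjoint fun n => A ∩ disjointed (fun n => U (u n)) n) :=
    fun i j hij => ((disjoint_disjointed fun n => U (u n)) hij).mono Set.inter_subset_right
      Set.inter_subset_right
  have hA' : A = ⋃ n, A ∩ disjointed (fun n => U (u n)) n := by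
    rw [← Set.inter_iUnion, iUnion_disjointed, hcov, Set.inter_univ]
  rw [hA', measure_iUnion hdis hmeas, measure_iUnion hdis hmeas]
  exact ENNReal.tsum_le_tsum fun n => hle (u n) _
    (Set.inter_subset_right.trans (disjointed_subset _ n)) (hmeas n)

lemma measure_le_of_forall_le_add {μ ν : Measure ℝ}
    (h : ∀ ε : ℝ, 0 < ε → μ ≤ ν + ENNReal.ofReal ε • volume) : μ ≤ ν := by
  refine measure_le_of_locally_le fun x => ⟨Metric.ball x 1, Metric.isOpen_ball,
    Metric.mem_ball_self one_pos, fun A hA hAm => ?_⟩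
  have hfin : volume A ≤ 2 := (measure_mono hA).trans (by rw [Real.volume_ball]; simp)
  refine ENNReal.le_of_forall_pos_le_add fun ε hε _ => ?_
  have := h (ε / 2) (by positivity) A
  refine this.trans ?_
  rw [Measure.add_apply, Measure.smul_apply, smul_eq_mul]
  gcongr
  calc ENNReal.ofReal (ε / 2) * volume A ≤ ENNReal.ofReal (ε / 2) * 2 := by gcongr
    _ = ENNReal.ofReal (ε / 2) * ENNReal.ofReal 2 := by simp
    _ = ε := by
      rw [← ENNReal.ofReal_mul (by positivity)]; simp

section curve

variable {γ γ' : ℝ → Plane}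

lemma curve_local_bounds (hγ : ∀ s, HasStrictDerivAt γ (γ' s) s) (hγ' : Continuous γ') {ε : ℝ}
    (hε : 0 < ε) (x : ℝ) : ∃ U, IsOpen U ∧ x ∈ U ∧ (∀ s ∈ U, |‖γ' s‖ - ‖γ' x‖| < ε) ∧
      ∀ s ∈ U, ∀ t ∈ U, ‖γ s - γ t‖ ≤ (‖γ' x‖ + ε) * |s - t| ∧
        ‖γ' x‖ * |s - t| ≤ ‖γ s - γ t‖ + ε * |s - t| := by
  have h1 := (hγ x).isLittleO.def hε
  rw [nhds_prod_eq] at h1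
  obtain ⟨pa, hpa, pb, hpb, hab⟩ := Filter.eventually_prod_iff.mp h1
  have h2 : ∀ᶠ s in nhds x, |‖γ' s‖ - ‖γ' x‖| < ε := by
    have : Continuous fun s => |‖γ' s‖ - ‖γ' x‖| := by fun_prop
    exact this.continuousAt.eventually (gt_mem_nhds (by simpa using hε))
  obtain ⟨U, hU, hUo, hxU⟩ := mem_nhds_iff.mp ((hpa.and hpb).and h2)
  refine ⟨U, hUo, hxU, fun s hs => (hU hs).2, fun s hs t ht => ?_⟩
  have h3 := hab (hU hs).1.1 (hU ht).1.2
  simp only [ContinuousLinearMap.toSpanSingleton_apply] at h3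
  rw [Real.norm_eq_abs] at h3
  have h4 : ‖(s - t) • γ' x‖ = |s - t| * ‖γ' x‖ := by rw [norm_smul, Real.norm_eq_abs]
  have h5 := norm_sub_norm_le (γ s - γ t) ((s - t) • γ' x)
  have h6 := norm_sub_norm_le ((s - t) • γ' x) (γ s - γ t)
  rw [norm_sub_rev ((s - t) • γ' x)] at h6
  constructor <;> nlinarith

/-- The length measure of a regular curve. -/
theorem comap_hausdorffMeasure (hγ : ∀ s, HasStrictDerivAt γ (γ' s) s) (hγ' : Continuous γ')
    (he : MeasurableEmbedding γ) :
    (Measure.hausdorffMeasure 1 : Measure Plane).comap γ =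
      volume.withDensity fun s => ENNReal.ofReal ‖γ' s‖ := by
  have happ : ∀ A, (Measure.hausdorffMeasure 1 : Measure Plane).comap γ A
      = Measure.hausdorffMeasure 1 (γ '' A) := fun A => he.comap_apply _ A
  have hvol : ∀ A : Set ℝ, (Measure.hausdorffMeasure 1 : Measure ℝ) A = volume A := fun A => by
    rw [hausdorffMeasure_real]
  have hden : ∀ A, MeasurableSet A → ∀ c : ℝ, (∀ s ∈ A, ‖γ' s‖ ≤ c) →
      volume.withDensity (fun s => ENNReal.ofReal ‖γ' s‖) A ≤ ENNReal.ofReal c * volume A := by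
    intro A hA c hc
    rw [withDensity_apply _ hA, ← setLIntegral_const]
    exact setLIntegral_mono measurable_const fun s hs => ENNReal.ofReal_le_ofReal (hc s hs)
  have hden' : ∀ A, MeasurableSet A → ∀ c : ℝ, (∀ s ∈ A, c ≤ ‖γ' s‖) →
      ENNReal.ofReal c * volume A ≤ volume.withDensity (fun s => ENNReal.ofReal ‖γ' s‖) A := by
    intro A hA c hc
    rw [withDensity_apply _ hA, ← setLIntegral_const]
    exact setLIntegral_mono (by fun_prop) fun s hs => ENNReal.ofReal_le_ofReal (hc s hs)
  apply le_antisymm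
  · refine measure_le_of_forall_le_add fun ε hε => measure_le_of_locally_le fun x => ?_
    obtain ⟨U, hU, hxU, h1, h2⟩ := curve_local_bounds hγ hγ' (ε := ε / 2) (by positivity) x
    refine ⟨U, hU, hxU, fun A hA hAm => ?_⟩
    have hlip : LipschitzOnWith (Real.toNNReal (‖γ' x‖ + ε / 2)) γ A :=
      LipschitzOnWith.of_dist_le_mul fun s hs t ht => by
        rw [dist_eq_norm, Real.dist_eq, Real.coe_toNNReal _ (by positivity)]
        exact (h2 s (hA hs) t (hA ht)).1
    have h3 := hlip.hausdorffMeasure_image_le (zero_le_one)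
    rw [hvol, ENNReal.rpow_one] at h3
    rw [happ, Measure.add_apply, Measure.smul_apply, smul_eq_mul]
    refine h3.trans ?_
    change ENNReal.ofReal (‖γ' x‖ + ε / 2) * volume A ≤ _
    by_cases hc : 0 ≤ ‖γ' x‖ - ε / 2
    · have h4 := hden' A hAm (‖γ' x‖ - ε / 2) fun s hs => by
        have := (abs_lt.mp (h1 s (hA hs))).1; linarith
      calc ENNReal.ofReal (‖γ' x‖ + ε / 2) * volume A
          = ENNReal.ofReal (‖γ' x‖ - ε / 2) * volume A + ENNReal.ofReal ε * volume A := by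
            rw [← add_mul, ← ENNReal.ofReal_add hc hε.le]; congr 2; ring
        _ ≤ _ := by gcongr
    · push Not at hc
      calc ENNReal.ofReal (‖γ' x‖ + ε / 2) * volume A ≤ ENNReal.ofReal ε * volume A := by
            gcongr; linarith
        _ ≤ _ := le_add_self
  · refine measure_le_of_forall_le_add fun ε hε => measure_le_of_locally_le fun x => ?_
    obtain ⟨U, hU, hxU, h1, h2⟩ := curve_local_bounds hγ hγ' (ε := ε / 2) (by positivity) x
    refine ⟨U, hU, hxU, fun A hA hAm => ?_⟩
    have h4 := hden A hAm (‖γ' x‖ + ε / 2) fun s hs => by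
      have := (abs_lt.mp (h1 s (hA hs))).2; linarith
    refine h4.trans ?_
    rw [Measure.add_apply, Measure.smul_apply, happ, smul_eq_mul]
    by_cases hc : 0 < ‖γ' x‖ - ε / 2
    · set c := ‖γ' x‖ - ε / 2
      have hinv : LipschitzOnWith (Real.toNNReal c⁻¹) (Function.invFun γ) (γ '' A) := by
        refine LipschitzOnWith.of_dist_le_mul ?_
        rintro _ ⟨s, hs, rfl⟩ _ ⟨t, ht, rfl⟩
        rw [Function.leftInverse_invFun he.injective, Function.leftInverse_invFun he.injective,
          Real.dist_eq, dist_eq_norm, Real.coe_toNNReal _ (by positivity), inv_mul_eq_div,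
          le_div_iff₀ hc]
        have := (h2 s (hA hs) t (hA ht)).2
        simp only [c]
        linarith
      have h3 := hinv.hausdorffMeasure_image_le (zero_le_one)
      rw [hvol, ENNReal.rpow_one] at h3
      have himg : Function.invFun γ '' (γ '' A) = A := by
        rw [Set.image_image]
        simp [Function.leftInverse_invFun he.injective _]
      rw [himg] at h3
      have h5 : ENNReal.ofReal c * volume A ≤ Measure.hausdorffMeasure 1 (γ '' A) := by
        calc ENNReal.ofReal c * volume A
            ≤ ENNReal.ofReal c * (ENNReal.ofReal c⁻¹ * Measure.hausdorffMeasure 1 (γ '' A)) := by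
              gcongr; exact h3
          _ = Measure.hausdorffMeasure 1 (γ '' A) := by
              rw [← mul_assoc, ← ENNReal.ofReal_mul hc.le, mul_inv_cancel₀ hc.ne']; simp
      calc ENNReal.ofReal (‖γ' x‖ + ε / 2) * volume A
          = ENNReal.ofReal c * volume A + ENNReal.ofReal ε * volume A := by
            rw [← add_mul, ← ENNReal.ofReal_add hc.le hε.le]; congr 2; simp only [c]; ring
        _ ≤ _ := by gcongr
    · push Not at hc
      calc ENNReal.ofReal (‖γ' x‖ + ε / 2) * volume A ≤ ENNReal.ofReal ε * volume A := by
            gcongr; linarith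
        _ ≤ _ := le_add_self

end curve

namespace GraphChart

variable {g : MetricField} {D M : Set Plane} {x : Plane} (ch : GraphChart M x)

/-- The boundary curve of the chart. -/
def curve (s : ℝ) : Plane := ch.map (s, 0)

lemma continuous_velocity : Continuous ch.velocity := by
  have := ch.smooth.continuous_deriv (by norm_num)
  unfold velocity; fun_prop

lemma hasStrictDerivAt_curve (s : ℝ) : HasStrictDerivAt ch.curve (ch.velocity s) s :=
  hasStrictDerivAt_of_hasDerivAt_of_continuousAt
    (Filter.Eventually.of_forall fun s => ch.hasDerivAt_curve s 0) ch.continuous_velocity.continuousAt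

lemma measurableEmbedding_curve : MeasurableEmbedding ch.curve := by
  have h1 : Topology.IsClosedEmbedding (fun s : ℝ => (s, (0 : ℝ))) :=
    Topology.IsClosedEmbedding.of_continuous_injective_isClosedMap (by fun_prop)
      (fun s t h => congrArg Prod.fst h) (by
        intro C hC
        have : (fun s : ℝ => (s, (0 : ℝ))) '' C = C ×ˢ {0} := by
          ext p; simp only [Set.mem_image, Set.mem_prod, Set.mem_singleton_iff]
          constructor
          · rintro ⟨s, hs, rfl⟩; exact ⟨hs, rfl⟩
          · rintro ⟨h1, h2⟩; exact ⟨p.1, h1, by ext1 <;> simp [h2]⟩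
        rw [this]; exact hC.prod isClosed_singleton)
  exact ((chartHomeo (x := x) ch.unit ch.smooth.continuous).isClosedEmbedding.comp
    h1).measurableEmbedding

lemma restrict_hausdorffMeasure {I : Set ℝ} (hI : MeasurableSet I) :
    (Measure.hausdorffMeasure 1 : Measure Plane).restrict (ch.curve '' I) =
      ((volume.restrict I).withDensity fun s => ENNReal.ofReal ‖ch.velocity s‖).map ch.curve := by
  have he := ch.measurableEmbedding_curve
  have h := comap_hausdorffMeasure ch.hasStrictDerivAt_curve ch.continuous_velocity he
  rw [← restrict_withDensity hI, ← h, he.restrict_comap, he.map_comap]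
  rw [Measure.restrict_restrict he.measurableSet_range]
  congr 1
  rw [Set.inter_eq_right.mpr (Set.image_subset_range _ _)]

lemma curve_image_eq (hM : IsClosed M) :
    ch.curve '' (Set.Ioo (-ch.a) ch.a) = frontier M ∩ ch.nbhd := by
  ext y
  constructor
  · rintro ⟨s, hs, rfl⟩
    have hb : (s, (0 : ℝ)) ∈ ch.box := ⟨hs, by simpa using ch.h_pos, ch.h_pos⟩
    exact ⟨(ch.map_mem_frontier_iff hM hb).mpr rfl, ⟨_, hb, rfl⟩⟩
  · rintro ⟨h1, ⟨p, hp, rfl⟩⟩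
    have := (ch.map_mem_frontier_iff hM hp).mp h1
    refine ⟨p.1, hp.1, ?_⟩
    rw [curve, ← this]

lemma integral_hausdorffMeasure (hM : IsClosed M) (F : Plane → ℝ) :
    ∫ y in frontier M ∩ ch.nbhd, F y ∂(Measure.hausdorffMeasure 1) =
      ∫ s in Set.Ioo (-ch.a) ch.a, ‖ch.velocity s‖ * F (ch.curve s) := by
  rw [← ch.curve_image_eq hM, ch.restrict_hausdorffMeasure measurableSet_Ioo,
    ch.measurableEmbedding_curve.integral_map, integral_withDensity_eq_integral_toReal_smul]
  · simp
  · have := ch.continuous_velocity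
    fun_prop
  · simp

lemma hausdorffMeasure_image_lt_top {r : ℝ} :
    Measure.hausdorffMeasure 1 (ch.curve '' Set.Icc (-r) r) < ⊤ := by
  have he := ch.measurableEmbedding_curve
  have h := comap_hausdorffMeasure ch.hasStrictDerivAt_curve ch.continuous_velocity he
  rw [← he.comap_apply, h, withDensity_apply _ measurableSet_Icc]
  obtain ⟨C, hC⟩ := (isCompact_Icc (a := -r) (b := r)).exists_bound_of_continuousOn
    ch.continuous_velocity.continuousOn
  calc ∫⁻ s in Set.Icc (-r) r, ENNReal.ofReal ‖ch.velocity s‖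
      ≤ ∫⁻ s in Set.Icc (-r) r, ENNReal.ofReal C :=
        setLIntegral_mono measurable_const fun s hs => ENNReal.ofReal_le_ofReal (hC s hs)
    _ < ⊤ := by
      rw [setLIntegral_const]
      exact ENNReal.mul_lt_top ENNReal.ofReal_lt_top (by simp)

end GraphChart

lemma IsCompactSmoothDomain.hausdorffMeasure_frontier_lt_top {M : Set Plane}
    (hM : IsCompactSmoothDomain M) :
    Measure.hausdorffMeasure 1 (frontier M) < ⊤ := by
  have hcl := hM.isCompact.isClosed
  have hcpt : IsCompact (frontier M) := hM.isCompact.of_isClosed_subset isClosed_frontier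
    hcl.frontier_subset
  refine hcpt.measure_lt_top_of_nhdsWithin fun x hx => ?_
  obtain ⟨b, hb⟩ := hM.boundary x hx
  obtain ⟨ch⟩ := hb.nonempty_graphChart hx
  refine ⟨frontier M ∩ ch.nbhd, ?_, ?_⟩
  · exact Filter.inter_mem self_mem_nhdsWithin
      (mem_nhdsWithin_of_mem_nhds (ch.isOpen_nbhd.mem_nhds ch.mem_nbhd))
  · rw [← ch.curve_image_eq hcl]
    exact (measure_mono (Set.image_mono Set.Ioo_subset_Icc_self)).trans_lt
      ch.hausdorffMeasure_image_lt_top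

lemma IsCompactSmoothDomain.volume_frontier {M : Set Plane} (hM : IsCompactSmoothDomain M) :
    volume (frontier M) = 0 := by
  have h1 := hM.hausdorffMeasure_frontier_lt_top
  have h2 : Measure.hausdorffMeasure 2 (frontier M) = 0 := by
    rcases Measure.hausdorffMeasure_zero_or_top (by norm_num : (1 : ℝ) < 2) (frontier M) with h | h
    · exact h
    · exact absurd h h1.ne
  have e := PiLp.volume_preserving_ofLp (Fin 2)
  have h3 : volume (WithLp.ofLp '' frontier M) = 0 := by
    rw [← hausdorffMeasure_pi_real]
    have hl : LipschitzWith 1 (WithLp.ofLp : Plane → Fin 2 → ℝ) := PiLp.lipschitzWith_ofLp 2 _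
    have := hl.hausdorffMeasure_image_le (d := (Fintype.card (Fin 2) : ℝ)) (by simp) (frontier M)
    refine le_antisymm (this.trans ?_) bot_le
    simp [h2]
  have hcpt : IsCompact (frontier M) := hM.isCompact.of_isClosed_subset isClosed_frontier
    hM.isCompact.isClosed.frontier_subset
  have hmeas : MeasurableSet (WithLp.ofLp '' frontier M) :=
    (hcpt.image (PiLp.continuous_ofLp 2 _)).measurableSet
  have h4 := e.measure_preimage hmeas.nullMeasurableSet
  rwa [Set.preimage_image_eq _ (WithLp.ofLp_injective 2), h3] at h4

end Pestov
end

noncomputable section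

namespace Pestov

/-- The divergence theorem on a rectangle, up to an edge where the divergence is only bounded
above by an integrable function. -/
theorem rect_divergence {a h : ℝ} (ha : 0 < a) (hh : 0 < h) {F G : ℝ × ℝ → ℝ}
    {F' G' : ℝ × ℝ → ℝ × ℝ →L[ℝ] ℝ} {δ Q : ℝ × ℝ → ℝ}
    (hF : ContinuousOn F (Set.Icc (-a) a ×ˢ Set.Icc (-h) 0))
    (hG : ContinuousOn G (Set.Icc (-a) a ×ˢ Set.Icc (-h) 0))
    (hdF : ∀ p ∈ Set.Ioo (-a) a ×ˢ Set.Ioo (-h) 0, HasFDerivAt F (F' p) p)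
    (hdG : ∀ p ∈ Set.Ioo (-a) a ×ˢ Set.Ioo (-h) 0, HasFDerivAt G (G' p) p)
    (hδ : ∀ p ∈ Set.Ioo (-a) a ×ˢ Set.Ioo (-h) 0, F' p (1, 0) + G' p (0, 1) = δ p)
    (hδc : ContinuousOn δ (Set.Icc (-a) a ×ˢ Set.Ico (-h) 0))
    (hFa : ∀ τ ∈ Set.Icc (-h) 0, F (a, τ) = 0) (hFa' : ∀ τ ∈ Set.Icc (-h) 0, F (-a, τ) = 0)
    (hGh : ∀ s ∈ Set.Icc (-a) a, G (s, -h) = 0)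
    (hQ : ∀ p ∈ Set.Ioo (-a) a ×ˢ Set.Ioo (-h) 0, δ p ≤ Q p)
    (hQi : IntegrableOn Q (Set.Ioo (-a) a ×ˢ Set.Ioo (-h) 0)) :
    IntegrableOn δ (Set.Ioo (-a) a ×ˢ Set.Ioo (-h) 0) ∧
      ∫ p in Set.Ioo (-a) a ×ˢ Set.Ioo (-h) 0, δ p = ∫ s in (-a)..a, G (s, 0) := by
  set R := Set.Ioo (-a) a ×ˢ Set.Ioo (-h) 0 with hR
  have hRm : MeasurableSet R := measurableSet_Ioo.prod measurableSet_Ioo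
  let ε : ℕ → ℝ := fun k => h / (k + 2)
  have hε0 : ∀ k, 0 < ε k := fun k => by positivity
  have hεh : ∀ k, ε k < h := fun k => by
    rw [div_lt_iff₀ (by positivity)]
    have : (0 : ℝ) ≤ k := Nat.cast_nonneg k
    nlinarith
  have hεt : Filter.Tendsto ε Filter.atTop (nhds 0) := by
    have := (tendsto_const_div_atTop_nhds_zero_nat h).comp (Filter.tendsto_add_atTop_nat 2)
    refine this.congr fun k => ?_
    simp [ε]
  let φ : ℕ → Set (ℝ × ℝ) := fun k => Set.Icc (-a) a ×ˢ Set.Icc (-h) (-ε k)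
  have hφm : ∀ k, MeasurableSet (φ k) := fun k => measurableSet_Icc.prod measurableSet_Icc
  have hφsub : ∀ k, φ k ⊆ Set.Icc (-a) a ×ˢ Set.Ico (-h) 0 := fun k p hp =>
    ⟨hp.1, hp.2.1, lt_of_le_of_lt hp.2.2 (by simpa using hε0 k)⟩
  have hcov : AECover (volume.restrict R) Filter.atTop φ := by
    refine ⟨?_, hφm⟩
    refine (ae_restrict_iff' hRm).mpr (Filter.Eventually.of_forall fun p hp => ?_)
    have hp2 : 0 < -p.2 := by linarith [hp.2.2]
    filter_upwards [hεt.eventually (gt_mem_nhds hp2)] with k hk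
    exact ⟨⟨hp.1.1.le, hp.1.2.le⟩, hp.2.1.le, by linarith⟩
  have hδint : ∀ k, IntegrableOn δ (φ k) := fun k =>
    (hδc.mono (hφsub k)).integrableOn_compact (isCompact_Icc.prod isCompact_Icc)
  have hae : ∀ k, (φ k ∩ R : Set (ℝ × ℝ)) =ᵐ[volume] φ k := by
    intro k
    have h1 : φ k =ᵐ[volume] Set.Ioo (-a) a ×ˢ Set.Ioo (-h) (-ε k) :=
      (Measure.set_prod_ae_eq Ioo_ae_eq_Icc Ioo_ae_eq_Icc).symm
    refine Filter.EventuallyLE.antisymm (Filter.Eventually.of_forall fun p hp => hp.1) ?_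
    refine h1.le.trans (Filter.Eventually.of_forall fun p hp => ?_)
    have hp' : p ∈ Set.Ioo (-a) a ×ˢ Set.Ioo (-h) (-ε k) := hp
    exact ⟨⟨⟨hp'.1.1.le, hp'.1.2.le⟩, hp'.2.1.le, hp'.2.2.le⟩, hp'.1, hp'.2.1,
      hp'.2.2.trans (by simpa using hε0 k)⟩
  have hval : ∀ k, ∫ p in φ k, δ p = ∫ s in (-a)..a, G (s, -ε k) := by
    intro k
    have hsub : Set.Icc ((-a, -h) : ℝ × ℝ) (a, -ε k) = φ k := (Set.Icc_prod_Icc _ _ _ _).symm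
    have hsub' : φ k ⊆ Set.Icc (-a) a ×ˢ Set.Icc (-h) 0 := fun p hp =>
      ⟨hp.1, hp.2.1, hp.2.2.trans (by simpa using (hε0 k).le)⟩
    have hcongr : ∀ᵐ p ∂(volume.restrict (φ k)), F' p (1, 0) + G' p (0, 1) = δ p := by
      rw [← Measure.restrict_congr_set (hae k)]
      refine (ae_restrict_iff' ((hφm k).inter hRm)).mpr (Filter.Eventually.of_forall fun p hp => ?_)
      exact hδ p hp.2
    have hin : ∀ p : ℝ × ℝ, p ∈ Set.Ioo (-a) a ×ˢ Set.Ioo (-h) (-ε k) → p ∈ R := fun p hp =>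
      ⟨hp.1, hp.2.1, hp.2.2.trans (by simpa using hε0 k)⟩
    have key := integral_divergence_prod_Icc_of_hasFDerivAt_of_le F G F' G' (-a, -h) (a, -ε k)
      ⟨by simp; linarith, by simp; linarith [hεh k]⟩ (by rw [hsub]; exact hF.mono hsub')
      (by rw [hsub]; exact hG.mono hsub') (fun p hp => hdF p (hin p hp)) (fun p hp => hdG p (hin p hp))
      (by rw [hsub]; exact (hδint k).congr (hcongr.mono fun p hp => hp.symm))
    rw [hsub, integral_congr_ae hcongr] at key
    rw [key]
    have z1 : ∫ s in (-a)..a, G (s, -h) = 0 := by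
      rw [intervalIntegral.integral_congr (g := fun _ => 0)]
      · simp
      · intro s hs
        rw [Set.uIcc_of_le (by linarith)] at hs
        exact hGh s hs
    have z2 : ∀ b : ℝ, (∀ τ ∈ Set.Icc (-h) 0, F (b, τ) = 0) → ∫ τ in (-h)..(-ε k), F (b, τ) = 0 := by
      intro b hb
      rw [intervalIntegral.integral_congr (g := fun _ => 0)]
      · simp
      · intro τ hτ
        rw [Set.uIcc_of_le (by linarith [hεh k])] at hτ
        exact hb τ ⟨hτ.1, hτ.2.trans (by simpa using (hε0 k).le)⟩
    simp only [z1, z2 a hFa, z2 (-a) hFa']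
    ring
  have hlim : Filter.Tendsto (fun k => ∫ s in (-a)..a, G (s, -ε k)) Filter.atTop
      (nhds (∫ s in (-a)..a, G (s, 0))) := by
    obtain ⟨C, hC⟩ := (isCompact_Icc.prod isCompact_Icc).exists_bound_of_continuousOn hG
    have huIoc : ∀ s ∈ Set.uIoc (-a) a, s ∈ Set.Icc (-a) a := fun s hs => by
      rw [Set.uIoc_of_le (by linarith)] at hs; exact ⟨hs.1.le, hs.2⟩
    have hεI : ∀ k, -ε k ∈ Set.Icc (-h) 0 := fun k =>
      ⟨by linarith [hεh k], by simpa using (hε0 k).le⟩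
    refine intervalIntegral.tendsto_integral_filter_of_dominated_convergence (fun _ => C) ?_ ?_
      (by simp) ?_
    · refine Filter.Eventually.of_forall fun k => ?_
      refine ContinuousOn.aestronglyMeasurable ?_ measurableSet_uIoc
      exact hG.comp (by fun_prop) fun s hs => ⟨huIoc s hs, hεI k⟩
    · exact Filter.Eventually.of_forall fun k => Filter.Eventually.of_forall fun s hs =>
        hC _ ⟨huIoc s hs, hεI k⟩
    · refine Filter.Eventually.of_forall fun s hs => ?_
      have h0 : ContinuousWithinAt G (Set.Icc (-a) a ×ˢ Set.Icc (-h) 0) (s, 0) :=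
        hG (s, 0) ⟨huIoc s hs, by linarith, le_rfl⟩
      refine h0.tendsto.comp (tendsto_nhdsWithin_iff.mpr ⟨?_, Filter.Eventually.of_forall fun k =>
        ⟨huIoc s hs, hεI k⟩⟩)
      have : Filter.Tendsto (fun k => (s, -ε k)) Filter.atTop (nhds (s, -0)) :=
        tendsto_const_nhds.prodMk_nhds hεt.neg
      simpa using this
  have hrestr : ∀ k, (volume.restrict R).restrict (φ k) = volume.restrict (φ k) := fun k => by
    rw [Measure.restrict_restrict (hφm k), Measure.restrict_congr_set (hae k)]
  have hQcov := hcov.integral_tendsto_of_countably_generated hQi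
  have hδ' : ∀ k, IntegrableOn δ (φ k) (volume.restrict R) := fun k => by
    rw [IntegrableOn, hrestr]; exact hδint k
  have hQk : ∀ k, IntegrableOn Q (φ k) (volume.restrict R) := fun k => hQi.integrableOn
  have hdiff : Integrable (fun p => Q p - δ p) (volume.restrict R) := by
    refine hcov.integrable_of_integral_tendsto_of_nonneg_ae
      ((∫ p in R, Q p) - ∫ s in (-a)..a, G (s, 0)) (fun k => (hQk k).sub (hδ' k)) ?_ ?_
    · exact (ae_restrict_iff' hRm).mpr (Filter.Eventually.of_forall fun p hp =>
        sub_nonneg.mpr (hQ p hp))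
    · refine (hQcov.sub hlim).congr fun k => ?_
      rw [integral_sub (hQk k) (hδ' k), hrestr k, hval k]
  have hδi : IntegrableOn δ R := by
    have := hQi.sub hdiff
    refine this.congr (Filter.Eventually.of_forall fun p => ?_)
    simp
  refine ⟨hδi, ?_⟩
  have h1 := hcov.integral_tendsto_of_countably_generated hδi
  refine tendsto_nhds_unique h1 (hlim.congr fun k => ?_)
  rw [hrestr k, hval k]

lemma exists_Ioo_of_isCompact {a : ℝ} (ha : 0 < a) {S : Set ℝ} (hS : IsCompact S)
    (hSa : S ⊆ Set.Ioo (-a) a) : ∃ b, 0 < b ∧ b < a ∧ S ⊆ Set.Ioo (-b) b := by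
  rcases S.eq_empty_or_nonempty with rfl | hne
  · exact ⟨a / 2, by positivity, by linarith, Set.empty_subset _⟩
  · obtain ⟨m, hm, hmax⟩ := hS.exists_isMaxOn hne (f := fun s : ℝ => |s|) (by fun_prop)
    have h1 : |m| < a := abs_lt.mpr (hSa hm)
    refine ⟨(|m| + a) / 2, by positivity, by linarith, fun s hs => ?_⟩
    have h2 : |s| ≤ |m| := hmax hs
    exact abs_lt.mp (by linarith)

end Pestov
end

noncomputable section

namespace Pestov

variable {g : MetricField} {D M : Set Plane} {x y : Plane}

lemma IsLocalDefiningFunction.exists_nhds {b : Plane → ℝ} (hb : IsLocalDefiningFunction M x b) :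
    ∃ U, IsOpen U ∧ x ∈ U ∧ ContDiffOn ℝ ∞ b U ∧ (∀ y ∈ U, fderiv ℝ b y ≠ 0) ∧
      ∀ y ∈ U, IsLocalDefiningFunction M y b := by
  obtain ⟨U, hU, hxU, hbU, hd, hM⟩ := hb
  have hc : ContinuousOn (fderiv ℝ b) U := hbU.continuousOn_fderiv_of_isOpen hU (by simp)
  have hO : IsOpen (U ∩ fderiv ℝ b ⁻¹' {0}ᶜ) := hc.isOpen_inter_preimage hU isOpen_compl_singleton
  refine ⟨U ∩ fderiv ℝ b ⁻¹' {0}ᶜ, hO, ⟨hxU, hd⟩, hbU.mono Set.inter_subset_left, fun y hy => hy.2,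
    fun y hy => ⟨U, hU, hy.1, hbU, hy.2, hM⟩⟩

lemma contDiffOn_rotGrad {b : Plane → ℝ} {U : Set Plane} (hU : IsOpen U) (hb : ContDiffOn ℝ ∞ b U) :
    ContDiffOn ℝ ∞ (rotGrad b) U := by
  apply contDiffOn_plane
  · simp only [rotGrad_zero_apply]; exact (contDiffOn_pd hU hb 1).neg
  · simp only [rotGrad_one_apply]; exact contDiffOn_pd hU hb 0

lemma contDiffOn_unitTangent (hg : IsRiemannianMetricOn g D) {b : Plane → ℝ} {U : Set Plane}
    (hU : IsOpen U) (hUD : U ⊆ D) (hb : ContDiffOn ℝ ∞ b U) (hd : ∀ y ∈ U, fderiv ℝ b y ≠ 0) :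
    ContDiffOn ℝ ∞ (unitTangent g b) U := by
  have h := contDiffOn_rotGrad hU hb
  unfold unitTangent gnorm
  exact (((contDiffOn_ip hg hUD h h).sqrt fun y hy =>
    (ip_self_pos hg (hUD hy) (rotGrad_ne_zero (hd y hy))).ne').inv fun y hy =>
    (gnorm_pos hg (hUD hy) (rotGrad_ne_zero (hd y hy))).ne').smul h

/-- Near a boundary point, the unit tangent of the boundary extends to a smooth field. -/
lemma IsCompactSmoothDomain.exists_tangent (hM : IsCompactSmoothDomain M) (hD : IsOpen D)
    (hg : IsRiemannianMetricOn g D) (hMD : M ⊆ D) (hx : x ∈ frontier M) :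
    ∃ U P, IsOpen U ∧ x ∈ U ∧ U ⊆ D ∧ ContDiffOn ℝ ∞ P U ∧ (∀ y ∈ U, ip g y (P y) (P y) = 1) ∧
      ∀ y ∈ frontier M ∩ U, bdryTangent g M y = P y ∧ outerNormal g M y = - perp g y (P y) := by
  obtain ⟨b, hb⟩ := hM.boundary x hx
  obtain ⟨U, hU, hxU, hbU, hd, hloc⟩ := hb.exists_nhds
  refine ⟨U ∩ D, unitTangent g b, hU.inter hD,
    ⟨hxU, hMD (hM.isCompact.isClosed.frontier_subset hx)⟩, Set.inter_subset_right,
    contDiffOn_unitTangent hg (hU.inter hD) Set.inter_subset_right (hbU.mono Set.inter_subset_left)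
    fun y hy => hd y hy.1, fun y hy => ip_normalize hg hy.2 (rotGrad_ne_zero (hd y hy.1)),
    fun y hy => ⟨bdryTangent_eq hg hy.2.2 hy.1 (hloc y hy.2.1),
    outerNormal_eq hg hy.2.2 hy.1 (hloc y hy.2.1)⟩⟩

lemma IsCompactSmoothDomain.continuousOn_bdryTangent (hM : IsCompactSmoothDomain M) (hD : IsOpen D)
    (hg : IsRiemannianMetricOn g D) (hMD : M ⊆ D) :
    ContinuousOn (bdryTangent g M) (frontier M) := by
  intro x hx
  obtain ⟨U, P, hU, hxU, -, hP, -, h⟩ := hM.exists_tangent hD hg hMD hx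
  have hc : ContinuousWithinAt P (frontier M) x :=
    (hP.continuousOn.continuousAt (hU.mem_nhds hxU)).continuousWithinAt
  refine hc.congr_of_eventuallyEq ?_ (h x ⟨hx, hxU⟩).1
  filter_upwards [self_mem_nhdsWithin, mem_nhdsWithin_of_mem_nhds (hU.mem_nhds hxU)] with y h1 h2
  exact (h y ⟨h1, h2⟩).1

lemma IsCompactSmoothDomain.bdryTangent_ne_zero (hM : IsCompactSmoothDomain M) (hD : IsOpen D)
    (hg : IsRiemannianMetricOn g D) (hMD : M ⊆ D) (hx : x ∈ frontier M) :
    bdryTangent g M x ≠ 0 := by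
  obtain ⟨U, P, hU, hxU, -, hP, h1, h⟩ := hM.exists_tangent hD hg hMD hx
  rw [(h x ⟨hx, hxU⟩).1]
  intro h0
  have := h1 x hxU
  rw [h0] at this
  simp [ip] at this

lemma integral_lengthMeasure (hM : IsCompactSmoothDomain M) (hD : IsOpen D)
    (hg : IsRiemannianMetricOn g D) (hMD : M ⊆ D) (Φ : Plane → ℝ) :
    ∫ y, Φ y ∂(lengthMeasure g M) =
      ∫ y in frontier M, ‖bdryTangent g M y‖⁻¹ * Φ y ∂(Measure.hausdorffMeasure 1) := by
  rw [lengthMeasure, integral_withDensity_eq_integral_toReal_smul₀]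
  · refine integral_congr_ae (Filter.Eventually.of_forall fun y => ?_)
    simp
  · have h : ContinuousOn (fun y => ‖bdryTangent g M y‖⁻¹) (frontier M) :=
      (hM.continuousOn_bdryTangent hD hg hMD).norm.inv₀ fun y hy =>
        norm_ne_zero_iff.mpr (hM.bdryTangent_ne_zero hD hg hMD hy)
    exact (h.aemeasurable isClosed_frontier.measurableSet).ennreal_ofReal
  · simp

namespace GraphChart

variable (ch : GraphChart M x)

lemma measurePreserving_map : MeasurePreserving ch.map volume volume :=
  measurePreserving_chartMap ch.unit ch.smooth.continuous

lemma measurableEmbedding_map : MeasurableEmbedding ch.map :=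
  (chartHomeo (x := x) ch.unit ch.smooth.continuous).measurableEmbedding

/-- The divergence theorem for fields supported in a boundary chart. -/
theorem divergence (hM : IsCompactSmoothDomain M) (hD : IsOpen D) (hg : IsRiemannianMetricOn g D)
    (hMD : M ⊆ D) {Z0 Z1 Q : Plane → ℝ} (hc0 : ContinuousOn Z0 M) (hc1 : ContinuousOn Z1 M)
    (hd0 : ∀ y ∈ interior M, DifferentiableAt ℝ Z0 y)
    (hd1 : ∀ y ∈ interior M, DifferentiableAt ℝ Z1 y)
    (hδc : ContinuousOn (fun y => pd 0 Z0 y + pd 1 Z1 y) (interior M))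
    {K : Set Plane} (hK : IsCompact K) (hKn : K ⊆ ch.nbhd) (hz0 : ∀ y ∉ K, Z0 y = 0)
    (hz1 : ∀ y ∉ K, Z1 y = 0) (hQ : ∀ y ∈ interior M, pd 0 Z0 y + pd 1 Z1 y ≤ Q y)
    (hQi : IntegrableOn Q (interior M)) :
    IntegrableOn (fun y => pd 0 Z0 y + pd 1 Z1 y) (interior M) ∧
      ∫ y in interior M, (pd 0 Z0 y + pd 1 Z1 y) =
        ∫ y, (Z0 y * bdryTangent g M y 1 - Z1 y * bdryTangent g M y 0) ∂(lengthMeasure g M) := by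
  have hcl := hM.isCompact.isClosed
  set δ : Plane → ℝ := fun y => pd 0 Z0 y + pd 1 Z1 y with hδ
  -- shrink the box
  have hK' : IsCompact (ch.map ⁻¹' K) :=
    (chartHomeo (x := x) ch.unit ch.smooth.continuous).isClosedEmbedding.isCompact_preimage hK
  have hKbox : ch.map ⁻¹' K ⊆ ch.box := by
    intro p hp
    obtain ⟨q, hq, hqp⟩ := hKn hp
    rwa [← ch.injective_map hqp]
  obtain ⟨a, ha0, ha, hKa⟩ := exists_Ioo_of_isCompact ch.a_pos (hK'.image continuous_fst)
    (by rintro _ ⟨p, hp, rfl⟩; exact (hKbox hp).1)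
  obtain ⟨h, hh0, hh, hKh⟩ := exists_Ioo_of_isCompact ch.h_pos (hK'.image continuous_snd)
    (by rintro _ ⟨p, hp, rfl⟩; exact (hKbox hp).2)
  have hnotK : ∀ p : ℝ × ℝ, p ∉ Set.Ioo (-a) a ×ˢ Set.Ioo (-h) h → ch.map p ∉ K := fun p hp hpK =>
    hp ⟨hKa ⟨p, hpK, rfl⟩, hKh ⟨p, hpK, rfl⟩⟩
  have hbox : ∀ p ∈ Set.Icc (-a) a ×ˢ Set.Icc (-h) 0, p ∈ ch.box := fun p hp =>
    ⟨⟨by linarith [hp.1.1], by linarith [hp.1.2]⟩, by linarith [hp.2.1], by linarith [hp.2.2]⟩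
  have hmapM : Set.MapsTo ch.map (Set.Icc (-a) a ×ˢ Set.Icc (-h) 0) M := fun p hp =>
    (ch.map_mem_iff (hbox p hp)).mpr hp.2.2
  have hmapI : Set.MapsTo ch.map (Set.Icc (-a) a ×ˢ Set.Ico (-h) 0) (interior M) := fun p hp =>
    (ch.map_mem_interior_iff (hbox p ⟨hp.1, hp.2.1, hp.2.2.le⟩)).mpr hp.2.2
  have hIoo : ∀ p ∈ Set.Ioo (-a) a ×ˢ Set.Ioo (-h) (0 : ℝ), p ∈ Set.Icc (-a) a ×ˢ Set.Ico (-h) 0 :=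
    fun p hp => ⟨⟨hp.1.1.le, hp.1.2.le⟩, hp.2.1.le, hp.2.2⟩
  -- pulled back field
  set n := ch.n with hn
  have hu := ch.unit
  rw [← hn] at hu
  have hf' : ContDiff ℝ 1 (deriv ch.f) := by
    have := ch.smooth
    exact ((contDiff_succ_iff_deriv (n := 1)).mp (one_add_one_eq_two (R := WithTop ℕ∞) ▸ this)).2.2
  set A : ℝ × ℝ → ℝ := fun p => -n 1 * Z0 (ch.map p) + n 0 * Z1 (ch.map p) with hA
  set G : ℝ × ℝ → ℝ := fun p => n 0 * Z0 (ch.map p) + n 1 * Z1 (ch.map p) - deriv ch.f p.1 * A p with hG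
  have hcm := ch.continuous_map.continuousOn (s := Set.Icc (-a) a ×ˢ Set.Icc (-h) 0)
  have hcA : ContinuousOn A (Set.Icc (-a) a ×ˢ Set.Icc (-h) 0) :=
    (continuousOn_const.mul (hc0.comp hcm hmapM)).add (continuousOn_const.mul (hc1.comp hcm hmapM))
  have hcG : ContinuousOn G (Set.Icc (-a) a ×ˢ Set.Icc (-h) 0) :=
    ((continuousOn_const.mul (hc0.comp hcm hmapM)).add
      (continuousOn_const.mul (hc1.comp hcm hmapM))).sub
      ((hf'.continuous.comp continuous_fst).continuousOn.mul hcA)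
  choose L hL hL' using ch.hasFDerivAt_map
  have hdA : ∀ p ∈ Set.Ioo (-a) a ×ˢ Set.Ioo (-h) (0 : ℝ), HasFDerivAt A
      ((-n 1) • ((fderiv ℝ Z0 (ch.map p)) ∘L L p) + n 0 • ((fderiv ℝ Z1 (ch.map p)) ∘L L p)) p := by
    intro p hp
    have h0 := (hd0 _ (hmapI (hIoo p hp))).hasFDerivAt.comp p (hL p)
    have h1 := (hd1 _ (hmapI (hIoo p hp))).hasFDerivAt.comp p (hL p)
    exact (h0.const_mul (-n 1)).add (h1.const_mul (n 0))
  have hdf : ∀ p : ℝ × ℝ, HasFDerivAt (fun p : ℝ × ℝ => deriv ch.f p.1)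
      ((deriv (deriv ch.f) p.1) • (ContinuousLinearMap.fst ℝ ℝ ℝ)) p := fun p =>
    ((hf'.differentiable (by norm_num)) p.1).hasDerivAt.comp_hasFDerivAt p hasFDerivAt_fst
  have hdG : ∀ p ∈ Set.Ioo (-a) a ×ˢ Set.Ioo (-h) (0 : ℝ), HasFDerivAt G
      (n 0 • ((fderiv ℝ Z0 (ch.map p)) ∘L L p) + n 1 • ((fderiv ℝ Z1 (ch.map p)) ∘L L p)
        - (deriv ch.f p.1 • ((-n 1) • ((fderiv ℝ Z0 (ch.map p)) ∘L L p)
          + n 0 • ((fderiv ℝ Z1 (ch.map p)) ∘L L p))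
          + A p • ((deriv (deriv ch.f) p.1) • (ContinuousLinearMap.fst ℝ ℝ ℝ)))) p := by
    intro p hp
    have h0 := (hd0 _ (hmapI (hIoo p hp))).hasFDerivAt.comp p (hL p)
    have h1 := (hd1 _ (hmapI (hIoo p hp))).hasFDerivAt.comp p (hL p)
    exact ((h0.const_mul (n 0)).add (h1.const_mul (n 1))).sub ((hdf p).mul (hdA p hp))
  have hvel : ∀ s, ch.velocity s 0 = -n 1 + deriv ch.f s * n 0 ∧
      ch.velocity s 1 = n 0 + deriv ch.f s * n 1 := fun s => by
    constructor <;> simp [velocity, hn]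
  have e1 := fun p : ℝ × ℝ => hL' p 1 0
  have e2 := fun p : ℝ × ℝ => hL' p 0 1
  simp only [one_smul, zero_smul, add_zero, zero_add] at e1 e2
  have hRm : MeasurableSet (Set.Ioo (-a) a ×ˢ Set.Ioo (-h) (0 : ℝ)) :=
    measurableSet_Ioo.prod measurableSet_Ioo
  set R := Set.Ioo (-a) a ×ˢ Set.Ioo (-h) (0 : ℝ) with hR
  have himg : ch.map '' R ⊆ interior M := by
    rintro _ ⟨p, hp, rfl⟩; exact hmapI (hIoo p hp)
  have hmain := rect_divergence (Q := fun p => Q (ch.map p)) (δ := fun p => δ (ch.map p)) ha0 hh0 hcA hcG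
    hdA hdG ?_ ?_ ?_ ?_ ?_ ?_ ?_
  rotate_left
  · intro p hp
    simp only [add_apply, sub_apply, smul_apply, ContinuousLinearMap.comp_apply, e1, e2,
      ContinuousLinearMap.coe_fst', smul_eq_mul, fderiv_eq_pd, (hvel p.1).1, (hvel p.1).2, hδ, ← hn]
    linear_combination (pd 0 Z0 (ch.map p) + pd 1 Z1 (ch.map p)) * hu
  · exact hδc.comp ch.continuous_map.continuousOn hmapI
  · intro τ hτ
    have := hnotK (a, τ) (fun hp => lt_irrefl _ hp.1.2)
    simp [hA, hz0 _ this, hz1 _ this]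
  · intro τ hτ
    have := hnotK (-a, τ) (fun hp => lt_irrefl _ hp.1.1)
    simp [hA, hz0 _ this, hz1 _ this]
  · intro s hs
    have := hnotK (s, -h) (fun hp => lt_irrefl _ hp.2.1)
    simp [hG, hA, hz0 _ this, hz1 _ this]
  · exact fun p hp => hQ _ (hmapI (hIoo p hp))
  · have h1 : IntegrableOn Q (ch.map '' R) := hQi.mono_set himg
    exact (ch.measurePreserving_map.integrableOn_image ch.measurableEmbedding_map).mp h1
  obtain ⟨hint, hval⟩ := hmain
  have hzero : ∀ y ∈ interior M \ ch.map '' R, δ y = 0 := by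
    intro y hy
    have hyK : y ∉ K := by
      intro hyK
      obtain ⟨p, hp, rfl⟩ := hKn hyK
      have h1 := (ch.map_mem_interior_iff hp).mp hy.1
      have h2 : p ∈ Set.Ioo (-a) a ×ˢ Set.Ioo (-h) h := by
        by_contra hcon; exact hnotK p hcon hyK
      exact hy.2 ⟨p, ⟨h2.1, h2.2.1, h1⟩, rfl⟩
    have hev : ∀ᶠ z in nhds y, z ∉ K := hK.isClosed.isOpen_compl.mem_nhds hyK
    have p0 : pd 0 Z0 y = 0 := by
      rw [pd, Filter.EventuallyEq.fderiv_eq (f := fun _ => (0 : ℝ)) (hev.mono fun z hz => hz0 z hz)]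
      simp
    have p1 : pd 1 Z1 y = 0 := by
      rw [pd, Filter.EventuallyEq.fderiv_eq (f := fun _ => (0 : ℝ)) (hev.mono fun z hz => hz1 z hz)]
      simp
    simp [hδ, p0, p1]
  have himgm : MeasurableSet (ch.map '' R) := ch.measurableEmbedding_map.measurableSet_image' hRm
  have hintimg : IntegrableOn δ (ch.map '' R) :=
    (ch.measurePreserving_map.integrableOn_image ch.measurableEmbedding_map).mpr hint
  have hintM : IntegrableOn δ (interior M) :=
    hintimg.of_forall_sdiff_eq_zero isOpen_interior.measurableSet hzero
  refine ⟨hintM, ?_⟩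
  rw [setIntegral_eq_of_subset_of_forall_sdiff_eq_zero isOpen_interior.measurableSet himg hzero,
    ch.measurePreserving_map.setIntegral_image_emb ch.measurableEmbedding_map, hval]
  -- the boundary term
  rw [integral_lengthMeasure hM hD hg hMD]
  have hbd : ∫ y in frontier M, ‖bdryTangent g M y‖⁻¹ *
      (Z0 y * bdryTangent g M y 1 - Z1 y * bdryTangent g M y 0) ∂(Measure.hausdorffMeasure 1)
      = ∫ y in frontier M ∩ ch.nbhd, ‖bdryTangent g M y‖⁻¹ *
      (Z0 y * bdryTangent g M y 1 - Z1 y * bdryTangent g M y 0) ∂(Measure.hausdorffMeasure 1) := by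
    refine setIntegral_eq_of_subset_of_forall_sdiff_eq_zero isClosed_frontier.measurableSet
      Set.inter_subset_left fun y hy => ?_
    have hyK : y ∉ K := fun hyK => hy.2 ⟨hy.1, hKn hyK⟩
    simp [hz0 y hyK, hz1 y hyK]
  rw [hbd, ch.integral_hausdorffMeasure hcl]
  have hpt : ∀ s ∈ Set.Ioo (-ch.a) ch.a, ‖ch.velocity s‖ * (‖bdryTangent g M (ch.curve s)‖⁻¹ *
      (Z0 (ch.curve s) * bdryTangent g M (ch.curve s) 1
        - Z1 (ch.curve s) * bdryTangent g M (ch.curve s) 0)) = G (s, 0) := by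
    intro s hs
    have hT := ch.bdryTangent_map hM hg hMD hs
    have hb : (s, (0 : ℝ)) ∈ ch.box := ⟨hs, by simpa using ch.h_pos, ch.h_pos⟩
    have hcD : ch.curve s ∈ D := hMD ((ch.map_mem_iff hb).mpr le_rfl)
    have hgn := gnorm_pos hg hcD (ch.velocity_ne_zero s)
    have hvn : ‖ch.velocity s‖ ≠ 0 := norm_ne_zero_iff.mpr (ch.velocity_ne_zero s)
    change bdryTangent g M (ch.curve s) = (gnorm g (ch.curve s) (ch.velocity s))⁻¹ • _ at hT
    rw [hT, norm_smul, Real.norm_of_nonneg (inv_nonneg.mpr hgn.le)]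
    simp only [PiLp.smul_apply, smul_eq_mul, (hvel s).1, (hvel s).2, hG, hA]
    change _ = n 0 * Z0 (ch.curve s) + n 1 * Z1 (ch.curve s) - deriv ch.f s *
      (-n 1 * Z0 (ch.curve s) + n 0 * Z1 (ch.curve s))
    field_simp
    ring
  rw [setIntegral_congr_fun measurableSet_Ioo hpt,
    intervalIntegral.integral_of_le (by linarith), ← integral_Ioc_eq_integral_Ioo]
  refine (setIntegral_eq_of_subset_of_forall_sdiff_eq_zero measurableSet_Ioc
    (Set.Ioc_subset_Ioc (by linarith) ha.le) fun s hs => ?_).symm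
  have := hnotK (s, 0) (fun hp => hs.2 ⟨hp.1.1, hp.1.2.le⟩)
  simp [hG, hA, hz0 _ this, hz1 _ this]

end GraphChart

end Pestov
end

noncomputable section

namespace Pestov

variable {g : MetricField} {D M : Set Plane} {x y : Plane}

lemma IsCompactSmoothDomain.isCompact_frontier (hM : IsCompactSmoothDomain M) :
    IsCompact (frontier M) :=
  hM.isCompact.of_isClosed_subset isClosed_frontier hM.isCompact.isClosed.frontier_subset

lemma lengthMeasure_restrict_frontier (g : MetricField) (M : Set Plane) :
    (lengthMeasure g M).restrict (frontier M) = lengthMeasure g M := by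
  rw [lengthMeasure, restrict_withDensity isClosed_frontier.measurableSet,
    Measure.restrict_restrict isClosed_frontier.measurableSet, Set.inter_self]

lemma IsCompactSmoothDomain.isFiniteMeasure_lengthMeasure (hM : IsCompactSmoothDomain M)
    (hD : IsOpen D) (hg : IsRiemannianMetricOn g D) (hMD : M ⊆ D) :
    IsFiniteMeasure (lengthMeasure g M) := by
  have h : ContinuousOn (fun y => ‖bdryTangent g M y‖⁻¹) (frontier M) :=
    (hM.continuousOn_bdryTangent hD hg hMD).norm.inv₀ fun y hy =>
      norm_ne_zero_iff.mpr (hM.bdryTangent_ne_zero hD hg hMD hy)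
  have : IsFiniteMeasure ((Measure.hausdorffMeasure 1 : Measure Plane).restrict (frontier M)) :=
    ⟨by simpa using hM.hausdorffMeasure_frontier_lt_top⟩
  have hi := h.integrableOn_compact (μ := (Measure.hausdorffMeasure 1).restrict (frontier M))
    hM.isCompact_frontier
  rw [IntegrableOn, Measure.restrict_restrict isClosed_frontier.measurableSet, Set.inter_self] at hi
  exact isFiniteMeasure_withDensity_ofReal hi.2

lemma IsCompactSmoothDomain.integrable_lengthMeasure (hM : IsCompactSmoothDomain M)
    (hD : IsOpen D) (hg : IsRiemannianMetricOn g D) (hMD : M ⊆ D) {Φ : Plane → ℝ}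
    (hΦ : ContinuousOn Φ (frontier M)) : Integrable Φ (lengthMeasure g M) := by
  have := hM.isFiniteMeasure_lengthMeasure hD hg hMD
  have h := hΦ.integrableOn_compact (μ := lengthMeasure g M) hM.isCompact_frontier
  rwa [IntegrableOn, lengthMeasure_restrict_frontier] at h

lemma GraphChart.isBounded_nbhd (ch : GraphChart M x) : Bornology.IsBounded ch.nbhd := by
  have h : IsCompact (ch.map '' (Set.Icc (-ch.a) ch.a ×ˢ Set.Icc (-ch.h) ch.h)) :=
    (isCompact_Icc.prod isCompact_Icc).image ch.continuous_map
  refine h.isBounded.subset ?_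
  rintro _ ⟨p, hp, rfl⟩
  exact ⟨p, ⟨⟨hp.1.1.le, hp.1.2.le⟩, hp.2.1.le, hp.2.2.le⟩, rfl⟩

/-- A field with compact support in the open set `interior M` has divergence of mean zero. -/
lemma integral_pd_mul_eq_zero {U : Set Plane} (hU : IsOpen U) {ψ W : Plane → ℝ} (i : Fin 2)
    (hψ : ContDiff ℝ ∞ ψ) (hψc : HasCompactSupport ψ) (hψU : tsupport ψ ⊆ U)
    (hd : ∀ y ∈ U, DifferentiableAt ℝ W y) (hδ : ContinuousOn (fun y => pd i W y) U) :
    IntegrableOn (fun y => pd i (fun z => ψ z * W z) y) U ∧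
      ∫ y in U, pd i (fun z => ψ z * W z) y = 0 := by
  have hpd : Continuous fun y => pd i ψ y :=
    (hψ.continuous_fderiv (by simp)).clm_apply continuous_const
  have hWc : ContinuousOn W U := fun y hy => (hd y hy).continuousAt.continuousWithinAt
  have key : ∀ {φ h : Plane → ℝ}, Continuous φ → HasCompactSupport φ → tsupport φ ⊆ U →
      ContinuousOn h U → Integrable fun y => φ y * h y := by
    intro φ h hφ hφc hφU hh
    have hcont : Continuous fun y => φ y * h y := by
      rw [continuous_iff_continuousAt]
      intro y
      by_cases hy : y ∈ tsupport φ
      · exact hφ.continuousAt.mul (hh.continuousAt (hU.mem_nhds (hφU hy)))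
      · have h0 : (fun y => φ y * h y) =ᶠ[nhds y] fun _ => 0 := by
          filter_upwards [(isClosed_tsupport φ).isOpen_compl.mem_nhds hy] with z hz
          rw [image_eq_zero_of_notMem_tsupport hz, zero_mul]
        exact continuousAt_const.congr h0.symm
    exact hcont.integrable_of_hasCompactSupport hφc.mul_right
  have i1 := key hψ.continuous hψc hψU hδ
  have hpds : HasCompactSupport fun y => pd i ψ y := hψc.fderiv_apply ℝ _
  have i2 := key hpd hpds ((tsupport_fderiv_apply_subset ℝ _).trans hψU) hWc
  have i3 := key hψ.continuous hψc hψU hWc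
  have hmain := integral_mul_fderiv_eq_neg_fderiv_mul_of_integrable (𝕜 := ℝ) (μ := volume)
    (v := EuclideanSpace.single i (1 : ℝ)) i2 i1 i3
    (fun y _ => hψ.differentiable (by simp) y) (fun y hy => hd y (hψU hy))
  have hzero : ∀ y ∉ U, ψ y * pd i W y + pd i ψ y * W y = 0 := by
    intro y hy
    have hy' : y ∉ tsupport ψ := fun h => hy (hψU h)
    have h1 : pd i ψ y = 0 := image_eq_zero_of_notMem_tsupport (f := fun y => pd i ψ y)
      fun h => hy' (tsupport_fderiv_apply_subset ℝ _ h)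
    rw [h1, image_eq_zero_of_notMem_tsupport hy']
    simp
  have heq : ∀ y ∈ U, ψ y * pd i W y + pd i ψ y * W y = pd i (fun z => ψ z * W z) y := fun y hy =>
    by rw [pd_mul i (hψ.differentiable (by simp) y) (hd y hy), mul_comm (W y)]
  refine ⟨(i1.add i2).integrableOn.congr_fun heq hU.measurableSet, ?_⟩
  rw [← setIntegral_congr_fun hU.measurableSet heq,
    setIntegral_eq_integral_of_forall_compl_eq_zero hzero, integral_add i1 i2]
  simp only [pd]
  rw [hmain, neg_add_cancel]

open scoped Manifold in
/-- The divergence theorem on a compact domain with smooth boundary, for fields that are continuous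
up to the boundary and whose divergence is continuous in the interior and bounded above by an
integrable function. -/
theorem IsCompactSmoothDomain.divergence (hM : IsCompactSmoothDomain M) (hD : IsOpen D)
    (hg : IsRiemannianMetricOn g D) (hMD : M ⊆ D) {W : Fin 2 → Plane → ℝ} {Q : Plane → ℝ}
    (hc : ∀ i, ContinuousOn (W i) M)
    (hd : ∀ i, ∀ y ∈ interior M, DifferentiableAt ℝ (W i) y)
    (hδ : ∀ i, ContinuousOn (fun y => pd i (W i) y) (interior M))
    (hQ : ∀ y ∈ interior M, pd 0 (W 0) y + pd 1 (W 1) y ≤ Q y)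
    (hQi : IntegrableOn Q (interior M)) :
    IntegrableOn (fun y => pd 0 (W 0) y + pd 1 (W 1) y) (interior M) ∧
      ∫ y in interior M, (pd 0 (W 0) y + pd 1 (W 1) y) =
        ∫ y, (W 0 y * bdryTangent g M y 1 - W 1 y * bdryTangent g M y 0)
          ∂(lengthMeasure g M) := by
  have hcl := hM.isCompact.isClosed
  have hch : ∀ y : frontier M, Nonempty (GraphChart M (y : Plane)) := fun y => by
    obtain ⟨b, hb⟩ := hM.boundary y y.2
    exact hb.nonempty_graphChart y.2
  let ch : ∀ y : frontier M, GraphChart M (y : Plane) := fun y => (hch y).some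
  obtain ⟨t, ht⟩ := hM.isCompact_frontier.elim_finite_subcover (fun y : frontier M => (ch y).nbhd)
    (fun y => (ch y).isOpen_nbhd) fun y hy => Set.mem_iUnion.mpr ⟨⟨y, hy⟩, (ch ⟨y, hy⟩).mem_nbhd⟩
  let U : Option t → Set Plane := fun o => o.elim (interior M) fun y => (ch y).nbhd
  have hUo : ∀ o, IsOpen (U o) := by
    rintro (_ | y)
    · exact isOpen_interior
    · exact (ch y).isOpen_nbhd
  have hUb : ∀ o, Bornology.IsBounded (U o) := by
    rintro (_ | y)
    · exact hM.isCompact.isBounded.subset interior_subset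
    · exact (ch y).isBounded_nbhd
  have hcov : M ⊆ ⋃ o, U o := by
    intro y hy
    by_cases hi : y ∈ interior M
    · exact Set.mem_iUnion.mpr ⟨none, hi⟩
    · obtain ⟨z, hz, hyz⟩ := Set.mem_iUnion₂.mp (ht ⟨subset_closure hy, hi⟩)
      exact Set.mem_iUnion.mpr ⟨some ⟨z, hz⟩, hyz⟩
  obtain ⟨ψ, hψ⟩ := SmoothPartitionOfUnity.exists_isSubordinate 𝓘(ℝ, Plane) hcl U hUo hcov
  have hψs : ∀ o, ContDiff ℝ ∞ (ψ o) := fun o => (ψ o).contMDiff.contDiff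
  have hψd : ∀ o y, DifferentiableAt ℝ (ψ o) y := fun o y => (hψs o).differentiable (by simp) y
  have hψc : ∀ o, HasCompactSupport (ψ o) := fun o =>
    Metric.isCompact_of_isClosed_isBounded (isClosed_tsupport _) ((hUb o).subset (hψ o))
  have hpdc : ∀ o (i : Fin 2), Continuous fun y => pd i (ψ o) y := fun o i =>
    ((hψs o).continuous_fderiv (by simp)).clm_apply continuous_const
  have hsum : ∀ y ∈ M, ∑ o, ψ o y = 1 := fun y hy => by
    rw [← finsum_eq_sum_of_fintype]; exact ψ.sum_eq_one hy
  have hsum' : ∀ y ∈ interior M, ∀ i, ∑ o, pd i (ψ o) y = 0 := by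
    intro y hy i
    have h1 : (fun z => ∑ o, ψ o z) =ᶠ[nhds y] fun _ => 1 := by
      filter_upwards [isOpen_interior.mem_nhds hy] with z hz using hsum z (interior_subset hz)
    have h2 := h1.fderiv_eq (𝕜 := ℝ)
    rw [fderiv_fun_sum fun o _ => hψd o y, fderiv_fun_const] at h2
    have h3 := congrArg (fun L : Plane →L[ℝ] ℝ => L (EuclideanSpace.single i 1)) h2
    simpa [pd] using h3
  have hprod : ∀ o, ∀ y ∈ interior M, pd 0 (fun z => ψ o z * W 0 z) y + pd 1 (fun z => ψ o z * W 1 z) y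
      = ψ o y * (pd 0 (W 0) y + pd 1 (W 1) y) + (pd 0 (ψ o) y * W 0 y + pd 1 (ψ o) y * W 1 y) := by
    intro o y hy
    rw [pd_mul 0 (hψd o y) (hd 0 y hy), pd_mul 1 (hψd o y) (hd 1 y hy)]
    ring
  have hpiece : ∀ o, IntegrableOn (fun y => pd 0 (fun z => ψ o z * W 0 z) y
        + pd 1 (fun z => ψ o z * W 1 z) y) (interior M) ∧
      ∫ y in interior M, (pd 0 (fun z => ψ o z * W 0 z) y + pd 1 (fun z => ψ o z * W 1 z) y) =
        ∫ y, (ψ o y * W 0 y * bdryTangent g M y 1 - ψ o y * W 1 y * bdryTangent g M y 0)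
          ∂(lengthMeasure g M) := by
    rintro (_ | y)
    · have h0 := integral_pd_mul_eq_zero isOpen_interior 0 (hψs none) (hψc none) (hψ none)
        (hd 0) (hδ 0)
      have h1 := integral_pd_mul_eq_zero isOpen_interior 1 (hψs none) (hψc none) (hψ none)
        (hd 1) (hδ 1)
      refine ⟨h0.1.add h1.1, ?_⟩
      rw [integral_add h0.1 h1.1, h0.2, h1.2, add_zero, ← lengthMeasure_restrict_frontier]
      refine (setIntegral_eq_zero_of_forall_eq_zero fun y hy => ?_).symm
      have : ψ none y = 0 := image_eq_zero_of_notMem_tsupport fun h => hy.2 (hψ none h)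
      simp [this]
    · have hz : ∀ z ∉ tsupport (ψ (some y)), ψ (some y) z = 0 := fun z hz =>
        image_eq_zero_of_notMem_tsupport hz
      have hQi' : IntegrableOn (fun z => ψ (some y) z * Q z
          + (pd 0 (ψ (some y)) z * W 0 z + pd 1 (ψ (some y)) z * W 1 z)) (interior M) := by
        refine Integrable.add ?_ ?_
        · refine hQi.bdd_mul (c := 1) (hψs _).continuous.aestronglyMeasurable ?_
          refine Filter.Eventually.of_forall fun z => ?_
          rw [Real.norm_of_nonneg (ψ.nonneg _ _)]
          exact ψ.le_one _ _
        · have hcc : ContinuousOn (fun z => pd 0 (ψ (some y)) z * W 0 z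
              + pd 1 (ψ (some y)) z * W 1 z) M :=
            ((hpdc _ 0).continuousOn.mul (hc 0)).add ((hpdc _ 1).continuousOn.mul (hc 1))
          exact (hcc.integrableOn_compact hM.isCompact).mono_set interior_subset
      refine (ch y).divergence hM hD hg hMD ((hψs _).continuous.continuousOn.mul (hc 0))
        ((hψs _).continuous.continuousOn.mul (hc 1)) (fun z hz => (hψd _ z).mul (hd 0 z hz))
        (fun z hz => (hψd _ z).mul (hd 1 z hz)) ?_ (hψc (some y)) (hψ (some y))
        (fun z hz' => by simp [hz z hz']) (fun z hz' => by simp [hz z hz']) (fun z hz => ?_) hQi'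
      · refine ContinuousOn.congr ?_ (hprod (some y))
        have hW : ∀ i, ContinuousOn (W i) (interior M) := fun i => (hc i).mono interior_subset
        exact ((hψs _).continuous.continuousOn.mul ((hδ 0).add (hδ 1))).add
          (((hpdc _ 0).continuousOn.mul (hW 0)).add ((hpdc _ 1).continuousOn.mul (hW 1)))
      · rw [hprod (some y) z hz]
        exact add_le_add_left (mul_le_mul_of_nonneg_left (hQ z hz) (ψ.nonneg _ _)) _
  have hsumδ : ∀ y ∈ interior M, ∑ o, (pd 0 (fun z => ψ o z * W 0 z) y
      + pd 1 (fun z => ψ o z * W 1 z) y) = pd 0 (W 0) y + pd 1 (W 1) y := by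
    intro y hy
    rw [Finset.sum_congr rfl fun o _ => hprod o y hy]
    simp only [Finset.sum_add_distrib, ← Finset.sum_mul]
    rw [hsum y (interior_subset hy), hsum' y hy, hsum' y hy]
    ring
  have hT := hM.continuousOn_bdryTangent hD hg hMD
  have hTi : ∀ i : Fin 2, ContinuousOn (fun y => bdryTangent g M y i) (frontier M) := fun i =>
    (EuclideanSpace.proj i : Plane →L[ℝ] ℝ).continuous.comp_continuousOn hT
  have hWf : ∀ i, ContinuousOn (W i) (frontier M) := fun i => (hc i).mono hcl.frontier_subset
  refine ⟨IntegrableOn.congr_fun (integrable_finsetSum _ fun o _ => (hpiece o).1) hsumδ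
    isOpen_interior.measurableSet, ?_⟩
  rw [← setIntegral_congr_fun isOpen_interior.measurableSet hsumδ,
    integral_finsetSum _ fun o _ => (hpiece o).1, Finset.sum_congr rfl fun o _ => (hpiece o).2,
    ← integral_finsetSum]
  · rw [← lengthMeasure_restrict_frontier]
    refine setIntegral_congr_fun isClosed_frontier.measurableSet fun y hy => ?_
    simp only [Finset.sum_sub_distrib, mul_assoc, ← Finset.sum_mul]
    rw [hsum y (hcl.frontier_subset hy)]
    ring
  · intro o _
    exact hM.integrable_lengthMeasure hD hg hMD
      ((((hψs o).continuous.continuousOn.mul (hWf 0)).mul (hTi 1)).sub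
      (((hψs o).continuous.continuousOn.mul (hWf 1)).mul (hTi 0)))

end Pestov
end

noncomputable section

namespace Pestov

variable {g : MetricField} {D M : Set Plane} {x y : Plane}

section Composition

variable {F : Type*} [NormedAddCommGroup F] [NormedSpace ℝ F] {s : Set F} {n : ℕ∞} {π P Q : F → Plane}

lemma contDiffOn_ip_comp (hg : IsRiemannianMetricOn g D) (hπ : ContDiffOn ℝ n π s)
    (hs : Set.MapsTo π s D) (hP : ContDiffOn ℝ n P s) (hQ : ContDiffOn ℝ n Q s) :
    ContDiffOn ℝ n (fun p => ip g (π p) (P p) (Q p)) s := by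
  have hp : ∀ i, ContDiffOn ℝ n (fun x => P x i) s := contDiffOn_euclidean.mp hP
  have hq : ∀ i, ContDiffOn ℝ n (fun x => Q x i) s := contDiffOn_euclidean.mp hQ
  have hG : ∀ i j, ContDiffOn ℝ n (fun x => g (π x) i j) s := fun i j =>
    ((hg.smooth i j).of_le (by exact_mod_cast le_top)).comp hπ hs
  simp only [ip_eq]
  exact ((((hG 0 0).mul (hp 0)).mul (hq 0)).add (((hG 0 1).mul (hp 0)).mul (hq 1))).add
    (((hG 1 0).mul (hp 1)).mul (hq 0)) |>.add (((hG 1 1).mul (hp 1)).mul (hq 1))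

lemma contDiffOn_euclidean_two {P : F → Plane} (h0 : ContDiffOn ℝ n (fun x => P x 0) s)
    (h1 : ContDiffOn ℝ n (fun x => P x 1) s) : ContDiffOn ℝ n P s := by
  rw [contDiffOn_euclidean]
  intro i; fin_cases i <;> assumption

lemma contDiffOn_perp_comp (hg : IsRiemannianMetricOn g D) (hπ : ContDiffOn ℝ n π s)
    (hs : Set.MapsTo π s D) (hP : ContDiffOn ℝ n P s) :
    ContDiffOn ℝ n (fun p => perp g (π p) (P p)) s := by
  have hp : ∀ i, ContDiffOn ℝ n (fun x => P x i) s := contDiffOn_euclidean.mp hP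
  have hG : ∀ i j, ContDiffOn ℝ n (fun x => g (π x) i j) s := fun i j =>
    ((hg.smooth i j).of_le (by exact_mod_cast le_top)).comp hπ hs
  have hd : ContDiffOn ℝ n (fun x => (Real.sqrt (g (π x)).det)⁻¹) s :=
    (((contDiffOn_sqrt_det hg).of_le (by exact_mod_cast le_top)).comp hπ hs).inv
      fun x hx => (sqrt_det_pos hg (hs hx)).ne'
  apply contDiffOn_euclidean_two
  · simp only [perp_zero_apply]
    exact hd.mul (((hG 1 0).mul (hp 0)).add ((hG 1 1).mul (hp 1))).neg
  · simp only [perp_one_apply]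
    exact hd.mul (((hG 0 0).mul (hp 0)).add ((hG 0 1).mul (hp 1)))

lemma contDiffOn_christoffelVec_comp (hg : IsRiemannianMetricOn g D) (hD : IsOpen D)
    (hπ : ContDiffOn ℝ n π s) (hs : Set.MapsTo π s D) (hP : ContDiffOn ℝ n P s)
    (hQ : ContDiffOn ℝ n Q s) : ContDiffOn ℝ n (fun p => christoffelVec g (π p) (P p) (Q p)) s := by
  have hp : ∀ i, ContDiffOn ℝ n (fun x => P x i) s := contDiffOn_euclidean.mp hP
  have hq : ∀ i, ContDiffOn ℝ n (fun x => Q x i) s := contDiffOn_euclidean.mp hQ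
  have hG : ∀ l i j, ContDiffOn ℝ n (fun x => christoffel g l i j (π x)) s := fun l i j =>
    ((contDiffOn_christoffel hg hD l i j).of_le (by exact_mod_cast le_top)).comp hπ hs
  rw [contDiffOn_euclidean]
  intro l
  simp only [christoffelVec_apply]
  exact ContDiffOn.sum fun i _ => ContDiffOn.sum fun j _ => ((hG l i j).mul (hp i)).mul (hq j)

end Composition

lemma gnorm_of_unit {x v : Plane} (h : ip g x v v = 1) : gnorm g x v = 1 := by
  rw [gnorm, h, Real.sqrt_one]

lemma toUnit_of_unit {p : Plane × Plane} (h : ip g p.1 p.2 p.2 = 1) : toUnit g p = p := by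
  rw [toUnit, gnorm_of_unit h, inv_one, one_smul]

lemma homExt_of_unit {u : Plane × Plane → ℝ} {p : Plane × Plane} (h : ip g p.1 p.2 p.2 = 1) :
    homExt g u p = u p := by rw [homExt, toUnit_of_unit h]

lemma ne_zero_of_unit {x v : Plane} (h : ip g x v v = 1) : v ≠ 0 := by
  rintro rfl
  simp [ip] at h

lemma ip_angVec (hg : IsRiemannianMetricOn g D) {q : Plane × ℝ} (hq : q.1 ∈ D) :
    ip g q.1 (angVec g q) (angVec g q) = 1 := ip_unitVec hg hq q.2

lemma toUnit_angleParam (hg : IsRiemannianMetricOn g D) {q : Plane × ℝ} (hq : q.1 ∈ D) :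
    toUnit g (angleParam g q) = angleParam g q := toUnit_of_unit (ip_angVec hg hq)

lemma homExt_angleParam (hg : IsRiemannianMetricOn g D) {u : Plane × Plane → ℝ} {q : Plane × ℝ}
    (hq : q.1 ∈ D) : homExt g u (angleParam g q) = u (angleParam g q) :=
  homExt_of_unit (ip_angVec hg hq)

lemma ip_toUnit (hg : IsRiemannianMetricOn g D) {p : Plane × Plane} (hp : p.1 ∈ D) (h0 : p.2 ≠ 0) :
    ip g p.1 (toUnit g p).2 (toUnit g p).2 = 1 := ip_normalize hg hp h0

lemma contDiffOn_toUnit (hg : IsRiemannianMetricOn g D) :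
    ContDiffOn ℝ ∞ (toUnit g) (D ×ˢ {0}ᶜ) := by
  have h2 : ContDiffOn ℝ ∞ (fun p : Plane × Plane => p.2) (D ×ˢ {0}ᶜ) := contDiffOn_snd
  have h := contDiffOn_ip_comp (n := ⊤) hg (contDiffOn_fst (s := D ×ˢ {0}ᶜ)) (fun p hp => hp.1) h2 h2
  refine contDiffOn_fst.prodMk (ContDiffOn.smul (ContDiffOn.inv (h.sqrt fun p hp =>
    (ip_self_pos hg hp.1 hp.2).ne') fun p hp => (gnorm_pos hg hp.1 hp.2).ne') h2)

lemma contDiffOn_angleParam (hg : IsRiemannianMetricOn g D) :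
    ContDiffOn ℝ ∞ (angleParam g) (D ×ˢ Set.univ) := contDiffOn_fst.prodMk (contDiffOn_angVec hg)

lemma isOpen_interior_prod (M : Set Plane) : IsOpen (interior M ×ˢ ({0}ᶜ : Set Plane)) :=
  isOpen_interior.prod isOpen_compl_singleton

lemma slitTangent_mem_nhds {p : Plane × Plane} (hp : p ∈ interior M ×ˢ ({0}ᶜ : Set Plane)) :
    slitTangent M ∈ nhds p :=
  Filter.mem_of_superset ((isOpen_interior_prod M).mem_nhds hp) fun _ h =>
    ⟨interior_subset h.1, h.2⟩

lemma dSM_of_mem_interior {u : Plane × Plane → ℝ} {p : Plane × Plane}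
    (hp : p ∈ interior M ×ˢ ({0}ᶜ : Set Plane)) : dSM g M u p = fderiv ℝ (homExt g u) p :=
  fderivWithin_of_mem_nhds (slitTangent_mem_nhds hp)

/-- A vector field applied to a function of class `C^(k+1)` is of class `C^k`. -/
lemma contDiffOn_homExt_field (hg : IsRiemannianMetricOn g D) (hMD : M ⊆ D)
    {u : Plane × Plane → ℝ} {k : ℕ} (hu : ContDiffOn ℝ (k + 1) (homExt g u) (interior M ×ˢ {0}ᶜ))
    {Ξ : Plane × Plane → Plane × Plane} (hΞ : ContDiffOn ℝ ∞ Ξ (D ×ˢ Set.univ)) :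
    ContDiffOn ℝ k (homExt g fun p => dSM g M u p (Ξ p)) (interior M ×ˢ {0}ᶜ) := by
  have hsub : interior M ×ˢ ({0}ᶜ : Set Plane) ⊆ D ×ˢ {0}ᶜ :=
    Set.prod_mono (interior_subset.trans hMD) subset_rfl
  have hmaps : Set.MapsTo (toUnit g) (interior M ×ˢ {0}ᶜ) (interior M ×ˢ ({0}ᶜ : Set Plane)) :=
    fun p hp => ⟨hp.1, ne_zero_of_unit (ip_toUnit hg (hsub hp).1 hp.2)⟩
  have htU := ((contDiffOn_toUnit hg).mono hsub).of_le (m := (k : ℕ∞ω)) (by exact_mod_cast le_top)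
  have h1 : ContDiffOn ℝ k (fderiv ℝ (homExt g u)) (interior M ×ˢ {0}ᶜ) :=
    hu.fderiv_of_isOpen (isOpen_interior_prod M) le_rfl
  have h2 : ContDiffOn ℝ k Ξ (interior M ×ˢ {0}ᶜ) :=
    (hΞ.mono (Set.prod_mono (interior_subset.trans hMD) (Set.subset_univ _))).of_le
      (by exact_mod_cast le_top)
  refine ContDiffOn.congr ((h1.clm_apply h2).comp htU hmaps) fun p hp => ?_
  simp only [homExt, Function.comp]
  rw [dSM_of_mem_interior (hmaps hp)]

lemma contDiffOn_geodesicSpray (hg : IsRiemannianMetricOn g D) (hD : IsOpen D) :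
    ContDiffOn ℝ ∞ (fun p : Plane × Plane => (p.2, -christoffelVec g p.1 p.2 p.2))
      (D ×ˢ Set.univ) :=
  contDiffOn_snd.prodMk (contDiffOn_christoffelVec_comp (n := ⊤) hg hD contDiffOn_fst
    (fun _ h => h.1) contDiffOn_snd contDiffOn_snd).neg

lemma contDiffOn_verticalField (hg : IsRiemannianMetricOn g D) :
    ContDiffOn ℝ ∞ (fun p : Plane × Plane => ((0 : Plane), perp g p.1 p.2)) (D ×ˢ Set.univ) :=
  contDiffOn_const.prodMk (contDiffOn_perp_comp (n := ⊤) hg contDiffOn_fst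
    (fun _ h => h.1) contDiffOn_snd)

lemma contDiffOn_homExt_X (hg : IsRiemannianMetricOn g D) (hD : IsOpen D) (hMD : M ⊆ D)
    {u : Plane × Plane → ℝ} {k : ℕ} (hu : ContDiffOn ℝ (k + 1) (homExt g u) (interior M ×ˢ {0}ᶜ)) :
    ContDiffOn ℝ k (homExt g (X g M u)) (interior M ×ˢ {0}ᶜ) :=
  contDiffOn_homExt_field hg hMD hu (contDiffOn_geodesicSpray hg hD)

lemma contDiffOn_homExt_V (hg : IsRiemannianMetricOn g D) (hMD : M ⊆ D)
    {u : Plane × Plane → ℝ} {k : ℕ} (hu : ContDiffOn ℝ (k + 1) (homExt g u) (interior M ×ˢ {0}ᶜ)) :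
    ContDiffOn ℝ k (homExt g (V g M u)) (interior M ×ˢ {0}ᶜ) :=
  contDiffOn_homExt_field hg hMD hu (contDiffOn_verticalField hg)

lemma angleParam_mem_interior (hg : IsRiemannianMetricOn g D) (hMD : M ⊆ D) {q : Plane × ℝ}
    (hq : q.1 ∈ interior M) : angleParam g q ∈ interior M ×ˢ ({0}ᶜ : Set Plane) :=
  ⟨hq, ne_zero_of_unit (ip_angVec hg (hMD (interior_subset hq)))⟩

lemma contDiffOn_comp_angleParam (hg : IsRiemannianMetricOn g D) (hMD : M ⊆ D)
    {u : Plane × Plane → ℝ} {k : ℕ} (hu : ContDiffOn ℝ k (homExt g u) (interior M ×ˢ {0}ᶜ)) :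
    ContDiffOn ℝ k (fun q => u (angleParam g q)) (interior M ×ˢ Set.univ) := by
  have hZ := ((contDiffOn_angleParam hg).mono (Set.prod_mono (interior_subset.trans hMD)
    subset_rfl)).of_le (m := (k : ℕ∞ω)) (by exact_mod_cast le_top)
  refine ContDiffOn.congr (hu.comp hZ fun q hq => angleParam_mem_interior hg hMD hq.1)
    fun q hq => (homExt_angleParam hg (hMD (interior_subset hq.1))).symm

/-- The derivative in angle coordinates. -/
lemma fderiv_comp_angleParam (hg : IsRiemannianMetricOn g D) (hD : IsOpen D) (hMD : M ⊆ D)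
    {u : Plane × Plane → ℝ} (hu : ContDiffOn ℝ 1 (homExt g u) (interior M ×ˢ {0}ᶜ))
    {q : Plane × ℝ} (hq : q.1 ∈ interior M) (ξ : Plane × ℝ) :
    fderiv ℝ (fun q => u (angleParam g q)) q ξ =
      dSM g M u (angleParam g q) (ξ.1, fderiv ℝ (angVec g) q ξ) := by
  have hqD := hMD (interior_subset hq)
  have hmem := angleParam_mem_interior hg hMD hq
  have hZ : HasFDerivAt (angleParam g)
      ((ContinuousLinearMap.fst ℝ Plane ℝ).prod (fderiv ℝ (angVec g) q)) q :=
    hasFDerivAt_fst.prodMk (hasFDerivAt_angVec hg hD hqD)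
  have hh := ((hu.contDiffAt ((isOpen_interior_prod M).mem_nhds hmem)).differentiableAt
    (by simp)).hasFDerivAt
  have hev : (fun q => u (angleParam g q)) =ᶠ[nhds q] homExt g u ∘ angleParam g := by
    filter_upwards [nhds_prod_univ hD hqD] with p hp
    exact (homExt_angleParam hg hp.1).symm
  rw [hev.fderiv_eq, (hh.comp q hZ).fderiv, dSM_of_mem_interior hmem]
  rfl

lemma X_angleParam (hg : IsRiemannianMetricOn g D) (hD : IsOpen D) (hMD : M ⊆ D)
    {u : Plane × Plane → ℝ} (hu : ContDiffOn ℝ 1 (homExt g u) (interior M ×ˢ {0}ᶜ))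
    {q : Plane × ℝ} (hq : q.1 ∈ interior M) :
    X g M u (angleParam g q) = fderiv ℝ (fun q => u (angleParam g q)) q (geoField g q) := by
  rw [fderiv_comp_angleParam hg hD hMD hu hq, geoField,
    fderiv_angVec_horLift hg hD (hMD (interior_subset hq))]
  rfl

lemma V_angleParam (hg : IsRiemannianMetricOn g D) (hD : IsOpen D) (hMD : M ⊆ D)
    {u : Plane × Plane → ℝ} (hu : ContDiffOn ℝ 1 (homExt g u) (interior M ×ˢ {0}ᶜ))
    {q : Plane × ℝ} (hq : q.1 ∈ interior M) :
    V g M u (angleParam g q) = fderiv ℝ (fun q => u (angleParam g q)) q (0, 1) := by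
  rw [fderiv_comp_angleParam hg hD hMD hu hq, fderiv_angVec hg hD (hMD (interior_subset hq))]
  have h0 : christoffelVec g q.1 0 (angVec g q) = 0 := by
    simpa using christoffelVec_smul_left g q.1 0 0 (angVec g q)
  simp only [h0, connForm_zero, neg_zero, zero_add, one_smul]
  rfl

/-- The derivative of `u` in the direction of the horizontal lift of `a`. -/
def horDeriv (g : MetricField) (M : Set Plane) (u : Plane × Plane → ℝ) (p : Plane × Plane)
    (a : Plane) : ℝ := dSM g M u p (a, -christoffelVec g p.1 a p.2)

lemma horDeriv_angleParam (hg : IsRiemannianMetricOn g D) (hD : IsOpen D) (hMD : M ⊆ D)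
    {u : Plane × Plane → ℝ} (hu : ContDiffOn ℝ 1 (homExt g u) (interior M ×ˢ {0}ᶜ))
    {q : Plane × ℝ} (hq : q.1 ∈ interior M) (a : Plane) :
    horDeriv g M u (angleParam g q) a =
      fderiv ℝ (fun q => u (angleParam g q)) q (horLift g q.1 a) := by
  rw [fderiv_comp_angleParam hg hD hMD hu hq,
    fderiv_angVec_horLift hg hD (hMD (interior_subset hq))]
  rfl

lemma X_eq_horDeriv (u : Plane × Plane → ℝ) (p : Plane × Plane) :
    X g M u p = horDeriv g M u p p.2 := rfl

lemma horDeriv_add (u : Plane × Plane → ℝ) (p : Plane × Plane) (a b : Plane) :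
    horDeriv g M u p (a + b) = horDeriv g M u p a + horDeriv g M u p b := by
  rw [horDeriv, horDeriv, horDeriv, ← map_add, christoffelVec_add_left, Prod.mk_add_mk]
  congr 2
  abel

lemma horDeriv_smul (u : Plane × Plane → ℝ) (p : Plane × Plane) (c : ℝ) (a : Plane) :
    horDeriv g M u p (c • a) = c * horDeriv g M u p a := by
  rw [horDeriv, horDeriv, christoffelVec_smul_left, ← smul_eq_mul, ← map_smul, Prod.smul_mk,
    smul_neg]

end Pestov
end

noncomputable section

namespace Pestov

variable {g : MetricField} {D M R : Set Plane} {x y : Plane}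

lemma exists_unitVec (hg : IsRiemannianMetricOn g D) (hx : x ∈ D) {v : Plane}
    (hv : ip g x v v = 1) : ∃ α, v = unitVec g x α := by
  have h := eq_ip_smul_add hg hx (ip_frameE hg hx) v
  set a := ip g x v (frameE g x)
  set b := ip g x v (perp g x (frameE g x))
  have hab : a ^ 2 + b ^ 2 = 1 := by
    rw [h] at hv
    simp only [ip_add_left, ip_add_right, ip_smul_left, ip_smul_right, ip_frameE hg hx,
      ip_perp_perp hg hx, ip_self_perp hg hx, ip_comm' hg hx (perp g x (frameE g x))] at hv
    linarith
  have hn : ‖(⟨a, b⟩ : ℂ)‖ = 1 := by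
    rw [Complex.norm_def, Complex.normSq_mk, ← sq, ← sq, hab, Real.sqrt_one]
  have h0 : (⟨a, b⟩ : ℂ) ≠ 0 := by rw [← norm_pos_iff, hn]; exact one_pos
  refine ⟨Complex.arg ⟨a, b⟩, ?_⟩
  rw [unitVec_eq, Complex.cos_arg h0, Complex.sin_arg, hn, div_one, div_one]
  exact h

lemma ip_unitVec_unitVec (hg : IsRiemannianMetricOn g D) (hx : x ∈ D) (θ α : ℝ) :
    ip g x (unitVec g x θ) (unitVec g x α) = Real.cos (θ - α) := by
  rw [unitVec_eq, unitVec_eq, Real.cos_sub]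
  simp only [ip_add_left, ip_add_right, ip_smul_left, ip_smul_right, ip_frameE hg hx,
    ip_frameF hg hx, ip_frameE_frameF hg hx, ip_comm' hg hx (frameF g x) (frameE g x)]
  ring

lemma countable_cos_eq_zero : {θ : ℝ | Real.cos θ = 0}.Countable := by
  refine (Set.countable_range fun k : ℤ => (2 * (k : ℝ) + 1) * Real.pi / 2).mono ?_
  rintro θ hθ
  obtain ⟨k, hk⟩ := Real.cos_eq_zero_iff.mp hθ
  exact ⟨k, hk.symm⟩

lemma IsCompactSmoothDomain.outerNormal_unit (hM : IsCompactSmoothDomain M) (hD : IsOpen D)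
    (hg : IsRiemannianMetricOn g D) (hMD : M ⊆ D) (hx : x ∈ frontier M) :
    ip g x (outerNormal g M x) (outerNormal g M x) = 1 := by
  obtain ⟨U, P, hU, hxU, hUD, hP, h1, h⟩ := hM.exists_tangent hD hg hMD hx
  rw [(h x ⟨hx, hxU⟩).2, ip_neg_left, ip_neg_right, ip_perp_perp hg (hUD hxU), h1 x hxU, neg_neg]

lemma IsCompactSmoothDomain.continuousOn_outerNormal (hM : IsCompactSmoothDomain M) (hD : IsOpen D)
    (hg : IsRiemannianMetricOn g D) (hMD : M ⊆ D) :
    ContinuousOn (outerNormal g M) (frontier M) := by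
  intro x hx
  obtain ⟨U, P, hU, hxU, hUD, hP, -, h⟩ := hM.exists_tangent hD hg hMD hx
  have hc : ContinuousWithinAt (fun y => -perp g y (P y)) (frontier M) x :=
    ((contDiffOn_perp hg hUD hP).neg.continuousOn.continuousAt
      (hU.mem_nhds hxU)).continuousWithinAt
  refine hc.congr_of_eventuallyEq ?_ (h x ⟨hx, hxU⟩).2
  filter_upwards [self_mem_nhdsWithin, mem_nhdsWithin_of_mem_nhds (hU.mem_nhds hxU)] with y h1 h2
  exact (h y ⟨h1, h2⟩).2

lemma IsCompactSmoothDomain.exists_graphChart (hM : IsCompactSmoothDomain M)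
    (hx : x ∈ frontier M) : Nonempty (GraphChart M x) := by
  obtain ⟨b, hb⟩ := hM.boundary x hx
  exact hb.nonempty_graphChart hx

lemma IsCompactSmoothDomain.subset_closure_interior (hM : IsCompactSmoothDomain M) :
    M ⊆ closure (interior M) := by
  intro x hx
  by_cases hi : x ∈ interior M
  · exact subset_closure hi
  obtain ⟨ch⟩ := hM.exists_graphChart ⟨subset_closure hx, hi⟩
  have hc : Continuous fun t : ℝ => ch.map (0, t) := ch.continuous_map.comp (by fun_prop)
  have ht : Filter.Tendsto (fun t : ℝ => ch.map (0, t)) (nhdsWithin 0 (Set.Iio 0)) (nhds x) := by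
    have := (hc.tendsto 0).mono_left (nhdsWithin_le_nhds (s := Set.Iio 0))
    rwa [ch.map_zero] at this
  refine mem_closure_of_tendsto ht ?_
  filter_upwards [self_mem_nhdsWithin, mem_nhdsWithin_of_mem_nhds
    (Ioo_mem_nhds (neg_lt_zero.mpr ch.h_pos) ch.h_pos)] with t h1 h2
  exact (ch.map_mem_interior_iff ⟨⟨by simpa using ch.a_pos, ch.a_pos⟩, h2⟩).mpr h1

lemma IsCompactSmoothDomain.uniqueDiffOn (hM : IsCompactSmoothDomain M) : UniqueDiffOn ℝ M := by
  intro x hx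
  by_cases hi : x ∈ interior M
  · exact uniqueDiffWithinAt_of_mem_nhds (mem_interior_iff_mem_nhds.mp hi)
  obtain ⟨ch⟩ := hM.exists_graphChart ⟨subset_closure hx, hi⟩
  set s : Set (ℝ × ℝ) := Set.Ioo (-ch.a) ch.a ×ˢ Set.Ioc (-ch.h) 0
  have h0 : ((0 : ℝ), (0 : ℝ)) ∈ s := ⟨⟨by simpa using ch.a_pos, ch.a_pos⟩, by simpa using ch.h_pos,
    le_rfl⟩
  obtain ⟨L, hL, hL'⟩ := ch.hasFDerivAt_map (0, 0)
  have hsurj : Function.Surjective L := by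
    have hu := ch.unit
    intro v
    refine ⟨(-ch.n 1 * v 0 + ch.n 0 * v 1, ch.n 0 * v 0 + ch.n 1 * v 1
      - deriv ch.f 0 * (-ch.n 1 * v 0 + ch.n 0 * v 1)), ?_⟩
    rw [hL']
    apply plane_ext
    · simp [GraphChart.velocity]; linear_combination v 0 * hu
    · simp [GraphChart.velocity]; linear_combination v 1 * hu
  have := hL.hasFDerivWithinAt.uniqueDiffWithinAt (s := s)
    ((uniqueDiffOn_Ioo _ _).prod (uniqueDiffOn_Ioc _ _) _ h0) hsurj.denseRange
  rw [ch.map_zero] at this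
  refine this.mono ?_
  rintro _ ⟨p, hp, rfl⟩
  exact (ch.map_mem_iff ⟨hp.1, hp.2.1, hp.2.2.trans_lt ch.h_pos⟩).mpr hp.2.2

lemma IsCompactSmoothDomain.uniqueDiffOn_slitTangent (hM : IsCompactSmoothDomain M) :
    UniqueDiffOn ℝ (slitTangent M) :=
  hM.uniqueDiffOn.prod isOpen_compl_singleton.uniqueDiffOn

lemma isClosed_unitBundle (hg : IsRiemannianMetricOn g D) {A : Set Plane} (hA : IsClosed A)
    (hAD : A ⊆ D) : IsClosed (unitBundle g A) := by
  have hc : ContinuousOn (fun p : Plane × Plane => ip g p.1 p.2 p.2) (A ×ˢ Set.univ) :=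
    (contDiffOn_ip_comp (n := 0) hg contDiffOn_fst (fun p hp => hAD hp.1) contDiffOn_snd
      contDiffOn_snd).continuousOn
  have := hc.preimage_isClosed_of_isClosed (hA.prod isClosed_univ) (isClosed_singleton (x := (1 : ℝ)))
  convert this using 1
  ext p
  simp [unitBundle]

/-- The hypotheses on the domain and the function: `u` is Lipschitz on `SM`, of class `C^1` off the
vectors tangent to `R`, of class `C^2` in the interior, and invariant under reflection. -/
structure IsAdmissible (g : MetricField) (D M R : Set Plane) (u : Plane × Plane → ℝ) : Prop where
  isOpen : IsOpen D
  metric : IsRiemannianMetricOn g D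
  domain : IsCompactSmoothDomain M
  subset : M ⊆ D
  isClosed : IsClosed R
  subset_frontier : R ⊆ frontier M
  lipschitz : ∃ C : NNReal, LipschitzOnWith C u (unitBundle g M)
  contDiff_one : ContDiffSM g M 1 (tangentialPart g M R) u
  contDiff_two : ContDiffSM g M 2 (unitBundle g R) u
  reflection : ∀ p ∈ unitBundle g (frontier M), u p = u (reflection g M p)

/-- The angle coordinates of the points of `SM` that are not tangent to `R`. -/
def regularSet (g : MetricField) (M R : Set Plane) : Set (Plane × ℝ) :=
  {q | q.1 ∈ M ∧ angleParam g q ∉ tangentialPart g M R}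

lemma regularSet_subset : regularSet g M R ⊆ M ×ˢ Set.univ := fun _ hq => ⟨hq.1, trivial⟩

namespace IsAdmissible

variable {u : Plane × Plane → ℝ} (h : IsAdmissible g D M R u)
include h

lemma frontier_subset : frontier M ⊆ M := h.domain.isCompact.isClosed.frontier_subset

lemma frontier_subset' : frontier M ⊆ D := h.frontier_subset.trans h.subset

lemma isClosed_tangentialPart : IsClosed (tangentialPart g M R) := by
  have hRD : R ⊆ D := h.subset_frontier.trans h.frontier_subset'
  have hcl := isClosed_unitBundle h.metric h.isClosed hRD
  have hn : ContinuousOn (fun p : Plane × Plane => outerNormal g M p.1) (unitBundle g R) :=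
    ((h.domain.continuousOn_outerNormal h.isOpen h.metric h.subset).mono h.subset_frontier).comp
      continuousOn_fst fun p hp => hp.1
  have hg : ∀ i j, ContinuousOn (fun p : Plane × Plane => g p.1 i j) (unitBundle g R) := fun i j =>
    (h.metric.smooth i j).continuousOn.comp continuousOn_fst fun p hp => hRD hp.1
  have hn' : ∀ i : Fin 2, ContinuousOn (fun p : Plane × Plane => outerNormal g M p.1 i)
      (unitBundle g R) := fun i =>
    (EuclideanSpace.proj i : Plane →L[ℝ] ℝ).continuous.comp_continuousOn hn
  have hv : ∀ i : Fin 2, Continuous fun p : Plane × Plane => p.2 i := fun i =>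
    (EuclideanSpace.proj i : Plane →L[ℝ] ℝ).continuous.comp continuous_snd
  have hc : ContinuousOn (fun p : Plane × Plane => ip g p.1 p.2 (outerNormal g M p.1))
      (unitBundle g R) := by
    simp only [ip]
    exact continuousOn_finsetSum _ fun i _ => continuousOn_finsetSum _ fun j _ =>
      ((hg i j).mul (hv i).continuousOn).mul (hn' j)
  have := hc.preimage_isClosed_of_isClosed hcl (isClosed_singleton (x := (0 : ℝ)))
  convert this using 1
  rfl

lemma contDiffOn_interior : ContDiffOn ℝ 2 (homExt g u) (interior M ×ˢ {0}ᶜ) := by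
  refine h.contDiff_two.mono fun p hp => ⟨⟨interior_subset hp.1, hp.2⟩, fun hR => ?_⟩
  exact (h.subset_frontier hR.1).2 hp.1

lemma contDiffOn_interior_one : ContDiffOn ℝ 1 (homExt g u) (interior M ×ˢ {0}ᶜ) :=
  h.contDiffOn_interior.of_le (by norm_num)

lemma exists_isOpen : ∃ O : Set (Plane × Plane), IsOpen O ∧
    {p ∈ slitTangent M | toUnit g p ∉ tangentialPart g M R} = slitTangent M ∩ O := by
  have hO : IsOpen (D ×ˢ ({0}ᶜ : Set Plane)) := h.isOpen.prod isOpen_compl_singleton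
  refine ⟨_, (contDiffOn_toUnit h.metric).continuousOn.isOpen_inter_preimage hO
    h.isClosed_tangentialPart.isOpen_compl, ?_⟩
  ext p
  exact ⟨fun hp => ⟨hp.1, ⟨h.subset hp.1.1, hp.1.2⟩, hp.2⟩, fun hp => ⟨hp.1, hp.2.2⟩⟩

lemma continuousOn_dSM : ContinuousOn (dSM g M u)
    {p ∈ slitTangent M | toUnit g p ∉ tangentialPart g M R} := by
  obtain ⟨O, hO, heq⟩ := h.exists_isOpen
  have h1 := h.contDiff_one
  rw [ContDiffSM, heq] at h1
  rw [heq]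
  refine (h1.continuousOn_fderivWithin (h.domain.uniqueDiffOn_slitTangent.inter hO)
    (by norm_num)).congr fun p hp => ?_
  rw [fderivWithin_inter (hO.mem_nhds hp.2)]
  rfl

lemma hasFDerivWithinAt {p : Plane × Plane} (hp : p ∈ slitTangent M)
    (hp' : toUnit g p ∉ tangentialPart g M R) :
    HasFDerivWithinAt (homExt g u) (dSM g M u p) (slitTangent M) p := by
  obtain ⟨O, hO, heq⟩ := h.exists_isOpen
  have h1 := h.contDiff_one
  have hpO : p ∈ slitTangent M ∩ O := heq ▸ ⟨hp, hp'⟩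
  rw [ContDiffSM, heq] at h1
  have h2 := (h1.differentiableOn (by norm_num)) p hpO
  rw [differentiableWithinAt_inter (hO.mem_nhds hpO.2)] at h2
  exact h2.hasFDerivWithinAt

lemma mem_interior_regularSet {q : Plane × ℝ} (hq : q.1 ∈ interior M) : q ∈ regularSet g M R :=
  ⟨interior_subset hq, fun hR => (h.subset_frontier hR.1.1).2 hq⟩

lemma mapsTo_angleParam : Set.MapsTo (angleParam g) (regularSet g M R)
    {p ∈ slitTangent M | toUnit g p ∉ tangentialPart g M R} := fun q hq => by
  have hqD := h.subset hq.1
  refine ⟨⟨hq.1, ne_zero_of_unit (ip_angVec h.metric hqD)⟩, ?_⟩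
  rw [toUnit_angleParam h.metric hqD]
  exact hq.2

lemma continuousOn_angleParam : ContinuousOn (angleParam g) (M ×ˢ Set.univ) :=
  (contDiffOn_angleParam h.metric).continuousOn.mono (Set.prod_mono h.subset subset_rfl)

/-- A continuous field applied to `u`, in angle coordinates, is continuous off the tangential
vectors. -/
lemma continuousOn_field {Ξ : Plane × ℝ → Plane × Plane} (hΞ : ContinuousOn Ξ (M ×ˢ Set.univ)) :
    ContinuousOn (fun q => dSM g M u (angleParam g q) (Ξ q)) (regularSet g M R) :=
  (h.continuousOn_dSM.comp (h.continuousOn_angleParam.mono regularSet_subset)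
    h.mapsTo_angleParam).clm_apply (hΞ.mono regularSet_subset)

lemma norm_fderiv_le {C : NNReal} (hC : LipschitzOnWith C u (unitBundle g M)) {q : Plane × ℝ}
    (hq : q.1 ∈ interior M) (ξ : Plane × ℝ) :
    |fderiv ℝ (fun q => u (angleParam g q)) q ξ| ≤ C * ‖(ξ.1, fderiv ℝ (angVec g) q ξ)‖ := by
  have hqM := interior_subset hq
  have hqD := h.subset hqM
  have hline : HasDerivAt (fun t : ℝ => q + t • ξ) ξ 0 := by
    simpa using ((hasDerivAt_id (0 : ℝ)).smul_const ξ).const_add q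
  have hq0 : q + (0 : ℝ) • ξ = q := by simp
  have hu := contDiffOn_comp_angleParam (k := 1) h.metric h.subset
    (by exact_mod_cast h.contDiffOn_interior_one)
  have h1 : HasFDerivAt (fun q => u (angleParam g q))
      (fderiv ℝ (fun q => u (angleParam g q)) q) (q + (0 : ℝ) • ξ) := by
    rw [hq0]
    exact ((hu.contDiffAt (nhds_prod_univ isOpen_interior hq)).differentiableAt
      (by norm_num)).hasFDerivAt
  have h2 : HasFDerivAt (angleParam g)
      ((ContinuousLinearMap.fst ℝ Plane ℝ).prod (fderiv ℝ (angVec g) q)) (q + (0 : ℝ) • ξ) := by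
    rw [hq0]
    exact hasFDerivAt_fst.prodMk (hasFDerivAt_angVec h.metric h.isOpen hqD)
  have s1 := (hasDerivAt_iff_tendsto_slope_zero.mp (h1.comp_hasDerivAt 0 hline)).norm
  have s2 := ((hasDerivAt_iff_tendsto_slope_zero.mp (h2.comp_hasDerivAt 0 hline)).norm).const_mul
    (C : ℝ)
  refine le_of_tendsto_of_tendsto s1 s2 ?_
  have hev : ∀ᶠ t in nhds (0 : ℝ), (q + t • ξ).1 ∈ M := by
    have : ContinuousAt (fun t : ℝ => (q + t • ξ).1) 0 := by fun_prop
    refine this.eventually ?_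
    simp only [hq0]
    exact mem_interior_iff_mem_nhds.mp hq
  filter_upwards [hev.filter_mono nhdsWithin_le_nhds] with t ht
  have hmem : ∀ {q : Plane × ℝ}, q.1 ∈ M → angleParam g q ∈ unitBundle g M := fun hq =>
    ⟨hq, ip_angVec h.metric (h.subset hq)⟩
  have := hC.norm_sub_le (hmem ht) (hmem hqM)
  simp only [zero_add, Function.comp, hq0, norm_smul]
  calc _ ≤ ‖t⁻¹‖ * (C * ‖angleParam g (q + t • ξ) - angleParam g q‖) := by gcongr
    _ = _ := by ring

/-- A field of bounded length tangent to `SM` and applied to `u` gives a bounded function. -/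
lemma exists_bound {ξ : Plane × ℝ → Plane × ℝ} {Ξ : Plane × ℝ → Plane × Plane}
    (hΞ : ContinuousOn Ξ (M ×ˢ Set.univ))
    (heq : ∀ q : Plane × ℝ, q.1 ∈ M → ((ξ q).1, fderiv ℝ (angVec g) q (ξ q)) = Ξ q) :
    ∃ B : ℝ, 0 ≤ B ∧ ∀ q ∈ regularSet g M R, q.2 ∈ Set.Icc 0 (2 * Real.pi) →
      |dSM g M u (angleParam g q) (Ξ q)| ≤ B := by
  obtain ⟨C, hC⟩ := h.lipschitz
  obtain ⟨B, hB⟩ := (h.domain.isCompact.prod (isCompact_Icc (a := 0) (b := 2 * Real.pi))).exists_bound_of_continuousOn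
    (hΞ.mono (Set.prod_mono subset_rfl (Set.subset_univ _)))
  refine ⟨C * max B 0, by positivity, fun q hq hq2 => ?_⟩
  have hcl : q ∈ closure (interior M ×ˢ {q.2}) := by
    rw [closure_prod_eq, closure_singleton]
    exact ⟨h.domain.subset_closure_interior hq.1, rfl⟩
  have hne : (nhdsWithin q (interior M ×ˢ {q.2})).NeBot := mem_closure_iff_nhdsWithin_neBot.mp hcl
  have hsub : interior M ×ˢ {q.2} ⊆ regularSet g M R := fun p hp => h.mem_interior_regularSet hp.1
  refine le_of_tendsto ((h.continuousOn_field hΞ q hq).mono hsub).abs ?_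
  filter_upwards [self_mem_nhdsWithin] with p hp
  rw [← heq p (interior_subset hp.1), ← fderiv_comp_angleParam h.metric h.isOpen h.subset
    h.contDiffOn_interior_one hp.1]
  refine (h.norm_fderiv_le hC hp.1 _).trans ?_
  rw [heq p (interior_subset hp.1)]
  have hp2 : p.2 = q.2 := hp.2
  exact mul_le_mul_of_nonneg_left ((hB p ⟨interior_subset hp.1, hp2 ▸ hq2⟩).trans (le_max_left _ _))
    C.2

lemma continuousOn_angVec : ContinuousOn (angVec g) (M ×ˢ Set.univ) :=
  (contDiffOn_angVec h.metric).continuousOn.mono (Set.prod_mono h.subset subset_rfl)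

lemma continuousOn_angPerp : ContinuousOn (angPerp g) (M ×ˢ Set.univ) :=
  (contDiffOn_angPerp h.metric).continuousOn.mono (Set.prod_mono h.subset subset_rfl)

lemma continuousOn_christoffelVec {P Q : Plane × ℝ → Plane} (hP : ContinuousOn P (M ×ˢ Set.univ))
    (hQ : ContinuousOn Q (M ×ˢ Set.univ)) :
    ContinuousOn (fun q => christoffelVec g q.1 (P q) (Q q)) (M ×ˢ Set.univ) := by
  have hG : ∀ l i j, ContinuousOn (fun q : Plane × ℝ => christoffel g l i j q.1)
      (M ×ˢ Set.univ) := fun l i j =>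
    (contDiffOn_christoffel h.metric h.isOpen l i j).continuousOn.comp continuousOn_fst
      fun q hq => h.subset hq.1
  have hp : ∀ i : Fin 2, ContinuousOn (fun q => P q i) (M ×ˢ Set.univ) := fun i =>
    (EuclideanSpace.proj i : Plane →L[ℝ] ℝ).continuous.comp_continuousOn hP
  have hq : ∀ i : Fin 2, ContinuousOn (fun q => Q q i) (M ×ˢ Set.univ) := fun i =>
    (EuclideanSpace.proj i : Plane →L[ℝ] ℝ).continuous.comp_continuousOn hQ
  unfold christoffelVec
  refine (PiLp.continuous_toLp 2 _).comp_continuousOn (continuousOn_pi.mpr fun l => ?_)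
  exact continuousOn_finsetSum _ fun i _ => continuousOn_finsetSum _ fun j _ =>
    ((hG l i j).mul (hp i)).mul (hq j)

lemma continuousOn_horDeriv {P : Plane × ℝ → Plane} (hP : ContinuousOn P (M ×ˢ Set.univ)) :
    ContinuousOn (fun q => horDeriv g M u (angleParam g q) (P q)) (regularSet g M R) :=
  h.continuousOn_field (hP.prodMk (h.continuousOn_christoffelVec hP h.continuousOn_angVec).neg)

lemma exists_bound_horDeriv {P : Plane × ℝ → Plane} (hP : ContinuousOn P (M ×ˢ Set.univ)) :
    ∃ B : ℝ, 0 ≤ B ∧ ∀ q ∈ regularSet g M R, q.2 ∈ Set.Icc 0 (2 * Real.pi) →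
      |horDeriv g M u (angleParam g q) (P q)| ≤ B :=
  h.exists_bound (ξ := fun q => horLift g q.1 (P q))
    (hP.prodMk (h.continuousOn_christoffelVec hP h.continuousOn_angVec).neg) fun q hq => by
      rw [fderiv_angVec_horLift h.metric h.isOpen (h.subset hq)]; rfl

lemma continuousOn_V :
    ContinuousOn (fun q => V g M u (angleParam g q)) (regularSet g M R) :=
  h.continuousOn_field (continuousOn_const.prodMk h.continuousOn_angPerp)

lemma exists_bound_V : ∃ B : ℝ, 0 ≤ B ∧ ∀ q ∈ regularSet g M R, q.2 ∈ Set.Icc 0 (2 * Real.pi) →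
      |V g M u (angleParam g q)| ≤ B :=
  h.exists_bound (ξ := fun _ => (0, 1))
    (continuousOn_const.prodMk h.continuousOn_angPerp) fun q hq => by
      rw [fderiv_angVec h.metric h.isOpen (h.subset hq)]
      have h0 : christoffelVec g q.1 0 (angVec g q) = 0 := by
        simpa using christoffelVec_smul_left g q.1 0 0 (angVec g q)
      simp only [h0, connForm_zero, neg_zero, zero_add, one_smul]
      rfl

lemma countable_tangential (hx : x ∈ M) :
    {θ : ℝ | (x, θ) ∉ regularSet g M R}.Countable := by
  by_cases hR : x ∈ R
  · have hxf := h.subset_frontier hR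
    have hxD := h.frontier_subset' hxf
    obtain ⟨α, hα⟩ := exists_unitVec h.metric hxD
      (h.domain.outerNormal_unit h.isOpen h.metric h.subset hxf)
    refine (countable_cos_eq_zero.preimage (f := fun θ => θ - α)
      (sub_left_injective)).mono fun θ hθ => ?_
    have h1 : angleParam g (x, θ) ∈ tangentialPart g M R := by
      by_contra hcon; exact hθ ⟨hx, hcon⟩
    have h2 : ip g x (unitVec g x θ) (outerNormal g M x) = 0 := h1.2
    rwa [hα, ip_unitVec_unitVec h.metric hxD] at h2
  · refine Set.countable_empty.mono fun θ hθ => hθ ⟨hx, fun hcon => hR hcon.1.1⟩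

end IsAdmissible

end Pestov
end

noncomputable section

namespace Pestov

variable {g : MetricField} {D M R : Set Plane} {x y : Plane}

/-- The integrand of the flux field of the Pestov identity. -/
def fluxIntegrand (g : MetricField) (M : Set Plane) (u : Plane × Plane → ℝ) (i : Fin 2)
    (q : Plane × ℝ) : ℝ :=
  Real.sqrt (g q.1).det *
    (angVec g q i * (horDeriv g M u (angleParam g q) (angPerp g q) * V g M u (angleParam g q))
      - angPerp g q i * (horDeriv g M u (angleParam g q) (angVec g q) * V g M u (angleParam g q)))

/-- The flux field of the Pestov identity. -/
def flux (g : MetricField) (M : Set Plane) (u : Plane × Plane → ℝ) (i : Fin 2) (x : Plane) : ℝ :=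
  ∫ θ in (0)..(2 * Real.pi), fluxIntegrand g M u i (x, θ)

lemma unitVec_periodic (g : MetricField) (x : Plane) : Function.Periodic (unitVec g x) (2 * Real.pi) :=
  fun θ => by rw [unitVec_eq, unitVec_eq, Real.cos_periodic θ, Real.sin_periodic θ]

lemma angleParam_two_pi (g : MetricField) (x : Plane) :
    angleParam g (x, 2 * Real.pi) = angleParam g (x, 0) := by
  have := unitVec_periodic g x 0
  rw [zero_add] at this
  simp only [angleParam, this]

lemma continuousOn_coord {P : Plane × ℝ → Plane} {s : Set (Plane × ℝ)} (hP : ContinuousOn P s)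
    (i : Fin 2) : ContinuousOn (fun q => P q i) s :=
  (EuclideanSpace.proj i : Plane →L[ℝ] ℝ).continuous.comp_continuousOn hP

lemma continuous_section {F : Plane × ℝ → ℝ} (hF : ContinuousOn F (interior M ×ˢ Set.univ))
    (hx : x ∈ interior M) : Continuous fun θ => F (x, θ) :=
  hF.comp_continuous (by fun_prop) fun _ => ⟨hx, trivial⟩

namespace IsAdmissible

variable {u : Plane × Plane → ℝ} (h : IsAdmissible g D M R u)
include h

lemma eventually_mem_regularSet {q : Plane × ℝ} (hq : q ∈ regularSet g M R) :
    regularSet g M R ∈ nhdsWithin q (M ×ˢ Set.univ) := by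
  have h1 := (h.continuousOn_angleParam q (regularSet_subset hq)).eventually
    (h.isClosed_tangentialPart.isOpen_compl.mem_nhds hq.2)
  filter_upwards [h1, self_mem_nhdsWithin] with p hp hpM
  exact ⟨hpM.1, hp⟩

lemma aestronglyMeasurable_section {F : Plane × ℝ → ℝ} (hF : ContinuousOn F (regularSet g M R))
    (hx : x ∈ M) : AEStronglyMeasurable fun θ => F (x, θ) := by
  have hcount := h.countable_tangential hx
  have hm : MeasurableSet {θ : ℝ | (x, θ) ∈ regularSet g M R} := by
    have := hcount.measurableSet.compl
    rwa [show {θ : ℝ | (x, θ) ∉ regularSet g M R}ᶜ = {θ : ℝ | (x, θ) ∈ regularSet g M R} by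
      ext; simp] at this
  have hc : ContinuousOn (fun θ => F (x, θ)) {θ : ℝ | (x, θ) ∈ regularSet g M R} :=
    hF.comp (by fun_prop) fun θ hθ => hθ
  have h1 := hc.aestronglyMeasurable (μ := volume) hm
  rwa [Measure.restrict_eq_self_of_ae_mem] at h1
  rw [ae_iff]
  exact hcount.measure_zero _

lemma ae_regular (hx : x ∈ M) : ∀ᵐ θ : ℝ, (x, θ) ∈ regularSet g M R := by
  rw [ae_iff]
  exact (h.countable_tangential hx).measure_zero _

lemma ae_bound {F : Plane × ℝ → ℝ} {B : ℝ}
    (hB : ∀ q ∈ regularSet g M R, q.2 ∈ Set.Icc 0 (2 * Real.pi) → |F q| ≤ B) (hx : x ∈ M) :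
    ∀ᵐ θ : ℝ, θ ∈ Set.uIoc 0 (2 * Real.pi) → ‖F (x, θ)‖ ≤ B := by
  filter_upwards [h.ae_regular hx] with θ hθ hθ2
  rw [Set.uIoc_of_le (by positivity)] at hθ2
  exact hB _ hθ ⟨hθ2.1.le, hθ2.2⟩

lemma intervalIntegrable_section {F : Plane × ℝ → ℝ} (hF : ContinuousOn F (regularSet g M R)) {B : ℝ}
    (hB : ∀ q ∈ regularSet g M R, q.2 ∈ Set.Icc 0 (2 * Real.pi) → |F q| ≤ B) (hx : x ∈ M) :
    IntervalIntegrable (fun θ => F (x, θ)) volume 0 (2 * Real.pi) := by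
  refine (intervalIntegrable_const (c := B)).mono_fun
    (h.aestronglyMeasurable_section hF hx).restrict ?_
  refine (ae_restrict_iff' measurableSet_uIoc).mpr ?_
  filter_upwards [h.ae_bound hB hx] with θ hθ hθ2
  exact (hθ hθ2).trans (le_abs_self B)

lemma continuousOn_integral_section {F : Plane × ℝ → ℝ} (hF : ContinuousOn F (regularSet g M R))
    {B : ℝ} (hB : ∀ q ∈ regularSet g M R, q.2 ∈ Set.Icc 0 (2 * Real.pi) → |F q| ≤ B) :
    ContinuousOn (fun x => ∫ θ in (0)..(2 * Real.pi), F (x, θ)) M := by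
  intro x hx
  refine intervalIntegral.continuousWithinAt_of_dominated_interval (bound := fun _ => B) ?_ ?_
    intervalIntegrable_const ?_
  · filter_upwards [self_mem_nhdsWithin] with y hy
    exact (h.aestronglyMeasurable_section hF hy).restrict
  · filter_upwards [self_mem_nhdsWithin] with y hy
    exact h.ae_bound hB hy
  · filter_upwards [h.ae_regular hx] with θ hθ _
    have h1 : ContinuousWithinAt F (M ×ˢ Set.univ) (x, θ) :=
      (hF (x, θ) hθ).mono_of_mem_nhdsWithin (h.eventually_mem_regularSet hθ)
    exact h1.comp (f := fun x => (x, θ)) (by fun_prop) fun y hy => ⟨hy, trivial⟩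

lemma continuousOn_fluxIntegrand (i : Fin 2) :
    ContinuousOn (fluxIntegrand g M u i) (regularSet g M R) := by
  have hs : ContinuousOn (fun q : Plane × ℝ => Real.sqrt (g q.1).det) (regularSet g M R) :=
    (contDiffOn_sqrt_det h.metric).continuousOn.comp continuousOn_fst fun q hq => h.subset hq.1
  have hv := (continuousOn_coord h.continuousOn_angVec i).mono
    (regularSet_subset (g := g) (R := R))
  have hw := (continuousOn_coord h.continuousOn_angPerp i).mono
    (regularSet_subset (g := g) (R := R))
  exact hs.mul ((hv.mul ((h.continuousOn_horDeriv h.continuousOn_angPerp).mul h.continuousOn_V)).sub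
    (hw.mul ((h.continuousOn_horDeriv h.continuousOn_angVec).mul h.continuousOn_V)))

lemma exists_bound_fluxIntegrand (i : Fin 2) : ∃ B : ℝ, 0 ≤ B ∧ ∀ q ∈ regularSet g M R,
    q.2 ∈ Set.Icc 0 (2 * Real.pi) → |fluxIntegrand g M u i q| ≤ B := by
  obtain ⟨Ba, ha0, ha⟩ := h.exists_bound_horDeriv h.continuousOn_angVec
  obtain ⟨Bb, hb0, hb⟩ := h.exists_bound_horDeriv h.continuousOn_angPerp
  obtain ⟨Bc, hc0, hc⟩ := h.exists_bound_V
  have hs : ContinuousOn (fun q : Plane × ℝ => Real.sqrt (g q.1).det) (M ×ˢ Set.univ) :=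
    (contDiffOn_sqrt_det h.metric).continuousOn.comp continuousOn_fst fun q hq => h.subset hq.1
  have hv := continuousOn_coord h.continuousOn_angVec i
  have hw := continuousOn_coord h.continuousOn_angPerp i
  have hK := h.domain.isCompact.prod (isCompact_Icc (a := 0) (b := 2 * Real.pi))
  have hsub : M ×ˢ Set.Icc 0 (2 * Real.pi) ⊆ M ×ˢ (Set.univ : Set ℝ) :=
    Set.prod_mono subset_rfl (Set.subset_univ _)
  obtain ⟨Bs, hBs⟩ := hK.exists_bound_of_continuousOn (hs.mono hsub)
  obtain ⟨Bv, hBv⟩ := hK.exists_bound_of_continuousOn (hv.mono hsub)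
  obtain ⟨Bw, hBw⟩ := hK.exists_bound_of_continuousOn (hw.mono hsub)
  refine ⟨|Bs| * (|Bv| * (Bb * Bc) + |Bw| * (Ba * Bc)), by positivity, fun q hq hq2 => ?_⟩
  have hqK : q ∈ M ×ˢ Set.Icc 0 (2 * Real.pi) := ⟨hq.1, hq2⟩
  have e1 := (hBs q hqK).trans (le_abs_self _)
  have e2 := (hBv q hqK).trans (le_abs_self _)
  have e3 := (hBw q hqK).trans (le_abs_self _)
  rw [Real.norm_eq_abs] at e1 e2 e3
  rw [fluxIntegrand, abs_mul]
  refine mul_le_mul e1 ((abs_sub _ _).trans (add_le_add ?_ ?_)) (abs_nonneg _) (abs_nonneg _)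
  · rw [abs_mul, abs_mul]
    exact mul_le_mul e2 (mul_le_mul (hb q hq hq2) (hc q hq hq2) (abs_nonneg _) hb0) (by positivity)
      (abs_nonneg _)
  · rw [abs_mul, abs_mul]
    exact mul_le_mul e3 (mul_le_mul (ha q hq hq2) (hc q hq hq2) (abs_nonneg _) ha0) (by positivity)
      (abs_nonneg _)

lemma continuousOn_flux (i : Fin 2) : ContinuousOn (flux g M u i) M := by
  obtain ⟨B, -, hB⟩ := h.exists_bound_fluxIntegrand i
  exact h.continuousOn_integral_section (h.continuousOn_fluxIntegrand i) hB

lemma contDiffOn_angle_one {P : Plane × ℝ → Plane × ℝ}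
    (hP : ContDiffOn ℝ 1 P (interior M ×ˢ Set.univ)) :
    ContDiffOn ℝ 1 (fun q => fderiv ℝ (fun q => u (angleParam g q)) q (P q))
      (interior M ×ˢ Set.univ) := by
  have hu := contDiffOn_comp_angleParam (k := 2) h.metric h.subset
    (by exact_mod_cast h.contDiffOn_interior)
  exact (hu.fderiv_of_isOpen (isOpen_interior.prod isOpen_univ) (m := 1) (by norm_num)).clm_apply hP

lemma interior_prod_subset : interior M ×ˢ (Set.univ : Set ℝ) ⊆ D ×ˢ Set.univ :=
  Set.prod_mono (interior_subset.trans h.subset) subset_rfl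

lemma contDiffOn_X : ContDiffOn ℝ 1 (fun q => X g M u (angleParam g q))
    (interior M ×ˢ Set.univ) := by
  have hv := ((contDiffOn_angVec h.metric).mono h.interior_prod_subset).of_le (m := 1) (by simp)
  refine (h.contDiffOn_angle_one (P := geoField g) (contDiffOn_horLift (n := 1) h.metric h.isOpen
    h.interior_prod_subset hv)).congr fun q hq => ?_
  exact X_angleParam h.metric h.isOpen h.subset h.contDiffOn_interior_one hq.1

lemma contDiffOn_horDeriv_perp : ContDiffOn ℝ 1
    (fun q => horDeriv g M u (angleParam g q) (angPerp g q)) (interior M ×ˢ Set.univ) := by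
  have hv := ((contDiffOn_angPerp h.metric).mono h.interior_prod_subset).of_le (m := 1) (by simp)
  refine (h.contDiffOn_angle_one (P := perpField g) (contDiffOn_horLift (n := 1) h.metric h.isOpen
    h.interior_prod_subset hv)).congr fun q hq => ?_
  exact horDeriv_angleParam h.metric h.isOpen h.subset h.contDiffOn_interior_one hq.1 _

lemma contDiffOn_V : ContDiffOn ℝ 1 (fun q => V g M u (angleParam g q))
    (interior M ×ˢ Set.univ) := by
  refine (h.contDiffOn_angle_one (P := fun _ => (0, 1)) contDiffOn_const).congr fun q hq => ?_
  exact V_angleParam h.metric h.isOpen h.subset h.contDiffOn_interior_one hq.1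

lemma contDiffOn_fluxIntegrand (i : Fin 2) :
    ContDiffOn ℝ 1 (fluxIntegrand g M u i) (interior M ×ˢ Set.univ) := by
  have hs : ContDiffOn ℝ 1 (fun q : Plane × ℝ => Real.sqrt (g q.1).det) (interior M ×ˢ Set.univ) :=
    ((contDiffOn_sqrt_det h.metric).of_le (by simp)).comp contDiffOn_fst
      fun q hq => h.subset (interior_subset hq.1)
  have hv : ContDiffOn ℝ 1 (fun q => angVec g q i) (interior M ×ˢ Set.univ) :=
    contDiffOn_euclidean.mp
      (((contDiffOn_angVec h.metric).mono h.interior_prod_subset).of_le (by simp)) i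
  have hw : ContDiffOn ℝ 1 (fun q => angPerp g q i) (interior M ×ˢ Set.univ) :=
    contDiffOn_euclidean.mp
      (((contDiffOn_angPerp h.metric).mono h.interior_prod_subset).of_le (by simp)) i
  exact hs.mul ((hv.mul (h.contDiffOn_horDeriv_perp.mul h.contDiffOn_V)).sub
    (hw.mul (h.contDiffOn_X.mul h.contDiffOn_V)))

lemma pd_flux (i j : Fin 2) (hx : x ∈ interior M) : DifferentiableAt ℝ (flux g M u i) x ∧
    pd j (flux g M u i) x =
      ∫ θ in (0)..(2 * Real.pi), fderiv ℝ (fluxIntegrand g M u i) (x, θ) (basisVec j, 0) := by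
  obtain ⟨L, hL, hL'⟩ := hasFDerivAt_integral_angle isOpen_interior (h.contDiffOn_fluxIntegrand i) hx
    0 (2 * Real.pi)
  refine ⟨hL.differentiableAt, ?_⟩
  rw [pd, show fderiv ℝ (flux g M u i) x = L from hL.fderiv]
  exact hL' _

lemma continuousOn_fderiv_fluxIntegrand (i : Fin 2) (ξ : Plane × ℝ) :
    ContinuousOn (fun q => fderiv ℝ (fluxIntegrand g M u i) q ξ) (interior M ×ˢ Set.univ) :=
  ((h.contDiffOn_fluxIntegrand i).continuousOn_fderiv_of_isOpen (isOpen_interior.prod isOpen_univ)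
    le_rfl).clm_apply continuousOn_const

lemma continuousOn_pd_flux (i j : Fin 2) : ContinuousOn (pd j (flux g M u i)) (interior M) :=
  (continuousOn_integral_angle (h.continuousOn_fderiv_fluxIntegrand i (basisVec j, 0)) 0
    (2 * Real.pi)).congr fun _ hx => (h.pd_flux i j hx).2

lemma contDiffOn_homExt_X : ContDiffOn ℝ 1 (homExt g (X g M u)) (interior M ×ˢ {0}ᶜ) := by
  exact_mod_cast Pestov.contDiffOn_homExt_X (k := 1) h.metric h.isOpen h.subset
    (by norm_num; exact h.contDiffOn_interior)

lemma contDiffOn_homExt_V : ContDiffOn ℝ 1 (homExt g (V g M u)) (interior M ×ˢ {0}ᶜ) := by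
  exact_mod_cast Pestov.contDiffOn_homExt_V (k := 1) h.metric h.subset
    (by norm_num; exact h.contDiffOn_interior)

lemma continuousOn_homExt_VX :
    ContinuousOn (homExt g (V g M (X g M u))) (interior M ×ˢ {0}ᶜ) :=
  (Pestov.contDiffOn_homExt_V (k := 0) h.metric h.subset
    (by norm_num; exact h.contDiffOn_homExt_X)).continuousOn

lemma continuousOn_homExt_XV :
    ContinuousOn (homExt g (X g M (V g M u))) (interior M ×ˢ {0}ᶜ) :=
  (Pestov.contDiffOn_homExt_X (k := 0) h.metric h.isOpen h.subset
    (by norm_num; exact h.contDiffOn_homExt_V)).continuousOn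

lemma continuousOn_comp_angleParam {f : Plane × Plane → ℝ}
    (hf : ContinuousOn (homExt g f) (interior M ×ˢ {0}ᶜ)) :
    ContinuousOn (fun q => f (angleParam g q)) (interior M ×ˢ Set.univ) :=
  (contDiffOn_comp_angleParam (k := 0) h.metric h.subset
    (contDiffOn_zero.mpr hf)).continuousOn

/-- The pointwise quantity in the Pestov identity. -/
lemma fderiv_fluxIntegrand_sum {q : Plane × ℝ} (hq : q.1 ∈ interior M) :
    ∑ i : Fin 2, fderiv ℝ (fluxIntegrand g M u i) q (basisVec i, 0) =
      Real.sqrt (g q.1).det * (V g M (X g M u) (angleParam g q) ^ 2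
        - X g M (V g M u) (angleParam g q) ^ 2 - X g M u (angleParam g q) ^ 2
        + gaussCurvature g q.1 * V g M u (angleParam g q) ^ 2)
      + fderiv ℝ (fun p : Plane × ℝ => Real.sqrt (g p.1).det *
        (connForm g p.1 (angVec g p) * (horDeriv g M u (angleParam g p) (angPerp g p)
            * V g M u (angleParam g p))
          - connForm g p.1 (angPerp g p) * (X g M u (angleParam g p) * V g M u (angleParam g p))
          - X g M u (angleParam g p) * horDeriv g M u (angleParam g p) (angPerp g p))) q (0, 1) := by
  have hqD := h.subset (interior_subset hq)
  have hu1 := h.contDiffOn_interior_one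
  have hX1 := h.contDiffOn_homExt_X
  have hV1 := h.contDiffOn_homExt_V
  have hu : ContDiffAt ℝ 2 (fun q => u (angleParam g q)) q :=
    (contDiffOn_comp_angleParam (k := 2) h.metric h.subset
      (by exact_mod_cast h.contDiffOn_interior)).contDiffAt (nhds_prod_univ isOpen_interior hq)
  have hmain := pestov_divergence h.metric h.isOpen hqD hu rfl rfl rfl
  have hnear : ∀ᶠ p : Plane × ℝ in nhds q, p.1 ∈ interior M := by
    filter_upwards [nhds_prod_univ isOpen_interior hq] with p hp using hp.1
  have ha : ∀ p : Plane × ℝ, p.1 ∈ interior M →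
      X g M u (angleParam g p) = fderiv ℝ (fun q => u (angleParam g q)) p (geoField g p) :=
    fun p hp => X_angleParam h.metric h.isOpen h.subset hu1 hp
  have ha' : ∀ p : Plane × ℝ, p.1 ∈ interior M → horDeriv g M u (angleParam g p) (angVec g p)
      = fderiv ℝ (fun q => u (angleParam g q)) p (geoField g p) := ha
  have hb : ∀ p : Plane × ℝ, p.1 ∈ interior M → horDeriv g M u (angleParam g p) (angPerp g p)
      = fderiv ℝ (fun q => u (angleParam g q)) p (perpField g p) :=
    fun p hp => horDeriv_angleParam h.metric h.isOpen h.subset hu1 hp _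
  have hc : ∀ p : Plane × ℝ, p.1 ∈ interior M →
      V g M u (angleParam g p) = fderiv ℝ (fun q => u (angleParam g q)) p (0, 1) :=
    fun p hp => V_angleParam h.metric h.isOpen h.subset hu1 hp
  rw [V_angleParam h.metric h.isOpen h.subset hX1 hq, X_angleParam h.metric h.isOpen h.subset hV1 hq,
    ha q hq, hc q hq]
  rw [Filter.EventuallyEq.fderiv_eq (f₁ := fun p => X g M u (angleParam g p)) (hnear.mono ha),
    Filter.EventuallyEq.fderiv_eq (f₁ := fun p => V g M u (angleParam g p)) (hnear.mono hc)]
  refine Eq.trans (Finset.sum_congr rfl fun i _ => ?_) (hmain.trans (congrArg₂ (· + ·) rfl ?_))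
  · congr 1
    refine Filter.EventuallyEq.fderiv_eq (hnear.mono fun p hp => ?_)
    simp only [fluxIntegrand, ha' p hp, hb p hp, hc p hp]
  · congr 1
    refine Filter.EventuallyEq.fderiv_eq (hnear.mono fun p hp => ?_)
    simp only [ha p hp, hb p hp, hc p hp]

lemma continuousOn_gaussCurvature : ContinuousOn (gaussCurvature g) D := by
  have hc := fun l i j => contDiffOn_christoffel h.metric h.isOpen l i j
  have hR : ∀ i j k l, ContinuousOn (curvatureTensor g i j k l) D := fun i j k l => by
    have hs : ContDiffOn ℝ ∞ (fun x => ∑ m, (christoffel g l i m x * christoffel g m j k x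
        - christoffel g l j m x * christoffel g m i k x)) D :=
      ContDiffOn.sum (𝕜 := ℝ) fun m _ => ((hc l i m).mul (hc m j k)).sub ((hc l j m).mul (hc m i k))
    exact (((contDiffOn_pd h.isOpen (hc l j k) i).sub
      (contDiffOn_pd h.isOpen (hc l i k) j)).add hs).continuousOn
  unfold gaussCurvature
  refine ContinuousOn.div ?_ (contDiffOn_det h.metric).continuousOn fun x hx =>
    (h.metric.det_pos hx).ne'
  simp only [Fin.sum_univ_two]
  exact ((h.metric.smooth 0 0).continuousOn.mul (hR 0 1 1 0)).add
    ((h.metric.smooth 0 1).continuousOn.mul (hR 0 1 1 1))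

lemma divergence_flux (hx : x ∈ interior M) :
    pd 0 (flux g M u 0) x + pd 1 (flux g M u 1) x = Real.sqrt (g x).det *
      ∫ θ in (0)..(2 * Real.pi), (V g M (X g M u) (angleParam g (x, θ)) ^ 2
        - X g M (V g M u) (angleParam g (x, θ)) ^ 2 - X g M u (angleParam g (x, θ)) ^ 2
        + gaussCurvature g x * V g M u (angleParam g (x, θ)) ^ 2) := by
  set G : Plane × ℝ → ℝ := fun p => Real.sqrt (g p.1).det *
        (connForm g p.1 (angVec g p) * (horDeriv g M u (angleParam g p) (angPerp g p)
            * V g M u (angleParam g p))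
          - connForm g p.1 (angPerp g p) * (X g M u (angleParam g p) * V g M u (angleParam g p))
          - X g M u (angleParam g p) * horDeriv g M u (angleParam g p) (angPerp g p)) with hG
  have hGc : ContDiffOn ℝ 1 G (interior M ×ˢ Set.univ) := by
    have hs : ContDiffOn ℝ 1 (fun q : Plane × ℝ => Real.sqrt (g q.1).det)
        (interior M ×ˢ Set.univ) :=
      ((contDiffOn_sqrt_det h.metric).of_le (by simp)).comp contDiffOn_fst
        fun q hq => h.subset (interior_subset hq.1)
    have hl : ∀ {P : Plane × ℝ → Plane}, ContDiffOn ℝ ∞ P (D ×ˢ Set.univ) →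
        ContDiffOn ℝ 1 (fun q => connForm g q.1 (P q)) (interior M ×ˢ Set.univ) := by
      intro P hP
      have := (contDiffOn_horLift (n := 1) h.metric h.isOpen h.interior_prod_subset
        ((hP.mono h.interior_prod_subset).of_le (by simp))).snd.neg
      simpa [horLift] using this
    exact hs.mul ((((hl (contDiffOn_angVec h.metric)).mul (h.contDiffOn_horDeriv_perp.mul h.contDiffOn_V)).sub
      ((hl (contDiffOn_angPerp h.metric)).mul (h.contDiffOn_X.mul h.contDiffOn_V))).sub
      (h.contDiffOn_X.mul h.contDiffOn_horDeriv_perp))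
  have hG' : ContinuousOn (fun q => fderiv ℝ G q (0, 1)) (interior M ×ˢ Set.univ) :=
    (hGc.continuousOn_fderiv_of_isOpen (isOpen_interior.prod isOpen_univ)
      le_rfl).clm_apply continuousOn_const
  have hGint : ∫ θ in (0)..(2 * Real.pi), fderiv ℝ G (x, θ) (0, 1) = 0 := by
    have hd : ∀ θ : ℝ, HasDerivAt (fun θ => G (x, θ)) (fderiv ℝ G (x, θ) (0, 1)) θ := fun θ =>
      (((hGc.contDiffAt (nhds_prod_univ isOpen_interior (q := (x, θ)) hx)).differentiableAt
        (by norm_num)).hasFDerivAt).comp_hasDerivAt θ ((hasDerivAt_const θ x).prodMk (hasDerivAt_id θ))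
    rw [intervalIntegral.integral_eq_sub_of_hasDerivAt (fun θ _ => hd θ)
      ((continuous_section hG' hx).intervalIntegrable _ _)]
    have e := angleParam_two_pi g x
    have e1 : angVec g (x, 2 * Real.pi) = angVec g (x, 0) := congrArg Prod.snd e
    have e2 : angPerp g (x, 2 * Real.pi) = angPerp g (x, 0) := congrArg (perp g x) e1
    simp only [hG, e, e1, e2, sub_self]
  have hP : ContinuousOn (fun q : Plane × ℝ => V g M (X g M u) (angleParam g q) ^ 2
        - X g M (V g M u) (angleParam g q) ^ 2 - X g M u (angleParam g q) ^ 2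
        + gaussCurvature g q.1 * V g M u (angleParam g q) ^ 2) (interior M ×ˢ Set.univ) :=
    ((((h.continuousOn_comp_angleParam h.continuousOn_homExt_VX).pow 2).sub
      ((h.continuousOn_comp_angleParam h.continuousOn_homExt_XV).pow 2)).sub
      (h.contDiffOn_X.continuousOn.pow 2)).add
      ((h.continuousOn_gaussCurvature.comp continuousOn_fst
        fun q hq => h.subset (interior_subset hq.1)).mul (h.contDiffOn_V.continuousOn.pow 2))
  have hF := fun i j : Fin 2 => (continuous_section
    (h.continuousOn_fderiv_fluxIntegrand i (basisVec j, 0)) hx).intervalIntegrable 0 (2 * Real.pi)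
      (μ := volume)
  rw [(h.pd_flux 0 0 hx).2, (h.pd_flux 1 1 hx).2, ← intervalIntegral.integral_add (hF 0 0) (hF 1 1)]
  have hsum : ∀ θ : ℝ, _ := fun θ => h.fderiv_fluxIntegrand_sum (q := (x, θ)) hx
  simp only [Fin.sum_univ_two] at hsum
  simp only [hsum]
  rw [intervalIntegral.integral_add, hGint, add_zero, intervalIntegral.integral_const_mul]
  · exact ((continuous_section hP hx).const_mul _ |>.intervalIntegrable _ _)
  · exact (continuous_section hG' hx).intervalIntegrable _ _

end IsAdmissible

end Pestov
end

noncomputable section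

namespace Pestov

variable {g : MetricField} {D M R : Set Plane} {x y : Plane}

/-- Through every boundary point there is a curve in the boundary with velocity `T`. -/
lemma IsCompactSmoothDomain.exists_boundary_curve (hM : IsCompactSmoothDomain M)
    (hg : IsRiemannianMetricOn g D) (hMD : M ⊆ D) (hx : x ∈ frontier M) :
    ∃ γ : ℝ → Plane, γ 0 = x ∧ HasDerivAt γ (bdryTangent g M x) 0 ∧
      ∀ᶠ s in nhds (0 : ℝ), γ s ∈ frontier M := by
  obtain ⟨ch⟩ := hM.exists_graphChart hx
  have h0 : (0 : ℝ) ∈ Set.Ioo (-ch.a) ch.a := ⟨by simpa using ch.a_pos, ch.a_pos⟩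
  have hT := ch.bdryTangent_map hM hg hMD h0
  rw [ch.map_zero] at hT
  set k := (gnorm g x (ch.velocity 0))⁻¹ with hk
  have hlin : HasDerivAt (fun s : ℝ => k * s) k 0 := by
    simpa using (hasDerivAt_id (0 : ℝ)).const_mul k
  refine ⟨fun s => ch.map (k * s, 0), by simp [ch.map_zero], ?_, ?_⟩
  · rw [hT]
    have hc : HasDerivAt (fun s => ch.map (s, 0)) (ch.velocity 0) (k * 0) := by
      simpa using ch.hasDerivAt_curve 0 0
    exact HasDerivAt.scomp (h := fun s => k * s) (g₁ := fun s => ch.map (s, 0)) (0 : ℝ) hc hlin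
  · have hev : ∀ᶠ s in nhds (0 : ℝ), k * s ∈ Set.Ioo (-ch.a) ch.a := by
      refine (by fun_prop : ContinuousAt (fun s : ℝ => k * s) 0).eventually ?_
      simp only [mul_zero]
      exact isOpen_Ioo.mem_nhds h0
    filter_upwards [hev] with s hs
    exact (ch.map_mem_frontier_iff hM.isCompact.isClosed
      ⟨hs, by simpa using ch.h_pos, ch.h_pos⟩).mpr rfl

/-- The covariant derivative of an orthonormal frame. -/
lemma covDeriv_frame (hg : IsRiemannianMetricOn g D) (hD : IsOpen D) {U : Set Plane}
    (hU : IsOpen U) (hUD : U ⊆ D) (hx : x ∈ U) {P : Plane → Plane} (hP : ContDiffOn ℝ ∞ P U)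
    (h1 : ∀ y ∈ U, ip g y (P y) (P y) = 1) (a : Plane) :
    fderiv ℝ P x a + christoffelVec g x a (P x) =
        ip g x (fderiv ℝ P x a + christoffelVec g x a (P x)) (perp g x (P x)) • perp g x (P x) ∧
    fderiv ℝ (fun y => perp g y (P y)) x a + christoffelVec g x a (perp g x (P x)) =
        -ip g x (fderiv ℝ P x a + christoffelVec g x a (P x)) (perp g x (P x)) • P x := by
  have hxD := hUD hx
  have hP' : HasFDerivAt P (fderiv ℝ P x) x :=
    ((hP.contDiffAt (hU.mem_nhds hx)).differentiableAt (by simp)).hasFDerivAt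
  have hN' : HasFDerivAt (fun y => perp g y (P y)) (fderiv ℝ (fun y => perp g y (P y)) x) x :=
    (((contDiffOn_perp hg hUD hP).contDiffAt (hU.mem_nhds hx)).differentiableAt
      (by simp)).hasFDerivAt
  set A := fderiv ℝ P x a + christoffelVec g x a (P x)
  set B := fderiv ℝ (fun y => perp g y (P y)) x a + christoffelVec g x a (perp g x (P x))
  have e1 : ip g x A (P x) + ip g x (P x) A = 0 := by
    rw [← fderiv_ip hg hD hxD hP' hP' a]
    exact fderiv_eq_zero_of_const_on hU hx h1 a
  have e2 : ip g x A (perp g x (P x)) + ip g x (P x) B = 0 := by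
    rw [← fderiv_ip hg hD hxD hP' hN' a]
    exact fderiv_eq_zero_of_const_on hU hx (fun y hy => ip_self_perp hg (hUD hy) _) a
  have e3 : ip g x B (perp g x (P x)) + ip g x (perp g x (P x)) B = 0 := by
    rw [← fderiv_ip hg hD hxD hN' hN' a]
    exact fderiv_eq_zero_of_const_on hU hx
      (fun y hy => (ip_perp_perp hg (hUD hy) _ _).trans (h1 y hy)) a
  rw [ip_comm' hg hxD (P x) A] at e1
  rw [ip_comm' hg hxD (P x) B] at e2
  rw [ip_comm' hg hxD (perp g x (P x)) B] at e3
  constructor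
  · conv_lhs => rw [eq_ip_smul_add hg hxD (h1 x hx) A]
    rw [show ip g x A (P x) = 0 by linarith, zero_smul, zero_add]
  · conv_lhs => rw [eq_ip_smul_add hg hxD (h1 x hx) B]
    rw [show ip g x B (perp g x (P x)) = 0 by linarith, zero_smul, add_zero,
      show ip g x B (P x) = -ip g x A (perp g x (P x)) by linarith]

lemma signedCurvature_eq (hM : IsCompactSmoothDomain M) (hg : IsRiemannianMetricOn g D)
    (hMD : M ⊆ D) {U : Set Plane} (hU : IsOpen U) {P : Plane → Plane} (hP : ContDiffOn ℝ ∞ P U)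
    (hT : ∀ y ∈ frontier M ∩ U, bdryTangent g M y = P y ∧ outerNormal g M y = -perp g y (P y))
    (hx : x ∈ frontier M ∩ U) : signedCurvature g M x =
      ip g x (fderiv ℝ P x (P x) + christoffelVec g x (P x) (P x)) (perp g x (P x)) := by
  have hP' : HasFDerivAt P (fderiv ℝ P x) x :=
    ((hP.contDiffAt (hU.mem_nhds hx.2)).differentiableAt (by simp)).hasFDerivAt
  obtain ⟨γ, hγ0, hγ, hγM⟩ := hM.exists_boundary_curve hg hMD hx.1
  have hTP : bdryTangent g M =ᶠ[nhdsWithin x (frontier M)] P := by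
    filter_upwards [self_mem_nhdsWithin, mem_nhdsWithin_of_mem_nhds (hU.mem_nhds hx.2)] with y h1 h2
    exact (hT y ⟨h1, h2⟩).1
  have hd : DifferentiableWithinAt ℝ (bdryTangent g M) (frontier M) x :=
    hP'.differentiableAt.differentiableWithinAt.congr_of_eventuallyEq hTP (hT x hx).1
  have d1 := hd.hasFDerivWithinAt.comp_hasDerivAt_of_eq 0 hγ hγM hγ0.symm
  have d2 : HasDerivAt (P ∘ γ) (fderiv ℝ P x (bdryTangent g M x)) 0 :=
    HasFDerivAt.comp_hasDerivAt_of_eq 0 hP' hγ hγ0.symm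
  have hev : P ∘ γ =ᶠ[nhds 0] bdryTangent g M ∘ γ := by
    have hγU : ∀ᶠ s in nhds (0 : ℝ), γ s ∈ U :=
      hγ.continuousAt.eventually (by rw [hγ0]; exact hU.mem_nhds hx.2)
    filter_upwards [hγM, hγU] with s h1 h2
    exact (hT _ ⟨h1, h2⟩).1.symm
  have hkey := (d1.congr_of_eventuallyEq hev).unique d2
  rw [signedCurvature, hkey, (hT x hx).1, (hT x hx).2, ip_neg_right, neg_neg]

lemma IsCompactSmoothDomain.continuousOn_signedCurvature (hM : IsCompactSmoothDomain M)
    (hD : IsOpen D) (hg : IsRiemannianMetricOn g D) (hMD : M ⊆ D) :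
    ContinuousOn (signedCurvature g M) (frontier M) := by
  intro x hx
  obtain ⟨U, P, hU, hxU, hUD, hP, -, hT⟩ := hM.exists_tangent hD hg hMD hx
  have h1 : ContDiffOn ℝ ∞ (fun y => fderiv ℝ P y (P y)) U :=
    (hP.fderiv_of_isOpen hU (m := ∞) (by simp)).clm_apply hP
  have hc := (contDiffOn_ip hg hUD (h1.add (contDiffOn_christoffelVec hg hD hUD hP hP))
    (contDiffOn_perp hg hUD hP)).continuousOn.continuousAt (hU.mem_nhds hxU)
  refine hc.continuousWithinAt.congr_of_eventuallyEq ?_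
    (signedCurvature_eq hM hg hMD hU hP hT ⟨hx, hxU⟩)
  filter_upwards [self_mem_nhdsWithin, mem_nhdsWithin_of_mem_nhds (hU.mem_nhds hxU)] with y h1 h2
  exact signedCurvature_eq hM hg hMD hU hP hT ⟨h1, h2⟩

lemma perp_unitVec (hg : IsRiemannianMetricOn g D) (hx : x ∈ D) (α : ℝ) :
    perp g x (unitVec g x α) = -Real.sin α • frameE g x + Real.cos α • frameF g x :=
  angPerp_eq hg (q := (x, α)) hx

lemma unitVec_add (hg : IsRiemannianMetricOn g D) (hx : x ∈ D) (φ α : ℝ) :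
    unitVec g x (φ + α) =
      Real.cos φ • unitVec g x α + Real.sin φ • perp g x (unitVec g x α) := by
  rw [perp_unitVec hg hx, unitVec_eq, unitVec_eq, Real.cos_add, Real.sin_add]
  module

/-- An integral over a period vanishes if the integrand is odd about some point. -/
lemma integral_period_eq_zero {F : ℝ → ℝ} (hF : Function.Periodic F (2 * Real.pi)) (α : ℝ)
    (hodd : ∀ᵐ φ, F (-φ + α) = -F (φ + α)) : ∫ θ in (0)..(2 * Real.pi), F θ = 0 := by
  have h1 : ∫ θ in (0)..(2 * Real.pi), F θ = ∫ φ in (-Real.pi)..Real.pi, F (φ + α) := by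
    rw [intervalIntegral.integral_comp_add_right (fun θ => F θ) α]
    have := hF.intervalIntegral_add_eq 0 (-Real.pi + α)
    rw [zero_add] at this
    rw [this]
    congr 1
    ring
  have h2 := intervalIntegral.integral_comp_neg (a := -Real.pi) (b := Real.pi) fun φ => F (φ + α)
  rw [neg_neg] at h2
  have h3 : ∫ φ in (-Real.pi)..Real.pi, F (-φ + α) = ∫ φ in (-Real.pi)..Real.pi, -F (φ + α) :=
    intervalIntegral.integral_congr_ae (hodd.mono fun φ hφ _ => hφ)
  rw [intervalIntegral.integral_neg] at h3
  linarith

namespace IsAdmissible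

variable {u : Plane × Plane → ℝ} (h : IsAdmissible g D M R u)
include h

/-- `Vu` is the derivative along the fibre. -/
lemma hasDerivAt_angle {θ : ℝ} (hq : (x, θ) ∈ regularSet g M R) :
    HasDerivAt (fun θ => u (angleParam g (x, θ))) (V g M u (angleParam g (x, θ))) θ := by
  have hxM : x ∈ M := hq.1
  have hxD := h.subset hxM
  have hmem := h.mapsTo_angleParam hq
  have hd : HasDerivAt (fun θ => angleParam g (x, θ)) (0, angPerp g (x, θ)) θ := by
    have h1 := (hasFDerivAt_angVec h.metric h.isOpen (q := (x, θ)) hxD).comp_hasDerivAt θ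
      ((hasDerivAt_const θ x).prodMk (hasDerivAt_id θ))
    rw [fderiv_angVec h.metric h.isOpen hxD] at h1
    have h0 : christoffelVec g x 0 (angVec g (x, θ)) = 0 := by
      simpa using christoffelVec_smul_left g x 0 0 (angVec g (x, θ))
    simp only [h0, connForm_zero, neg_zero, zero_add, one_smul] at h1
    exact (hasDerivAt_const θ x).prodMk h1
  have hslit : ∀ θ, angleParam g (x, θ) ∈ slitTangent M := fun θ =>
    ⟨hxM, ne_zero_of_unit (ip_unitVec h.metric hxD θ)⟩
  have h1 := (h.hasFDerivWithinAt hmem.1 hmem.2).comp_hasDerivAt θ hd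
    (Filter.Eventually.of_forall hslit)
  refine h1.congr_of_eventuallyEq (Filter.Eventually.of_forall fun θ => ?_)
  exact (homExt_angleParam h.metric (q := (x, θ)) hxD).symm

/-- The derivative of `u` along the boundary, for vectors that make a constant angle with the
boundary. -/
lemma hasDerivAt_boundary {U : Set Plane} (hU : IsOpen U) (hUD : U ⊆ D) {P : Plane → Plane}
    (hP : ContDiffOn ℝ ∞ P U) (h1 : ∀ y ∈ U, ip g y (P y) (P y) = 1)
    (hT : ∀ y ∈ frontier M ∩ U, bdryTangent g M y = P y ∧ outerNormal g M y = -perp g y (P y))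
    (hx : x ∈ frontier M ∩ U) {γ : ℝ → Plane} (hγ0 : γ 0 = x)
    (hγ : HasDerivAt γ (bdryTangent g M x) 0) (hγM : ∀ᶠ s in nhds (0 : ℝ), γ s ∈ frontier M)
    (φ : ℝ) {p : Plane × Plane} (hp : p = (x, Real.cos φ • P x + Real.sin φ • perp g x (P x)))
    (hpR : p ∉ tangentialPart g M R) :
    HasDerivAt (fun s => u (γ s, Real.cos φ • P (γ s) + Real.sin φ • perp g (γ s) (P (γ s))))
      (horDeriv g M u p (bdryTangent g M x) + signedCurvature g M x * V g M u p) 0 := by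
  have hxD := hUD hx.2
  have hP' : HasFDerivAt P (fderiv ℝ P x) x :=
    ((hP.contDiffAt (hU.mem_nhds hx.2)).differentiableAt (by simp)).hasFDerivAt
  have hN' : HasFDerivAt (fun y => perp g y (P y)) (fderiv ℝ (fun y => perp g y (P y)) x) x :=
    (((contDiffOn_perp h.metric hUD hP).contDiffAt (hU.mem_nhds hx.2)).differentiableAt
      (by simp)).hasFDerivAt
  have hunit : ∀ y ∈ U, ip g y (Real.cos φ • P y + Real.sin φ • perp g y (P y))
      (Real.cos φ • P y + Real.sin φ • perp g y (P y)) = 1 := fun y hy => by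
    have hyD := hUD hy
    simp only [ip_add_left, ip_add_right, ip_smul_left, ip_smul_right, ip_perp_perp h.metric hyD,
      ip_self_perp h.metric hyD, ip_comm' h.metric hyD (perp g y (P y)) (P y), h1 y hy]
    linear_combination Real.sin_sq_add_cos_sq φ
  have hpS : ip g p.1 p.2 p.2 = 1 := by rw [hp]; exact hunit x hx.2
  have hpM : p ∈ slitTangent M := ⟨by rw [hp]; exact h.frontier_subset hx.1, ne_zero_of_unit hpS⟩
  have hγU : ∀ᶠ s in nhds (0 : ℝ), γ s ∈ U :=
    hγ.continuousAt.eventually (by rw [hγ0]; exact hU.mem_nhds hx.2)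
  have dP : HasDerivAt (fun s => P (γ s)) (fderiv ℝ P x (bdryTangent g M x)) 0 :=
    HasFDerivAt.comp_hasDerivAt_of_eq 0 hP' hγ hγ0.symm
  have dN : HasDerivAt (fun s => perp g (γ s) (P (γ s)))
      (fderiv ℝ (fun y => perp g y (P y)) x (bdryTangent g M x)) 0 :=
    HasFDerivAt.comp_hasDerivAt_of_eq (l := fun y => perp g y (P y)) 0 hN' hγ hγ0.symm
  have dZ := hγ.prodMk ((dP.const_smul (Real.cos φ)).add (dN.const_smul (Real.sin φ)))
  have hfd := h.hasFDerivWithinAt hpM (by rwa [toUnit_of_unit hpS])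
  have hd := hfd.comp_hasDerivAt_of_eq 0 dZ (by
    filter_upwards [hγM, hγU] with s hs hsU
    exact ⟨h.frontier_subset hs, ne_zero_of_unit (hunit _ hsU)⟩) (by simp [hp, hγ0])
  have hval : dSM g M u p (bdryTangent g M x,
      Real.cos φ • fderiv ℝ P x (bdryTangent g M x)
        + Real.sin φ • fderiv ℝ (fun y => perp g y (P y)) x (bdryTangent g M x))
      = horDeriv g M u p (bdryTangent g M x) + signedCurvature g M x * V g M u p := by
    rw [horDeriv, V, ← smul_eq_mul, ← (dSM g M u p).map_smul, ← (dSM g M u p).map_add]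
    congr 1
    obtain ⟨c1, c2⟩ := covDeriv_frame h.metric h.isOpen hU hUD hx.2 hP h1 (bdryTangent g M x)
    rw [signedCurvature_eq h.domain h.metric h.subset hU hP hT hx, (hT x hx).1]
    rw [(hT x hx).1] at c1 c2
    set k := ip g x (fderiv ℝ P x (P x) + christoffelVec g x (P x) (P x)) (perp g x (P x))
    rw [← eq_sub_iff_add_eq] at c1 c2
    rw [c1, c2, hp]
    ext1
    · simp
    · simp only [Prod.snd_add, Prod.smul_snd, christoffelVec_add_right, christoffelVec_smul_right,
        perp_add, perp_smul, perp_perp h.metric hxD]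
      module
  rw [hval] at hd
  refine hd.congr_of_eventuallyEq ?_
  filter_upwards [hγU] with s hs
  exact (homExt_of_unit (hunit _ hs)).symm

end IsAdmissible

end Pestov
end

noncomputable section

namespace Pestov

variable {g : MetricField} {D M R : Set Plane} {x y : Plane}

lemma ae_sin_ne_zero : ∀ᵐ φ : ℝ, Real.sin φ ≠ 0 := by
  rw [ae_iff]
  refine Set.Countable.measure_zero ?_ _
  refine (countable_cos_eq_zero.preimage (f := fun φ => φ - Real.pi / 2)
    (sub_left_injective)).mono fun φ hφ => ?_
  simpa [Real.cos_sub_pi_div_two] using hφ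

/-- In a frame `P, P^⊥` with `ν = -P^⊥`, reflection reverses the angle. -/
lemma reflection_frame (hg : IsRiemannianMetricOn g D) (hy : y ∈ D) {P : Plane}
    (h1 : ip g y P P = 1) (hν : outerNormal g M y = -perp g y P) (φ : ℝ) :
    reflection g M (y, Real.cos φ • P + Real.sin φ • perp g y P) =
      (y, Real.cos (-φ) • P + Real.sin (-φ) • perp g y P) := by
  have : ip g y (Real.cos φ • P + Real.sin φ • perp g y P) (perp g y P) = Real.sin φ := by
    rw [ip_add_left, ip_smul_left, ip_smul_left, ip_self_perp hg hy, ip_perp_perp hg hy, h1]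
    ring
  simp only [reflection, hν, ip_neg_right, this, Real.cos_neg, Real.sin_neg, Prod.mk.injEq, true_and]
  module

namespace IsAdmissible

variable {u : Plane × Plane → ℝ} (h : IsAdmissible g D M R u)
include h

lemma frame_notMem_tangentialPart (hx : x ∈ frontier M) {P : Plane} (h1 : ip g x P P = 1)
    (hν : outerNormal g M x = -perp g x P) {φ : ℝ} (hφ : Real.sin φ ≠ 0) :
    (x, Real.cos φ • P + Real.sin φ • perp g x P) ∉ tangentialPart g M R := by
  have hxD := h.frontier_subset' hx
  intro hcon
  have h2 : ip g x (Real.cos φ • P + Real.sin φ • perp g x P) (outerNormal g M x) = 0 := hcon.2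
  rw [hν, ip_neg_right, ip_add_left, ip_smul_left, ip_smul_left, ip_self_perp h.metric hxD,
    ip_perp_perp h.metric hxD, h1] at h2
  exact hφ (by linarith)

/-- The integral over the fibre of the tangential derivative times the vertical derivative
vanishes, by reflection symmetry. -/
lemma integral_tangential_mul_V (hx : x ∈ frontier M) :
    ∫ θ in (0)..(2 * Real.pi),
      (horDeriv g M u (angleParam g (x, θ)) (bdryTangent g M x)
        + signedCurvature g M x * V g M u (angleParam g (x, θ))) *
      V g M u (angleParam g (x, θ)) = 0 := by
  obtain ⟨U, P, hU, hxU, hUD, hP, h1, hT⟩ :=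
    h.domain.exists_tangent h.isOpen h.metric h.subset hx
  obtain ⟨γ, hγ0, hγ, hγM⟩ := h.domain.exists_boundary_curve h.metric h.subset hx
  have hxD := hUD hxU
  obtain ⟨α, hα⟩ := exists_unitVec h.metric hxD (h1 x hxU)
  have hZ : ∀ φ, angleParam g (x, φ + α) =
      (x, Real.cos φ • P x + Real.sin φ • perp g x (P x)) := fun φ => by
    rw [hα, ← unitVec_add h.metric hxD]; rfl
  have hγU : ∀ᶠ s in nhds (0 : ℝ), γ s ∈ U :=
    hγ.continuousAt.eventually (by rw [hγ0]; exact hU.mem_nhds hxU)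
  have hunit : ∀ y ∈ U, ∀ φ, ip g y (Real.cos φ • P y + Real.sin φ • perp g y (P y))
      (Real.cos φ • P y + Real.sin φ • perp g y (P y)) = 1 := fun y hy φ => by
    have hyD := hUD hy
    simp only [ip_add_left, ip_add_right, ip_smul_left, ip_smul_right, ip_perp_perp h.metric hyD,
      ip_self_perp h.metric hyD, ip_comm' h.metric hyD (perp g y (P y)) (P y), h1 y hy]
    linear_combination Real.sin_sq_add_cos_sq φ
  have hsymm : ∀ y ∈ frontier M ∩ U, ∀ φ,
      u (y, Real.cos φ • P y + Real.sin φ • perp g y (P y)) =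
        u (y, Real.cos (-φ) • P y + Real.sin (-φ) • perp g y (P y)) := fun y hy φ => by
    rw [h.reflection _ ⟨hy.1, hunit y hy.2 φ⟩,
      reflection_frame h.metric (hUD hy.2) (h1 y hy.2) (hT y hy).2]
  have hreg : ∀ φ, Real.sin φ ≠ 0 → angleParam g (x, φ + α) ∉ tangentialPart g M R := fun φ hφ => by
    rw [hZ]
    exact h.frame_notMem_tangentialPart hx (h1 x hxU) (hT x ⟨hx, hxU⟩).2 hφ
  have hreg' : ∀ φ, Real.sin φ ≠ 0 → (x, φ + α) ∈ regularSet g M R := fun φ hφ =>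
    ⟨h.frontier_subset hx, hreg φ hφ⟩
  have hneg : ∀ φ, Real.sin φ ≠ 0 → Real.sin (-φ) ≠ 0 := fun φ hφ => by
    rwa [Real.sin_neg, neg_ne_zero]
  refine integral_period_eq_zero (fun θ => ?_) α ?_
  · have : angleParam g (x, θ + 2 * Real.pi) = angleParam g (x, θ) := by
      have := unitVec_periodic g x θ
      simp only [angleParam, this]
    simp only [this]
  filter_upwards [ae_sin_ne_zero] with φ hφ
  have hE : horDeriv g M u (angleParam g (x, -φ + α)) (bdryTangent g M x)
        + signedCurvature g M x * V g M u (angleParam g (x, -φ + α)) =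
      horDeriv g M u (angleParam g (x, φ + α)) (bdryTangent g M x)
        + signedCurvature g M x * V g M u (angleParam g (x, φ + α)) := by
    have d1 := h.hasDerivAt_boundary hU hUD hP h1 hT ⟨hx, hxU⟩ hγ0 hγ hγM φ (hZ φ) (hreg φ hφ)
    have d2 := h.hasDerivAt_boundary hU hUD hP h1 hT ⟨hx, hxU⟩ hγ0 hγ hγM (-φ) (hZ (-φ))
      (hreg (-φ) (hneg φ hφ))
    refine (d2.congr_of_eventuallyEq ?_).unique d1 |>.symm ▸ rfl
    filter_upwards [hγM, hγU] with s hs hsU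
    exact hsymm _ ⟨hs, hsU⟩ φ
  have hV : V g M u (angleParam g (x, -φ + α)) = -V g M u (angleParam g (x, φ + α)) := by
    have d1 := (h.hasDerivAt_angle (hreg' φ hφ)).comp φ ((hasDerivAt_id φ).add_const α)
    have d2 := (h.hasDerivAt_angle (hreg' (-φ) (hneg φ hφ))).comp φ
      (((hasDerivAt_id φ).neg).add_const α)
    have hev : (fun θ => u (angleParam g (x, θ))) ∘ (fun φ => id φ + α) =
        (fun θ => u (angleParam g (x, θ))) ∘ (fun φ => (-id) φ + α) := by
      funext ψ
      simp only [Function.comp, Pi.neg_apply, id, hZ]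
      exact hsymm x ⟨hx, hxU⟩ ψ
    have := d1.unique (hev ▸ d2)
    linarith
  rw [hE, hV]
  ring

/-- The flux of the field through the boundary. -/
lemma flux_boundary (hx : x ∈ frontier M) :
    flux g M u 0 x * bdryTangent g M x 1 - flux g M u 1 x * bdryTangent g M x 0 =
      -(signedCurvature g M x *
        ∫ θ in (0)..(2 * Real.pi), V g M u (angleParam g (x, θ)) ^ 2) := by
  have hxM := h.frontier_subset hx
  have hxD := h.subset hxM
  set T := bdryTangent g M x with hTdef
  obtain ⟨B0, -, hB0⟩ := h.exists_bound_fluxIntegrand 0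
  obtain ⟨B1, -, hB1⟩ := h.exists_bound_fluxIntegrand 1
  obtain ⟨Bc, hc0, hc⟩ := h.exists_bound_V
  have i0 := h.intervalIntegrable_section (h.continuousOn_fluxIntegrand 0) hB0 hxM
  have i1 := h.intervalIntegrable_section (h.continuousOn_fluxIntegrand 1) hB1 hxM
  have ic := h.intervalIntegrable_section (F := fun q => V g M u (angleParam g q) ^ 2)
    (h.continuousOn_V.pow 2) (B := Bc ^ 2) (fun q hq hq2 => by
      rw [abs_of_nonneg (sq_nonneg _), ← sq_abs]
      exact pow_le_pow_left₀ (abs_nonneg _) (hc q hq hq2) 2) hxM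
  have hpt : ∀ θ : ℝ, fluxIntegrand g M u 0 (x, θ) * T 1 - fluxIntegrand g M u 1 (x, θ) * T 0 =
      (horDeriv g M u (angleParam g (x, θ)) T
        + signedCurvature g M x * V g M u (angleParam g (x, θ))) * V g M u (angleParam g (x, θ))
      - signedCurvature g M x * V g M u (angleParam g (x, θ)) ^ 2 := by
    intro θ
    have hv := ip_angVec h.metric (q := (x, θ)) hxD
    have hcross := cross_perp h.metric hxD (angVec g (x, θ))
    rw [hv, mul_one] at hcross
    have hs := (sqrt_det_pos h.metric hxD).ne'
    have hdec := eq_ip_smul_add h.metric hxD hv T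
    set v := angVec g (x, θ)
    have hw : angPerp g (x, θ) = perp g x v := rfl
    have hcr : Real.sqrt (g x).det * (v 0 * perp g x v 1 - v 1 * perp g x v 0) = 1 := by
      rw [hcross, mul_inv_cancel₀ hs]
    set k := ip g x T v
    set l := ip g x T (perp g x v)
    have hT0 : T 0 = k * v 0 + l * perp g x v 0 := by rw [hdec]; simp
    have hT1 : T 1 = k * v 1 + l * perp g x v 1 := by rw [hdec]; simp
    have hH : horDeriv g M u (angleParam g (x, θ)) T =
        k * horDeriv g M u (angleParam g (x, θ)) v
          + l * horDeriv g M u (angleParam g (x, θ)) (perp g x v) := by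
      rw [hdec, horDeriv_add, horDeriv_smul, horDeriv_smul]
    simp only [fluxIntegrand, hw]
    rw [hH, hT0, hT1]
    linear_combination (k * horDeriv g M u (angleParam g (x, θ)) v
      + l * horDeriv g M u (angleParam g (x, θ)) (perp g x v)) * V g M u (angleParam g (x, θ)) * hcr
  have hi : IntervalIntegrable (fun θ => (horDeriv g M u (angleParam g (x, θ)) T
        + signedCurvature g M x * V g M u (angleParam g (x, θ))) * V g M u (angleParam g (x, θ)))
      volume 0 (2 * Real.pi) := by
    have := ((i0.mul_const (T 1)).sub (i1.mul_const (T 0))).add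
      (ic.const_mul (signedCurvature g M x))
    refine this.congr fun θ _ => ?_
    simp only [hpt]
    ring
  rw [flux, flux, ← intervalIntegral.integral_mul_const, ← intervalIntegral.integral_mul_const,
    ← intervalIntegral.integral_sub (i0.mul_const _) (i1.mul_const _)]
  simp only [hpt]
  rw [intervalIntegral.integral_sub hi (ic.const_mul _), h.integral_tangential_mul_V hx,
    intervalIntegral.integral_const_mul, zero_sub]

end IsAdmissible

end Pestov
end

noncomputable section

namespace Pestov

variable {g : MetricField} {D M R A : Set Plane} {x y : Plane}

/-- The angle measure on a period. -/
def angleMeasure : Measure ℝ := volume.restrict (Set.Ioc 0 (2 * Real.pi))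

instance : IsFiniteMeasure angleMeasure := by
  unfold angleMeasure; infer_instance

lemma integral_angleMeasure (f : ℝ → ℝ) :
    ∫ θ, f θ ∂angleMeasure = ∫ θ in (0)..(2 * Real.pi), f θ := by
  rw [intervalIntegral.integral_of_le (by positivity), angleMeasure]

lemma ae_prod_fst {μ : Measure Plane} {p : Plane → Prop} (hμ : ∀ᵐ x ∂μ, p x) :
    ∀ᵐ q ∂(μ.prod angleMeasure), p q.1 :=
  Measure.quasiMeasurePreserving_fst.ae hμ

lemma ae_prod_angle {μ : Measure Plane} : ∀ᵐ q ∂(μ.prod angleMeasure), q.2 ∈ Set.Ioc 0 (2 * Real.pi) :=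
  Measure.quasiMeasurePreserving_snd.ae (ae_restrict_mem measurableSet_Ioc)

section Concentrated

variable {μ : Measure Plane}

lemma aemeasurable_angleParam (hg : IsRiemannianMetricOn g D) (hA : IsClosed A) (hAD : A ⊆ D)
    (hμ : ∀ᵐ x ∂μ, x ∈ A) : AEMeasurable (angleParam g) (μ.prod angleMeasure) := by
  have hc : ContinuousOn (angleParam g) (A ×ˢ Set.univ) :=
    (contDiffOn_angleParam hg).continuousOn.mono (Set.prod_mono hAD subset_rfl)
  have h1 := hc.aemeasurable (μ := μ.prod angleMeasure) (hA.measurableSet.prod MeasurableSet.univ)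
  rwa [Measure.restrict_eq_self_of_ae_mem] at h1
  filter_upwards [ae_prod_fst hμ] with q hq using ⟨hq, trivial⟩

lemma ae_map_angleParam (hg : IsRiemannianMetricOn g D) (hA : IsClosed A) (hAD : A ⊆ D)
    (hμ : ∀ᵐ x ∂μ, x ∈ A) {s : Set (Plane × Plane)} (hs : MeasurableSet s)
    (h : ∀ᵐ q ∂(μ.prod angleMeasure), angleParam g q ∈ s) :
    ∀ᵐ p ∂((μ.prod angleMeasure).map (angleParam g)), p ∈ s :=
  (ae_map_iff (aemeasurable_angleParam hg hA hAD hμ) hs).mpr h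

lemma aestronglyMeasurable_of_homExt (hg : IsRiemannianMetricOn g D) (hA : IsClosed A) (hAD : A ⊆ D)
    (hμ : ∀ᵐ x ∂μ, x ∈ A) {s : Set (Plane × Plane)} (hs : MeasurableSet s)
    (h : ∀ᵐ q ∂(μ.prod angleMeasure), angleParam g q ∈ s) {f : Plane × Plane → ℝ}
    (hf : ContinuousOn (homExt g f) s) :
    AEStronglyMeasurable f ((μ.prod angleMeasure).map (angleParam g)) := by
  have h1 := hf.aestronglyMeasurable (μ := (μ.prod angleMeasure).map (angleParam g)) hs
  rw [Measure.restrict_eq_self_of_ae_mem (ae_map_angleParam hg hA hAD hμ hs h)] at h1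
  refine h1.congr ?_
  have hcl := isClosed_unitBundle hg hA hAD
  have h2 : ∀ᵐ p ∂((μ.prod angleMeasure).map (angleParam g)), p ∈ unitBundle g A := by
    refine ae_map_angleParam hg hA hAD hμ hcl.measurableSet ?_
    filter_upwards [ae_prod_fst hμ] with q hq
    exact ⟨hq, ip_angVec hg (hAD hq)⟩
  filter_upwards [h2] with p hp
  exact homExt_of_unit hp.2

lemma integral_map_angleParam [IsFiniteMeasure μ] (hg : IsRiemannianMetricOn g D) (hA : IsClosed A) (hAD : A ⊆ D)
    (hμ : ∀ᵐ x ∂μ, x ∈ A) {f : Plane × Plane → ℝ}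
    (hf : Integrable f ((μ.prod angleMeasure).map (angleParam g))) :
    Integrable (fun x => ∫ θ in (0)..(2 * Real.pi), f (angleParam g (x, θ))) μ ∧
    ∫ p, f p ∂((μ.prod angleMeasure).map (angleParam g)) =
      ∫ x, (∫ θ in (0)..(2 * Real.pi), f (angleParam g (x, θ))) ∂μ := by
  have hZ := aemeasurable_angleParam hg hA hAD hμ
  have h1 : Integrable (f ∘ angleParam g) (μ.prod angleMeasure) :=
    (integrable_map_measure hf.aestronglyMeasurable hZ).mp hf
  rw [integral_map hZ hf.aestronglyMeasurable]
  simp only [← integral_angleMeasure]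
  exact ⟨h1.integral_prod_left, integral_prod _ h1⟩

end Concentrated

lemma volSM_eq (g : MetricField) (M : Set Plane) :
    volSM g M = ((areaMeasure g M).prod angleMeasure).map (angleParam g) := rfl

lemma volBdrySM_eq (g : MetricField) (M : Set Plane) :
    volBdrySM g M = ((lengthMeasure g M).prod angleMeasure).map (angleParam g) := rfl

lemma ae_lengthMeasure (g : MetricField) (M : Set Plane) :
    ∀ᵐ x ∂(lengthMeasure g M), x ∈ frontier M := by
  rw [← lengthMeasure_restrict_frontier]
  exact ae_restrict_mem isClosed_frontier.measurableSet

namespace IsAdmissible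

variable {u : Plane × Plane → ℝ} (h : IsAdmissible g D M R u)
include h

lemma isClosed_domain : IsClosed M := h.domain.isCompact.isClosed

lemma continuousOn_sqrt_det : ContinuousOn (fun x => Real.sqrt (g x).det) M :=
  (contDiffOn_sqrt_det h.metric).continuousOn.mono h.subset

lemma areaMeasure_eq : areaMeasure g M =
    (volume.restrict (interior M)).withDensity fun x => ENNReal.ofReal (Real.sqrt (g x).det) := by
  have : (volume.restrict M : Measure Plane) = volume.restrict (interior M) := by
    refine Measure.restrict_congr_set (Filter.EventuallyEq.symm ?_)
    refine Filter.eventuallyEq_set.mpr ?_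
    have h0 : ∀ᵐ x : Plane, x ∉ frontier M :=
      measure_eq_zero_iff_ae_notMem.mp h.domain.volume_frontier
    filter_upwards [h0] with x hx
    refine ⟨fun hi => interior_subset hi, fun hM => ?_⟩
    by_contra hi
    exact hx ⟨subset_closure hM, hi⟩
  rw [areaMeasure, this]

lemma aemeasurable_density : AEMeasurable (fun x => ENNReal.ofReal (Real.sqrt (g x).det))
    (volume.restrict (interior M)) :=
  ((h.continuousOn_sqrt_det.mono interior_subset).aemeasurable
    isOpen_interior.measurableSet).ennreal_ofReal

lemma integral_areaMeasure (f : Plane → ℝ) :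
    ∫ x, f x ∂(areaMeasure g M) = ∫ x in interior M, Real.sqrt (g x).det * f x := by
  rw [h.areaMeasure_eq, integral_withDensity_eq_integral_toReal_smul₀ h.aemeasurable_density
    (Filter.Eventually.of_forall fun _ => ENNReal.ofReal_lt_top)]
  refine integral_congr_ae (Filter.Eventually.of_forall fun x => ?_)
  simp only [ENNReal.toReal_ofReal (Real.sqrt_nonneg _), smul_eq_mul]

lemma integrable_areaMeasure {f : Plane → ℝ} :
    Integrable f (areaMeasure g M) ↔
      IntegrableOn (fun x => Real.sqrt (g x).det * f x) (interior M) := by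
  rw [h.areaMeasure_eq, integrable_withDensity_iff_integrable_smul₀' h.aemeasurable_density
    (Filter.Eventually.of_forall fun _ => ENNReal.ofReal_lt_top)]
  simp only [ENNReal.toReal_ofReal (Real.sqrt_nonneg _), smul_eq_mul]
  rfl

lemma isFiniteMeasure_areaMeasure : IsFiniteMeasure (areaMeasure g M) :=
  isFiniteMeasure_withDensity_ofReal
    (h.continuousOn_sqrt_det.integrableOn_compact h.domain.isCompact).2

lemma ae_areaMeasure : ∀ᵐ x ∂(areaMeasure g M), x ∈ interior M := by
  rw [h.areaMeasure_eq]
  exact (withDensity_absolutelyContinuous _ _).ae_le (ae_restrict_mem isOpen_interior.measurableSet)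

lemma ae_areaMeasure' : ∀ᵐ x ∂(areaMeasure g M), x ∈ M :=
  h.ae_areaMeasure.mono fun _ hx => interior_subset hx

lemma aestronglyMeasurable_volSM {f : Plane × Plane → ℝ}
    (hf : ContinuousOn (homExt g f) (interior M ×ˢ {0}ᶜ)) :
    AEStronglyMeasurable f (volSM g M) := by
  have := h.isFiniteMeasure_areaMeasure
  refine aestronglyMeasurable_of_homExt h.metric h.isClosed_domain h.subset h.ae_areaMeasure'
    (isOpen_interior_prod M).measurableSet ?_ hf
  filter_upwards [ae_prod_fst h.ae_areaMeasure] with q hq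
  exact angleParam_mem_interior h.metric h.subset hq

lemma memLp_volSM {f : Plane × Plane → ℝ}
    (hf : ContinuousOn (homExt g f) (interior M ×ˢ {0}ᶜ)) {B : ℝ}
    (hB : ∀ q ∈ regularSet g M R, q.2 ∈ Set.Icc 0 (2 * Real.pi) → |f (angleParam g q)| ≤ B) :
    MemLp f 2 (volSM g M) := by
  have := h.isFiniteMeasure_areaMeasure
  have hm := h.aestronglyMeasurable_volSM hf
  have hZ := aemeasurable_angleParam h.metric h.isClosed_domain h.subset h.ae_areaMeasure'
  rw [volSM_eq] at hm ⊢
  refine (memLp_map_measure_iff hm hZ).mpr (MemLp.of_bound (hm.comp_aemeasurable hZ) B ?_)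
  filter_upwards [ae_prod_fst h.ae_areaMeasure, ae_prod_angle] with q hq hq2
  exact hB q (h.mem_interior_regularSet hq) ⟨hq2.1.le, hq2.2⟩

lemma integral_volSM {f : Plane × Plane → ℝ} (hf : Integrable f (volSM g M)) :
    IntegrableOn (fun x => Real.sqrt (g x).det *
      ∫ θ in (0)..(2 * Real.pi), f (angleParam g (x, θ))) (interior M) ∧
    ∫ p, f p ∂(volSM g M) = ∫ x in interior M, Real.sqrt (g x).det *
      ∫ θ in (0)..(2 * Real.pi), f (angleParam g (x, θ)) := by
  have := h.isFiniteMeasure_areaMeasure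
  obtain ⟨h1, h2⟩ := integral_map_angleParam h.metric h.isClosed_domain h.subset h.ae_areaMeasure' hf
  exact ⟨h.integrable_areaMeasure.mp h1, h2.trans (h.integral_areaMeasure _)⟩

lemma integrable_sq_volSM {f : Plane × Plane → ℝ}
    (hf : ContinuousOn (homExt g f) (interior M ×ˢ {0}ᶜ))
    (hi : IntegrableOn (fun x => Real.sqrt (g x).det *
      ∫ θ in (0)..(2 * Real.pi), f (angleParam g (x, θ)) ^ 2) (interior M)) :
    MemLp f 2 (volSM g M) := by
  have := h.isFiniteMeasure_areaMeasure
  have hm := h.aestronglyMeasurable_volSM hf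
  have hZ := aemeasurable_angleParam h.metric h.isClosed_domain h.subset h.ae_areaMeasure'
  rw [volSM_eq] at hm ⊢
  refine (memLp_two_iff_integrable_sq hm).mpr ((integrable_map_measure (hm.pow 2) hZ).mpr
    ((integrable_prod_iff ((hm.pow 2).comp_aemeasurable hZ)).mpr ⟨?_, ?_⟩))
  · filter_upwards [h.ae_areaMeasure] with x hx
    have hc := (continuous_section ((h.continuousOn_comp_angleParam hf).pow 2) hx)
    exact (hc.intervalIntegrable 0 (2 * Real.pi)).1
  · rw [h.integrable_areaMeasure]
    refine hi.congr (Filter.Eventually.of_forall fun x => ?_)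
    simp only [Function.comp, Pi.pow_apply, norm_pow, Real.norm_eq_abs, sq_abs, integral_angleMeasure]

lemma measurableSet_regularSet : MeasurableSet (regularSet g M R) := by
  obtain ⟨O, hO, heq⟩ := continuousOn_iff'.mp h.continuousOn_angleParam _
    h.isClosed_tangentialPart.isOpen_compl
  have : regularSet g M R = O ∩ M ×ˢ Set.univ := by
    rw [← heq]
    ext q
    exact ⟨fun hq => ⟨hq.2, hq.1, trivial⟩, fun hq => ⟨hq.2.1, hq.1⟩⟩
  rw [this]
  exact hO.measurableSet.inter (h.isClosed_domain.measurableSet.prod MeasurableSet.univ)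

lemma ae_regularSet {μ : Measure Plane} [IsFiniteMeasure μ] (hμ : ∀ᵐ x ∂μ, x ∈ M) :
    ∀ᵐ q ∂(μ.prod angleMeasure), q ∈ regularSet g M R := by
  have h1 := (Measure.measure_prod_null (μ := μ) (ν := angleMeasure)
    h.measurableSet_regularSet.compl).mpr ?_
  · exact (measure_eq_zero_iff_ae_notMem.mp h1).mono fun q hq => not_not.mp hq
  · filter_upwards [hμ] with x hx
    exact Measure.absolutelyContinuous_of_le Measure.restrict_le_self
      ((h.countable_tangential hx).measure_zero volume)

lemma continuousOn_homExt_V : ContinuousOn (homExt g (V g M u))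
    {p ∈ slitTangent M | toUnit g p ∉ tangentialPart g M R} := by
  have hsub : slitTangent M ⊆ D ×ˢ {0}ᶜ := fun p hp => ⟨h.subset hp.1, hp.2⟩
  have ht : ContinuousOn (toUnit g) {p ∈ slitTangent M | toUnit g p ∉ tangentialPart g M R} :=
    (contDiffOn_toUnit h.metric).continuousOn.mono fun p hp => hsub hp.1
  have hu : ∀ p ∈ slitTangent M, ip g p.1 (toUnit g p).2 (toUnit g p).2 = 1 := fun p hp =>
    ip_toUnit h.metric (hsub hp).1 hp.2
  have hmaps : Set.MapsTo (toUnit g) {p ∈ slitTangent M | toUnit g p ∉ tangentialPart g M R}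
      {p ∈ slitTangent M | toUnit g p ∉ tangentialPart g M R} := fun p hp =>
    ⟨⟨hp.1.1, ne_zero_of_unit (hu p hp.1)⟩, by
      rw [toUnit_of_unit (p := toUnit g p) (hu p hp.1)]; exact hp.2⟩
  have hw : ContinuousOn (fun p => ((0 : Plane), perp g p.1 p.2))
      {p ∈ slitTangent M | toUnit g p ∉ tangentialPart g M R} :=
    (contDiffOn_verticalField h.metric).continuousOn.mono fun p hp => ⟨(hsub hp.1).1, trivial⟩
  exact (h.continuousOn_dSM.clm_apply hw).comp ht hmaps

lemma memLp_V_volBdrySM : MemLp (V g M u) 2 (volBdrySM g M) := by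
  have := h.domain.isFiniteMeasure_lengthMeasure h.isOpen h.metric h.subset
  have hA := ae_lengthMeasure g M
  have hreg := h.ae_regularSet (hA.mono fun x hx => h.frontier_subset hx)
  have hs : MeasurableSet {p ∈ slitTangent M | toUnit g p ∉ tangentialPart g M R} := by
    obtain ⟨O, hO, heq⟩ := h.exists_isOpen
    rw [heq]
    exact (h.isClosed_domain.measurableSet.prod (measurableSet_singleton _).compl).inter
      hO.measurableSet
  have hm : AEStronglyMeasurable (V g M u) (volBdrySM g M) :=
    aestronglyMeasurable_of_homExt h.metric isClosed_frontier h.frontier_subset' hA hs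
      (hreg.mono fun q hq => h.mapsTo_angleParam hq) h.continuousOn_homExt_V
  have hZ := aemeasurable_angleParam h.metric isClosed_frontier h.frontier_subset' hA
  obtain ⟨B, -, hB⟩ := h.exists_bound_V
  rw [volBdrySM_eq] at hm ⊢
  refine (memLp_map_measure_iff hm hZ).mpr (MemLp.of_bound (hm.comp_aemeasurable hZ) B ?_)
  filter_upwards [hreg, ae_prod_angle] with q hq hq2
  exact hB q hq ⟨hq2.1.le, hq2.2⟩

lemma integral_curvature_volBdrySM :
    ∫ p, signedCurvature g M p.1 * V g M u p * V g M u p ∂(volBdrySM g M) =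
      ∫ x, signedCurvature g M x * (∫ θ in (0)..(2 * Real.pi), V g M u (angleParam g (x, θ)) ^ 2)
        ∂(lengthMeasure g M) := by
  have := h.domain.isFiniteMeasure_lengthMeasure h.isOpen h.metric h.subset
  have hA := ae_lengthMeasure g M
  have hZ := aemeasurable_angleParam h.metric isClosed_frontier h.frontier_subset' hA
  have hκ := h.domain.continuousOn_signedCurvature h.isOpen h.metric h.subset
  have hfr : ∀ᵐ p ∂(volBdrySM g M), p ∈ frontier M ×ˢ (Set.univ : Set Plane) := by
    refine ae_map_angleParam h.metric isClosed_frontier h.frontier_subset' hA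
      (isClosed_frontier.measurableSet.prod MeasurableSet.univ) ?_
    filter_upwards [ae_prod_fst hA] with q hq using ⟨hq, trivial⟩
  have hκm : AEStronglyMeasurable (fun p : Plane × Plane => signedCurvature g M p.1)
      (volBdrySM g M) := by
    have h1 : ContinuousOn (fun p : Plane × Plane => signedCurvature g M p.1)
      (frontier M ×ˢ Set.univ) := hκ.comp continuousOn_fst fun p hp => hp.1
    have h2 := h1.aestronglyMeasurable (μ := volBdrySM g M)
      (isClosed_frontier.measurableSet.prod MeasurableSet.univ)
    rwa [Measure.restrict_eq_self_of_ae_mem hfr] at h2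
  obtain ⟨B, hB⟩ := h.domain.isCompact_frontier.exists_bound_of_continuousOn hκ
  have hi : Integrable (fun p => signedCurvature g M p.1 * V g M u p * V g M u p)
      (volBdrySM g M) := by
    refine (h.memLp_V_volBdrySM.integrable_sq.bdd_mul hκm (c := B) ?_).congr ?_
    · filter_upwards [hfr] with p hp using hB _ hp.1
    · exact Filter.Eventually.of_forall fun p => by simp only; ring
  rw [volBdrySM_eq,
    (integral_map_angleParam h.metric isClosed_frontier h.frontier_subset' hA hi).2]
  refine integral_congr_ae (Filter.Eventually.of_forall fun x => ?_)
  simp only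
  rw [← intervalIntegral.integral_const_mul]
  refine intervalIntegral.integral_congr fun θ _ => ?_
  simp only [angleParam]
  ring

/-- The Pestov identity for functions invariant under reflection. -/
theorem pestov_identity (hVX : MemLp (V g M (X g M u)) 2 (volSM g M)) :
    MemLp (X g M (V g M u)) 2 (volSM g M) ∧
    MemLp (X g M u) 2 (volSM g M) ∧
    MemLp (V g M u) 2 (volSM g M) ∧
    MemLp (V g M u) 2 (volBdrySM g M) ∧
    ∫ p, (V g M (X g M u) p) ^ 2 ∂(volSM g M) =
      ∫ p, (X g M (V g M u) p) ^ 2 ∂(volSM g M)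
      + ∫ p, (X g M u p) ^ 2 ∂(volSM g M)
      - ∫ p, gaussCurvature g p.1 * V g M u p * V g M u p ∂(volSM g M)
      - ∫ p, signedCurvature g M p.1 * V g M u p * V g M u p ∂(volBdrySM g M) := by
  have := h.isFiniteMeasure_areaMeasure
  obtain ⟨Ba, -, hBa⟩ := h.exists_bound_horDeriv h.continuousOn_angVec
  obtain ⟨Bc, -, hBc⟩ := h.exists_bound_V
  have mX : MemLp (X g M u) 2 (volSM g M) :=
    h.memLp_volSM h.contDiffOn_homExt_X.continuousOn hBa
  have mV : MemLp (V g M u) 2 (volSM g M) :=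
    h.memLp_volSM h.contDiffOn_homExt_V.continuousOn hBc
  have hint : ∀ᵐ p ∂(volSM g M), p ∈ M ×ˢ (Set.univ : Set Plane) := by
    refine ae_map_angleParam h.metric h.isClosed_domain h.subset h.ae_areaMeasure'
      (h.isClosed_domain.measurableSet.prod MeasurableSet.univ) ?_
    filter_upwards [ae_prod_fst h.ae_areaMeasure'] with q hq using ⟨hq, trivial⟩
  have hKM := h.continuousOn_gaussCurvature.mono h.subset
  have hKm : AEStronglyMeasurable (fun p : Plane × Plane => gaussCurvature g p.1)
      (volSM g M) := by
    have h1 : ContinuousOn (fun p : Plane × Plane => gaussCurvature g p.1) (M ×ˢ Set.univ) :=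
      hKM.comp continuousOn_fst fun p hp => hp.1
    have h2 := h1.aestronglyMeasurable (μ := volSM g M)
      (h.isClosed_domain.measurableSet.prod MeasurableSet.univ)
    rwa [Measure.restrict_eq_self_of_ae_mem hint] at h2
  obtain ⟨BK, hBK⟩ := h.domain.isCompact.exists_bound_of_continuousOn hKM
  have iK : Integrable (fun p => gaussCurvature g p.1 * V g M u p ^ 2) (volSM g M) :=
    mV.integrable_sq.bdd_mul hKm (c := BK) (hint.mono fun p hp => hBK _ hp.1)
  obtain ⟨oA, eA⟩ := h.integral_volSM hVX.integrable_sq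
  obtain ⟨oa, ea⟩ := h.integral_volSM mX.integrable_sq
  obtain ⟨oK, eK⟩ := h.integral_volSM iK
  have cA : ContinuousOn (fun q => V g M (X g M u) (angleParam g q) ^ 2) (interior M ×ˢ Set.univ) :=
    (h.continuousOn_comp_angleParam h.continuousOn_homExt_VX).pow 2
  have cB : ContinuousOn (fun q => X g M (V g M u) (angleParam g q) ^ 2) (interior M ×ˢ Set.univ) :=
    (h.continuousOn_comp_angleParam h.continuousOn_homExt_XV).pow 2
  have ca : ContinuousOn (fun q => X g M u (angleParam g q) ^ 2) (interior M ×ˢ Set.univ) :=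
    h.contDiffOn_X.continuousOn.pow 2
  have cK : ContinuousOn (fun q : Plane × ℝ => gaussCurvature g q.1 * V g M u (angleParam g q) ^ 2)
      (interior M ×ˢ Set.univ) :=
    (h.continuousOn_gaussCurvature.comp continuousOn_fst
      fun q hq => h.subset (interior_subset hq.1)).mul (h.contDiffOn_V.continuousOn.pow 2)
  have hdiv : ∀ x ∈ interior M, pd 0 (flux g M u 0) x + pd 1 (flux g M u 1) x =
      Real.sqrt (g x).det * (∫ θ in (0)..(2 * Real.pi), V g M (X g M u) (angleParam g (x, θ)) ^ 2)
      - Real.sqrt (g x).det * (∫ θ in (0)..(2 * Real.pi), X g M (V g M u) (angleParam g (x, θ)) ^ 2)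
      - Real.sqrt (g x).det * (∫ θ in (0)..(2 * Real.pi), X g M u (angleParam g (x, θ)) ^ 2)
      + Real.sqrt (g x).det * (∫ θ in (0)..(2 * Real.pi),
        gaussCurvature g (angleParam g (x, θ)).1 * V g M u (angleParam g (x, θ)) ^ 2) := by
    intro x hx
    have jA := (continuous_section cA hx).intervalIntegrable (μ := volume) 0 (2 * Real.pi)
    have jB := (continuous_section cB hx).intervalIntegrable (μ := volume) 0 (2 * Real.pi)
    have ja := (continuous_section ca hx).intervalIntegrable (μ := volume) 0 (2 * Real.pi)
    have jK := (continuous_section cK hx).intervalIntegrable (μ := volume) 0 (2 * Real.pi)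
    rw [h.divergence_flux hx, intervalIntegral.integral_add ((jA.sub jB).sub ja) jK,
      intervalIntegral.integral_sub (jA.sub jB) ja, intervalIntegral.integral_sub jA jB]
    simp only [angleParam]
    ring
  have hnonneg : ∀ (x : Plane) (f : ℝ → ℝ),
      0 ≤ Real.sqrt (g x).det * ∫ θ in (0)..(2 * Real.pi), f θ ^ 2 := fun x f =>
    mul_nonneg (Real.sqrt_nonneg _)
      (intervalIntegral.integral_nonneg (by positivity) fun θ _ => sq_nonneg _)
  obtain ⟨oD, eD⟩ := h.domain.divergence h.isOpen h.metric h.subset (W := flux g M u)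
    (Q := fun y => Real.sqrt (g y).det *
        (∫ θ in (0)..(2 * Real.pi), V g M (X g M u) (angleParam g (y, θ)) ^ 2)
        + Real.sqrt (g y).det * (∫ θ in (0)..(2 * Real.pi),
        gaussCurvature g (angleParam g (y, θ)).1 * V g M u (angleParam g (y, θ)) ^ 2))
    h.continuousOn_flux (fun i y hy => (h.pd_flux i i hy).1) (fun i => h.continuousOn_pd_flux i i)
    (fun y hy => by
      rw [hdiv y hy]
      have h1 := hnonneg y fun θ => X g M (V g M u) (angleParam g (y, θ))
      have h2 := hnonneg y fun θ => X g M u (angleParam g (y, θ))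
      linarith)
    (oA.add oK)
  have oB : IntegrableOn (fun x => Real.sqrt (g x).det *
      ∫ θ in (0)..(2 * Real.pi), X g M (V g M u) (angleParam g (x, θ)) ^ 2) (interior M) := by
    refine IntegrableOn.congr_fun (((oA.sub oa).add oK).sub oD) (fun x hx => ?_)
      isOpen_interior.measurableSet
    simp only [Pi.sub_apply, Pi.add_apply]
    rw [hdiv x hx]
    ring
  have mB := h.integrable_sq_volSM h.continuousOn_homExt_XV oB
  obtain ⟨-, eB⟩ := h.integral_volSM mB.integrable_sq
  refine ⟨mB, mX, mV, h.memLp_V_volBdrySM, ?_⟩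
  have hbdry : ∫ y, (flux g M u 0 y * bdryTangent g M y 1 - flux g M u 1 y * bdryTangent g M y 0)
      ∂(lengthMeasure g M) =
      -∫ p, signedCurvature g M p.1 * V g M u p * V g M u p ∂(volBdrySM g M) := by
    rw [h.integral_curvature_volBdrySM, ← integral_neg]
    refine integral_congr_ae ?_
    filter_upwards [ae_lengthMeasure g M] with x hx using h.flux_boundary hx
  have hKeq : ∫ p, gaussCurvature g p.1 * V g M u p * V g M u p ∂(volSM g M) =
      ∫ p, gaussCurvature g p.1 * V g M u p ^ 2 ∂(volSM g M) :=
    integral_congr_ae (Filter.Eventually.of_forall fun p => by simp only; ring)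
  have hsum : ∫ y in interior M, (pd 0 (flux g M u 0) y + pd 1 (flux g M u 1) y) =
      ∫ p, V g M (X g M u) p ^ 2 ∂(volSM g M) - ∫ p, X g M (V g M u) p ^ 2 ∂(volSM g M)
      - ∫ p, X g M u p ^ 2 ∂(volSM g M)
      + ∫ p, gaussCurvature g p.1 * V g M u p ^ 2 ∂(volSM g M) := by
    rw [setIntegral_congr_fun isOpen_interior.measurableSet hdiv, eA, eB, ea, eK]
    refine (integral_add ((oA.sub oB).sub oa) oK).trans (congrArg₂ (· + ·) ?_ rfl)
    exact (integral_sub (oA.sub oB) oa).trans (congrArg₂ (· - ·) (integral_sub oA oB) rfl)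
  rw [hKeq]
  linarith

end IsAdmissible

end Pestov
end

theorem lemma3p1 (g : MetricField) (c : Plane) (r : ℝ) (M E R : Set Plane)
    (hg : IsRiemannianMetricOn g (Metric.ball c r))
    (hM : IsCompactSmoothDomain M) (hMD : M ⊆ Metric.ball c r)
    (hE : IsClosed E) (hR : IsClosed R) (hER : Disjoint E R) (hbd : E ∪ R = frontier M)
    (u : Plane × Plane → ℝ)
    (hu0 : ContinuousOn u (unitBundle g M))
    (huLip : ∃ C : NNReal, LipschitzOnWith C u (unitBundle g M))
    (hu1 : ContDiffSM g M 1 (tangentialPart g M R) u)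
    (hu2 : ContDiffSM g M 2 (unitBundle g R) u)
    (hρ : ∀ p ∈ unitBundle g (frontier M), u p = u (reflection g M p))
    (hVX : MemLp (V g M (X g M u)) 2 (volSM g M)) :
    MemLp (X g M (V g M u)) 2 (volSM g M) ∧
    MemLp (X g M u) 2 (volSM g M) ∧
    MemLp (V g M u) 2 (volSM g M) ∧
    MemLp (V g M u) 2 (volBdrySM g M) ∧
    ∫ p, (V g M (X g M u) p) ^ 2 ∂(volSM g M) =
      ∫ p, (X g M (V g M u) p) ^ 2 ∂(volSM g M)
      + ∫ p, (X g M u p) ^ 2 ∂(volSM g M)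
      - ∫ p, gaussCurvature g p.1 * V g M u p * V g M u p ∂(volSM g M)
      - ∫ p, signedCurvature g M p.1 * V g M u p * V g M u p ∂(volBdrySM g M) := by
  exact IsAdmissible.pestov_identity (D := Metric.ball c r) (R := R)
    { isOpen := Metric.isOpen_ball
      metric := hg
      domain := hM
      subset := hMD
      isClosed := hR
      subset_frontier := hbd ▸ Set.subset_union_right
      lipschitz := huLip
      contDiff_one := hu1
      contDiff_two := hu2
      reflection := hρ } hVX
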